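/- For $0<\theta<\pi$ let $\Omega_\theta=\{z\in\mathbb C: 0<\arg z<\theta\}$, let $\sigma$ be arc length on $\partial\Omega_\theta$, and let $L_2=L_2(\partial\Omega_\theta,\sigma;\mathbb C)$, regarded as a real Banach space. All operators are real linear and norms are operator norms. Let $$Ef(z)=\frac1{\pi i}\,\mathrm{p.v.}\!\int_{\partial\Omega_\theta}\frac{f(w)}{w-z}\,dw=\lim_{\varepsilon\to0^+}\frac1{\pi i}\int_{\{w\in\partial\Omega_\theta:\,|w-z|>\varepsilon\}}\frac{f(w)}{w-z}\,dw$$ be the principal value Cauchy integral, with $\partial\Omega_\theta$ oriented so that $\Omega_\theta$ lies on its left, and let $Nf=\overline f$. Put $E^+=\frac12(I+E)$ and $N^+=\frac12(I+N)$, with ranges $E^+L_2$ (the interior Hardy space) and $N^+L_2$ (the real valued functions), and let $K:N^+L_2\to N^+L_2$, $Kf=\mathrm{Re}(Ef)$, be the double layer potential operator. For all sufficiently small $\theta>0$: for every $f\in L_2$ the limit $Ef(z)$ exists for almost every $z\in\partial\Omega_\theta$, $E$ is a bounded operator on $L_2$ with $E^2=I$, and the three operators $$I+K:N^+L_2\to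 N^+L_2,\qquad N^+:E^+L_2\to N^+L_2,\qquad E^+:N^+L_2\to E^+L_2$$ (the double layer equation, the Dirichlet map and the classical ansatz) are invertible with bounded inverses. As $\theta\to0^+$, $$\|(I+K)^{-1}\|\approx\frac1{\theta^2},\qquad \|(N^+:E^+L_2\to N^+L_2)^{-1}\|\approx\frac1\theta,\qquad \|(E^+:N^+L_2\to E^+L_2)^{-1}\|\approx\frac1\theta .$$ Moreover $\|E\|$, $\|N\|$ and $\|K\|$ remain bounded as $\theta\to0^+$, and the condition numbers $\kappa(T)=\|T\|\,\|T^{-1}\|$ satisfy $\kappa(I+K)\approx1/\theta^2$, while $\kappa(N^+:E^+L_2\to N^+L_2)\approx1/\theta$ and $\kappa(E^+:N^+L_2\to E^+L_2)\approx1/\theta$; so the double layer equation is worse conditioned than the boundary value problem it is used to solve. Here $a(\theta)\approx b(\theta)$ means that there are constants $0<c\le C<\infty$, independent of $\theta$, such that $c\,b(\theta)\le a(\theta)\le C\,b(\theta)$ for all sufficiently small $\theta>0$. -/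

import Mathlib

open MeasureTheory Filter Topology Asymptotics

noncomputable section

namespace ConeCauchy

/-- The open planar cone `{0 < arg z < θ}`.  As `Complex.arg` takes values in `(-π, π]`, this is the
cone with opening angle `θ` when `0 < θ ≤ π`; only small `θ` are used. -/
def cone (θ : ℝ) : Set ℂ := {z | 0 < z.arg ∧ z.arg < θ}

/-- Arc length on the boundary of the cone. -/
def arcLength (θ : ℝ) : Measure ℂ := (Measure.hausdorffMeasure 1).restrict (frontier (cone θ))

/-- The unit tangent of the boundary, oriented so that the cone lies to the left: `1` along the
edge on the positive real axis and `-exp (iθ)` along the other edge. -/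
def tangent (θ : ℝ) (w : ℂ) : ℂ := if w.arg = 0 then 1 else -Complex.exp (θ * Complex.I)

/-- The complex valued square integrable functions on the boundary of the cone. -/
abbrev BdryL2 (θ : ℝ) : Type := Lp ℂ 2 (arcLength θ)

/-- The truncated Cauchy integral `(π i)⁻¹ ∫_{|w - z| > ε} f(w) (w - z)⁻¹ dw`, where
`dw = tangent w d(arcLength)`. -/
def truncCauchy (θ ε : ℝ) (f : ℂ → ℂ) (z : ℂ) : ℂ :=
  1 / (Real.pi * Complex.I) *
    ∫ w in {w : ℂ | ε < ‖w - z‖}, f w / (w - z) * tangent θ w ∂(arcLength θ)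

/-- `g` is the principal value Cauchy integral of `f`: at almost every boundary point `z` the
truncated integrals converge to `g z` as `ε → 0⁺`. -/
def IsPVCauchy (θ : ℝ) (f g : BdryL2 θ) : Prop :=
  ∀ᵐ z ∂(arcLength θ), Tendsto (fun ε : ℝ => truncCauchy θ ε f z) (𝓝[>] 0) (𝓝 (g z))

/-- The Cauchy singular integral operator `E`, the bounded operator sending every `f` to its
principal value Cauchy integral.  There is at most one such operator; that there is one is part
of the theorem. -/
def cauchyOp (θ : ℝ) : BdryL2 θ →L[ℝ] BdryL2 θ :=
  Classical.epsilon fun T : BdryL2 θ →L[ℝ] BdryL2 θ => ∀ f, IsPVCauchy θ f (T f)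

/-- The operator `N` of pointwise complex conjugation. -/
def conjOp (θ : ℝ) : BdryL2 θ →L[ℝ] BdryL2 θ :=
  (Complex.conjCLE : ℂ →L[ℝ] ℂ).compLpL 2 (arcLength θ)

section Reflections

variable {H : Type*} [NormedAddCommGroup H] [NormedSpace ℝ H]

/-- The spectral projection `R⁺ = (I + R) / 2` of a reflection operator `R`. -/
def plusProj (R : H →L[ℝ] H) : H →L[ℝ] H := (1 / 2 : ℝ) • (ContinuousLinearMap.id ℝ H + R)

/-- The range `R⁺H`. -/
def plusSpace (R : H →L[ℝ] H) : Submodule ℝ H := (plusProj R).range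

/-- The restricted projection `S⁺ : R⁺H → S⁺H`. -/
def plusRestrict (R S : H →L[ℝ] H) : plusSpace R →L[ℝ] plusSpace S :=
  ((plusProj S).comp (plusSpace R).subtypeL).codRestrict (plusSpace S)
    fun f => ⟨(f : H), rfl⟩

/-- The compression `f ↦ S⁺ (T f)` of an operator `T` to the subspace `S⁺H`. -/
def compression (S T : H →L[ℝ] H) : plusSpace S →L[ℝ] plusSpace S :=
  ((plusProj S).comp (T.comp (plusSpace S).subtypeL)).codRestrict (plusSpace S)
    fun f => ⟨T (f : H), rfl⟩

end Reflections

/-- The condition number `‖T‖ ‖T⁻¹‖` of an invertible operator. -/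
def condNumber {X Y : Type*} [NormedAddCommGroup X] [NormedSpace ℝ X] [NormedAddCommGroup Y]
    [NormedSpace ℝ Y] (T : X →L[ℝ] Y) : ℝ := ‖T‖ * ‖T.inverse‖

/-- The subspace `N⁺L₂` of real valued functions. -/
abbrev RealL2 (θ : ℝ) : Submodule ℝ (BdryL2 θ) := plusSpace (conjOp θ)

/-- The interior Hardy space `E⁺L₂`. -/
abbrev HardyL2 (θ : ℝ) : Submodule ℝ (BdryL2 θ) := plusSpace (cauchyOp θ)

/-- The double layer potential operator `K f = Re (E f)` on real valued functions. -/
def doubleLayer (θ : ℝ) : RealL2 θ →L[ℝ] RealL2 θ := compression (conjOp θ) (cauchyOp θ)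

/-- The operator `I + K` of the double layer equation. -/
def layerEq (θ : ℝ) : RealL2 θ →L[ℝ] RealL2 θ :=
  ContinuousLinearMap.id ℝ (RealL2 θ) + doubleLayer θ

/-- The Dirichlet map `N⁺ : E⁺L₂ → N⁺L₂`. -/
def dirichletMap (θ : ℝ) : HardyL2 θ →L[ℝ] RealL2 θ := plusRestrict (cauchyOp θ) (conjOp θ)

/-- The classical ansatz `E⁺ : N⁺L₂ → E⁺L₂`. -/
def ansatzMap (θ : ℝ) : RealL2 θ →L[ℝ] HardyL2 θ := plusRestrict (conjOp θ) (cauchyOp θ)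

end ConeCauchy

end

/-!
# Conditioning of the double layer equation on a thin cone

Parametrise the boundary of the cone by arc length `t ∈ ℝ`, with the edge on the real axis for
`t > 0` and the other edge for `t < 0` (`edge`). The Cauchy operator `E` becomes an operator on
`L²(ℝ)` (`flatCauchy`): within an edge it is the Hilbert transform, and from the opposite edge it
has the smooth kernel `(π i)⁻¹ (s - q(t))⁻¹`, where `q = oppPole θ` traces two rays in the upper
half plane.

*Existence and boundedness of `E`.* The Hilbert transform is the reflection that belongs to the
orthogonal projection onto the Hardy space of the half plane, and its principal values exist at
Lebesgue points (`ae_tendsto_truncated_integral`). The opposite edge contributes the values along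
`q` of a Cauchy integral, which is the Poisson integral of a Cauchy projection; the Poisson kernel
along a ray is nonnegative and homogeneous, and Schur's test with the weight `|s|^(-1/2)` bounds it.
For the double layer potential `K`, whose kernel connects opposite edges only, the test gives
`‖K‖ ≤ cos (θ/2) < 1` (`norm_flatDoubleLayer_le`), so that `I + K` is invertible by a Neumann
series.

*`E² = I`.* The operator `E` is skew for the pairing `∫ f g dz` (`flatPairing_flatCauchy`). The
functions `z ↦ (z - a)⁻¹` with `a` off the boundary are eigenfunctions with eigenvalue `±1`, by
explicit integration (`flatCauchy_coneRes`), and they separate points for the pairing by the jump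
relation. Skewness moves `E²` onto them.

*Upper bounds for the inverses.* If `E F = ± F`, skewness gives `∫ F² dz = 0`. Multiply by
`exp (-iθ/2)` and take imaginary parts: as the tangent then has imaginary part `- sin (θ/2)` on both
edges, this is the Rellich identity `sin (θ/2) ∫ (u² - v²) = O(‖u‖ ‖v‖)` for `F = u + i v`, by which
`u` and `v` control each other with a constant of order `1/θ`
(`sin_mul_norm_le_of_flatPairing_eq_zero`). This bounds the inverse of the Dirichlet map, and that
of the ansatz, since the two Hardy components of a real function have opposite imaginary parts. The
factorisation `I + K = 2 N⁺ E⁺` on real functions then yields both invertibility and the bound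
`O(1/θ²)` for the inverse of `I + K`.

*Lower bounds.* The odd function `sgn s |s|^(-1/2)` is a formal eigenfunction of `K` with eigenvalue
`- cos (θ/2)`; truncated to a long interval it gives `‖f + K f‖ ≤ θ² ‖f‖`
(`exists_norm_add_flatDoubleLayer_le`). Hence the inverse of `I + K` has norm at least `1/θ²`, and
by the factorisation and the upper bounds `O(1/θ)` for the other two inverses, each of these has
norm at least a multiple of `1/θ`. Since `I + K` does not shrink nonnegative functions, the norms of
all three operators are bounded from above and below, and the condition numbers follow.
-/

namespace ConeCauchy

/-! ### Lebesgue points and the Poisson kernel -/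

/-- The Poisson kernel is dominated by a dyadic sum of normalised indicators of balls. -/
theorem poisson_le_dyadic_sum {ε : ℝ} (hε : 0 < ε) (t s : ℝ) :
    ENNReal.ofReal (ε / ((s - t) ^ 2 + ε ^ 2)) ≤
      ∑' n : ℕ, (Metric.closedBall t (2 ^ n * ε)).indicator
        (fun _ => ENNReal.ofReal (4 / (4 ^ n * ε))) s := by
  have hex : ∃ n : ℕ, |s - t| ≤ 2 ^ n * ε := by
    obtain ⟨n, hn⟩ := pow_unbounded_of_one_lt (|s - t| / ε) (one_lt_two (α := ℝ))
    exact ⟨n, by rw [div_lt_iff₀ hε] at hn; exact hn.le⟩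
  classical
  -- The first dyadic ball that contains `s` already gives a large enough term.
  set n := Nat.find hex with hn
  have h1 : |s - t| ≤ 2 ^ n * ε := Nat.find_spec hex
  refine le_trans ?_ (ENNReal.le_tsum n)
  rw [Set.indicator_of_mem (by rw [Metric.mem_closedBall, Real.dist_eq]; exact h1)]
  apply ENNReal.ofReal_le_ofReal
  rw [div_le_div_iff₀ (by positivity) (by positivity)]
  rcases Nat.eq_zero_or_pos n with h0 | h0
  · rw [h0]; nlinarith [sq_nonneg (s - t), hε, sq_nonneg ε]
  · obtain ⟨m, hm⟩ : ∃ m, n = m + 1 := ⟨n - 1, by omega⟩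
    have h2 : 2 ^ m * ε < |s - t| := by
      have := Nat.find_min hex (m := m) (by omega)
      exact not_le.mp this
    have h3 : (2 ^ m * ε) ^ 2 ≤ (s - t) ^ 2 := by
      rw [← sq_abs (s - t)]; exact pow_le_pow_left₀ (by positivity) h2.le 2
    have h4 : ((2:ℝ) ^ m * ε) ^ 2 = 4 ^ m * ε ^ 2 := by
      rw [mul_pow, ← pow_mul, mul_comm m 2, pow_mul]; norm_num
    rw [h4] at h3
    rw [hm, pow_succ]
    nlinarith [sq_nonneg ε]

/-- At almost every point, the Poisson means of the oscillation of an `L²` function tend to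
zero: the point can be any Lebesgue point. -/
theorem ae_tendsto_lintegral_poisson {f : ℝ → ℂ} (hf : MemLp f 2 volume) :
    ∀ᵐ t : ℝ, Tendsto (fun ε : ℝ => ∫⁻ s, ‖f s - f t‖ₑ * ENNReal.ofReal (ε / ((s - t) ^ 2 + ε ^ 2)))
      (𝓝[>] 0) (𝓝 0) := by
  have hloc : LocallyIntegrable f volume := hf.locallyIntegrable (by norm_num)
  filter_upwards [IsUnifLocDoublingMeasure.ae_tendsto_average_norm_sub volume hloc 1] with t ht
  -- The averages `a r` of the oscillation over balls tend to `0` and are bounded; the Poisson means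
  -- are dominated by a convergent dyadic sum of such averages.
  let a : ℝ → ENNReal := fun r =>
    (∫⁻ s in Metric.closedBall t r, ‖f s - f t‖ₑ) / ENNReal.ofReal (2 * r)
  have ha : Tendsto a (𝓝[>] 0) (𝓝 0) := by
    have h := ht (l := 𝓝[>] (0:ℝ)) (fun _ => t) id tendsto_id
      (eventually_of_mem self_mem_nhdsWithin fun r (hr : 0 < r) => by
        simpa using hr.le)
    have h2 := ENNReal.tendsto_ofReal h
    rw [ENNReal.ofReal_zero] at h2
    refine h2.congr' ?_
    filter_upwards [self_mem_nhdsWithin] with r (hr : 0 < r)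
    have hint : IntegrableOn (fun s => f s - f t) (Metric.closedBall t r) volume :=
      (hloc.integrableOn_isCompact (isCompact_closedBall t r)).sub
        (integrableOn_const (by rw [Real.volume_closedBall]; exact ENNReal.ofReal_ne_top))
    simp only [id]
    rw [setAverage_eq, smul_eq_mul, ENNReal.ofReal_mul (by positivity),
      ofReal_integral_norm_eq_lintegral_enorm hint]
    simp only [measureReal_def, Real.volume_closedBall]
    rw [ENNReal.toReal_ofReal (by positivity), ENNReal.ofReal_inv_of_pos (by positivity)]
    exact ENNReal.div_eq_inv_mul.symm
  -- Near `0` the bound comes from the limit, for large radii from square integrability.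
  obtain ⟨M, hM, hMa⟩ : ∃ M : ENNReal, M ≠ ⊤ ∧ ∀ r : ℝ, 0 < r → a r ≤ M := by
    obtain ⟨δ, hδ, hδ1⟩ : ∃ δ > 0, ∀ r, 0 < r → r < δ → a r ≤ 1 := by
      have := ha.eventually (ge_mem_nhds (show (0:ENNReal) < 1 by simp))
      rw [eventually_nhdsWithin_iff, Metric.eventually_nhds_iff] at this
      obtain ⟨δ, hδ, h⟩ := this
      exact ⟨δ, hδ, fun r hr hrδ => h (by simpa [abs_of_pos hr] using hrδ) hr⟩
    have hF : ∫⁻ s, ‖f s‖ₑ ^ 2 ≠ ⊤ := by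
      have := (memLp_two_iff_integrable_sq_norm hf.1).1 hf
      have := this.2
      rw [hasFiniteIntegral_iff_enorm] at this
      simpa using this.ne
    refine ⟨1 + ((∫⁻ s, ‖f s‖ₑ ^ 2) / ENNReal.ofReal (2 * δ) + (1 + ‖f t‖ₑ)), ?_, fun r hr => ?_⟩
    · simp [ENNReal.div_eq_top, hF, hδ]
    · rcases lt_or_ge r δ with h | h
      · exact (hδ1 r hr h).trans le_self_add
      · refine le_trans ?_ le_add_self
        have h1 : ∀ s, ‖f s - f t‖ₑ ≤ ‖f s‖ₑ ^ 2 + (1 + ‖f t‖ₑ) := fun s => by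
          refine (enorm_sub_le).trans ?_
          rw [← add_assoc]
          gcongr
          rcases le_total ‖f s‖ₑ 1 with h | h
          · exact h.trans le_add_self
          · refine le_trans ?_ le_self_add
            rw [sq]; exact le_mul_of_one_le_left zero_le h
        have h2 : ∫⁻ s in Metric.closedBall t r, ‖f s - f t‖ₑ ≤
            (∫⁻ s, ‖f s‖ₑ ^ 2) + (1 + ‖f t‖ₑ) * ENNReal.ofReal (2 * r) := by
          refine (lintegral_mono h1).trans ?_
          rw [lintegral_add_right _ measurable_const, setLIntegral_const, Real.volume_closedBall]
          gcongr
          exact Measure.restrict_le_self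
        have hr2 : ENNReal.ofReal (2 * r) ≠ 0 := by simpa using hr
        calc a r ≤ ((∫⁻ s, ‖f s‖ₑ ^ 2) + (1 + ‖f t‖ₑ) * ENNReal.ofReal (2 * r)) /
              ENNReal.ofReal (2 * r) := by
                exact ENNReal.div_le_div_right h2 _
          _ = (∫⁻ s, ‖f s‖ₑ ^ 2) / ENNReal.ofReal (2 * r) + (1 + ‖f t‖ₑ) := by
                rw [ENNReal.add_div, ENNReal.mul_div_cancel_right hr2 ENNReal.ofReal_ne_top]
          _ ≤ _ := by gcongr
  have hsum : Tendsto (fun ε : ℝ => ∑' n : ℕ, ENNReal.ofReal (8 / 2 ^ n) * a (2 ^ n * ε))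
      (𝓝[>] 0) (𝓝 0) := by
    have h0 : Tendsto (fun ε : ℝ => ∫⁻ n, ENNReal.ofReal (8 / 2 ^ n) * a (2 ^ n * ε)
        ∂(Measure.count : Measure ℕ)) (𝓝[>] 0) (𝓝 (∫⁻ _, 0 ∂(Measure.count : Measure ℕ))) := by
      refine tendsto_lintegral_filter_of_dominated_convergence
        (fun n : ℕ => ENNReal.ofReal (8 / 2 ^ n) * M) ?_ ?_ ?_ ?_
      · exact Eventually.of_forall fun _ => Measurable.of_discrete
      · filter_upwards [self_mem_nhdsWithin] with ε (hε : 0 < ε)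
        exact Eventually.of_forall fun n => mul_le_mul_right (hMa _ (by positivity)) _
      · rw [lintegral_count, ENNReal.tsum_mul_right]
        refine ENNReal.mul_ne_top ?_ hM
        have : Summable fun n : ℕ => (8:ℝ) / 2 ^ n := by
          simpa [div_eq_mul_inv] using (summable_geometric_two).mul_left (8:ℝ)
        rw [← ENNReal.ofReal_tsum_of_nonneg (fun n => by positivity) this]
        exact ENNReal.ofReal_ne_top
      · refine Eventually.of_forall fun n => ?_
        have h1 : Tendsto (fun ε : ℝ => 2 ^ n * ε) (𝓝[>] 0) (𝓝[>] 0) := by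
          refine tendsto_nhdsWithin_iff.2 ⟨?_, ?_⟩
          · have : Tendsto (fun ε : ℝ => 2 ^ n * ε) (𝓝 0) (𝓝 (2 ^ n * 0)) :=
              (continuous_const.mul continuous_id).tendsto _
            rw [mul_zero] at this
            exact this.mono_left nhdsWithin_le_nhds
          · filter_upwards [self_mem_nhdsWithin] with ε (hε : 0 < ε)
            exact Set.mem_Ioi.2 (by positivity)
        have := ENNReal.Tendsto.const_mul (a := ENNReal.ofReal (8 / 2 ^ n)) (ha.comp h1)
          (Or.inr ENNReal.ofReal_ne_top)
        simpa using this
    simpa [lintegral_count] using h0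
  refine tendsto_of_tendsto_of_tendsto_of_le_of_le' tendsto_const_nhds hsum
    (Eventually.of_forall fun _ => zero_le) ?_
  filter_upwards [self_mem_nhdsWithin] with ε (hε : 0 < ε)
  have hm : AEMeasurable (fun s => ‖f s - f t‖ₑ) volume :=
    (hf.1.sub aestronglyMeasurable_const).enorm
  calc ∫⁻ s, ‖f s - f t‖ₑ * ENNReal.ofReal (ε / ((s - t) ^ 2 + ε ^ 2))
      ≤ ∫⁻ s, ∑' n : ℕ, ‖f s - f t‖ₑ * (Metric.closedBall t (2 ^ n * ε)).indicator
        (fun _ => ENNReal.ofReal (4 / (4 ^ n * ε))) s := by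
        refine lintegral_mono fun s => ?_
        rw [ENNReal.tsum_mul_left]
        exact mul_le_mul_right (poisson_le_dyadic_sum hε t s) _
    _ = ∑' n : ℕ, ∫⁻ s, ‖f s - f t‖ₑ * (Metric.closedBall t (2 ^ n * ε)).indicator
        (fun _ => ENNReal.ofReal (4 / (4 ^ n * ε))) s :=
        lintegral_tsum fun n => hm.mul
          (measurable_const.indicator Metric.isClosed_closedBall.measurableSet).aemeasurable
    _ ≤ _ := by
        refine ENNReal.tsum_le_tsum fun n => le_of_eq ?_
        have h1 : ∀ s, ‖f s - f t‖ₑ * (Metric.closedBall t (2 ^ n * ε)).indicator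
            (fun _ => ENNReal.ofReal (4 / (4 ^ n * ε))) s =
            (Metric.closedBall t (2 ^ n * ε)).indicator
              (fun s => ‖f s - f t‖ₑ * ENNReal.ofReal (4 / (4 ^ n * ε))) s := fun s => by
          by_cases hs : s ∈ Metric.closedBall t (2 ^ n * ε) <;> simp [hs]
        simp_rw [h1]
        rw [lintegral_indicator Metric.isClosed_closedBall.measurableSet,
          lintegral_mul_const' _ _ ENNReal.ofReal_ne_top]
        have h2 : (0:ℝ) < 2 * (2 ^ n * ε) := by positivity
        have h3 : ENNReal.ofReal (4 / (4 ^ n * ε)) =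
            ENNReal.ofReal (8 / 2 ^ n) / ENNReal.ofReal (2 * (2 ^ n * ε)) := by
          rw [← ENNReal.ofReal_div_of_pos h2]
          congr 1
          have : (4:ℝ) ^ n = 2 ^ n * 2 ^ n := by rw [← mul_pow]; norm_num
          rw [this]; field_simp; norm_num
        rw [h3]
        simp only [a, ENNReal.div_eq_inv_mul]
        ring

/-! ### The Cauchy kernel and the Cauchy projection on the line -/

/-- The Cauchy kernel `s ↦ (s - z)⁻¹` on the real line. -/
noncomputable def res (z : ℂ) (s : ℝ) : ℂ := ((s : ℂ) - z)⁻¹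

theorem ofReal_sub_ne_zero {z : ℂ} (hz : z.im ≠ 0) (s : ℝ) : (s : ℂ) - z ≠ 0 := by
  intro h
  apply hz
  have := congrArg Complex.im h
  simpa using this

theorem measurable_res (z : ℂ) : Measurable (res z) :=
  (Complex.measurable_ofReal.sub_const z).inv

theorem norm_ofReal_sub_sq (z : ℂ) (s : ℝ) :
    ‖(s : ℂ) - z‖ ^ 2 = (s - z.re) ^ 2 + z.im ^ 2 := by
  rw [← Complex.normSq_eq_norm_sq, Complex.normSq_apply]
  simp
  ring

theorem norm_res_sq (z : ℂ) (s : ℝ) : ‖res z s‖ ^ 2 = ((s - z.re) ^ 2 + z.im ^ 2)⁻¹ := by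
  rw [res, norm_inv, inv_pow, norm_ofReal_sub_sq]

theorem integrable_poisson (x : ℝ) {y : ℝ} (hy : y ≠ 0) :
    Integrable fun s : ℝ => ((s - x) ^ 2 + y ^ 2)⁻¹ := by
  have h := ((integrable_inv_one_add_sq.comp_div hy).comp_sub_right x).const_mul (y ^ 2)⁻¹
  refine h.congr (Eventually.of_forall fun s => ?_)
  simp only
  rw [← mul_inv]
  congr 1
  field_simp
  ring

theorem integral_poisson (x : ℝ) {y : ℝ} (hy : 0 < y) :
    ∫ s : ℝ, ((s - x) ^ 2 + y ^ 2)⁻¹ = Real.pi / y := by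
  have h : ∀ s : ℝ, ((s - x) ^ 2 + y ^ 2)⁻¹ = (y ^ 2)⁻¹ * (1 + ((s - x) / y) ^ 2)⁻¹ := fun s => by
    rw [← mul_inv]
    congr 1
    field_simp
    ring
  simp_rw [h]
  rw [integral_const_mul, integral_sub_right_eq_self (fun s => (1 + (s / y) ^ 2)⁻¹) x,
    Measure.integral_comp_div (fun s => (1 + s ^ 2)⁻¹) y, integral_univ_inv_one_add_sq,
    abs_of_pos hy,
    smul_eq_mul]
  field_simp

theorem memLp_res {z : ℂ} (hz : z.im ≠ 0) : MemLp (res z) 2 volume := by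
  rw [memLp_two_iff_integrable_sq_norm (measurable_res z).aestronglyMeasurable]
  simp_rw [norm_res_sq]
  exact integrable_poisson _ hz

theorem conj_res (z : ℂ) (s : ℝ) : (starRingEnd ℂ) (res z s) = res ((starRingEnd ℂ) z) s := by
  simp [res, map_inv₀]

theorem res_sub_res {z w : ℂ} (hz : z.im ≠ 0) (hw : w.im ≠ 0) (s : ℝ) :
    res z s - res w s = (z - w) * (res z s * res w s) := by
  have h1 := ofReal_sub_ne_zero hz s
  have h2 := ofReal_sub_ne_zero hw s
  simp only [res]
  field_simp
  ring

theorem hasDerivAt_ofReal_sub (z : ℂ) (s : ℝ) : HasDerivAt (fun s : ℝ => (s : ℂ) - z) 1 s :=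
  (HasDerivAt.ofReal_comp (hasDerivAt_id s)).sub_const z

theorem tendsto_res_atTop (z : ℂ) : Tendsto (res z) atTop (𝓝 0) := by
  have h : Tendsto (fun s : ℝ => (s : ℂ) - z) atTop (Bornology.cobounded ℂ) := by
    rw [← tendsto_norm_atTop_iff_cobounded]
    refine tendsto_atTop_mono (f := fun s : ℝ => s - ‖z‖) (fun s => ?_)
      (tendsto_atTop_add_const_right _ _ tendsto_id)
    refine le_trans ?_ (norm_sub_norm_le _ _)
    simpa using le_abs_self s
  exact tendsto_inv₀_cobounded.comp h

theorem tendsto_res_atBot (z : ℂ) : Tendsto (res z) atBot (𝓝 0) := by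
  have h := ((tendsto_res_atTop (-z)).comp tendsto_neg_atBot_atTop).neg
  rw [neg_zero] at h
  refine h.congr fun s => ?_
  simp only [res, Function.comp, Complex.ofReal_neg, ← inv_neg]
  ring

/-- Two Cauchy kernels with poles in the same half plane are orthogonal for the bilinear
pairing. -/
theorem integral_res_mul_res {z w : ℂ} (hz : 0 < z.im) (hw : 0 < w.im) :
    ∫ s : ℝ, res z s * res w s = 0 := by
  have hint : Integrable fun s : ℝ => res z s * res w s :=
    (memLp_res hz.ne').integrable_mul (memLp_res hw.ne')
  rcases eq_or_ne z w with rfl | hzw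
  · have hd : ∀ s : ℝ, HasDerivAt (fun s => -res z s) (res z s * res z s) s := fun s => by
      have := ((hasDerivAt_ofReal_sub z s).inv (ofReal_sub_ne_zero hz.ne' s)).neg
      refine this.congr_deriv ?_
      simp only [res]
      have := ofReal_sub_ne_zero hz.ne' s
      field_simp
    rw [integral_of_hasDerivAt_of_tendsto hd hint (by simpa using (tendsto_res_atBot z).neg)
      (by simpa using (tendsto_res_atTop z).neg), sub_zero]
  · -- A primitive is the logarithm of `(s - z) / (s - w)`, which avoids the cut because both
    -- factors have arguments in the same half plane, and which tends to `1` at both ends.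
    let q : ℝ → ℂ := fun s => ((s : ℂ) - z) * res w s
    have hq : ∀ s, q s ∈ Complex.slitPlane := fun s => by
      by_contra h
      rw [Complex.mem_slitPlane_iff_not_le_zero, not_not, Complex.le_def] at h
      simp only [Complex.zero_re, Complex.zero_im] at h
      have h1 : (s : ℂ) - z = q s * ((s : ℂ) - w) := by
        simp only [q, res]
        rw [mul_assoc, inv_mul_cancel₀ (ofReal_sub_ne_zero hw.ne' s), mul_one]
      have h2 := congrArg Complex.im h1
      rw [Complex.mul_im, h.2] at h2
      simp at h2
      nlinarith [h.1]
    have hq1 : ∀ s, q s = 1 + (w - z) * res w s := fun s => by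
      have := ofReal_sub_ne_zero hw.ne' s
      simp only [q, res]
      field_simp
      ring
    have hd : ∀ s : ℝ, HasDerivAt (fun s => (z - w)⁻¹ * Complex.log (q s)) (res z s * res w s) s :=
      fun s => by
      have h1 : HasDerivAt q (1 * res w s + ((s : ℂ) - z) *
          (-1 / ((s : ℂ) - w) ^ 2)) s :=
        (hasDerivAt_ofReal_sub z s).mul
          ((hasDerivAt_ofReal_sub w s).inv (ofReal_sub_ne_zero hw.ne' s))
      refine ((h1.clog_real (hq s)).const_mul (z - w)⁻¹).congr_deriv ?_
      have e1 := ofReal_sub_ne_zero hz.ne' s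
      have e2 := ofReal_sub_ne_zero hw.ne' s
      have e3 := sub_ne_zero.2 hzw
      simp only [q, res]
      field_simp
      ring
    have hl : ∀ l : Filter ℝ, Tendsto (res w) l (𝓝 0) →
        Tendsto (fun s => (z - w)⁻¹ * Complex.log (q s)) l (𝓝 0) := fun l hl => by
      have h1 : Tendsto q l (𝓝 1) := by
        have := (hl.const_mul (w - z)).const_add 1
        simp only [mul_zero, add_zero] at this
        exact this.congr fun s => (hq1 s).symm
      have h2 := (h1.clog (by simp)).const_mul (z - w)⁻¹
      simpa using h2
    rw [integral_of_hasDerivAt_of_tendsto hd hint (hl _ (tendsto_res_atBot w))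
      (hl _ (tendsto_res_atTop w)), sub_zero]

/-- The complex Hilbert space `L²(ℝ)`. -/
abbrev LineL2 : Type := Lp ℂ 2 (volume : Measure ℝ)

open scoped Classical in
/-- The Cauchy kernel as an element of `L²(ℝ)`; zero when the pole `z` is real. -/
noncomputable def resL2 (z : ℂ) : LineL2 :=
  if hz : z.im ≠ 0 then (memLp_res hz).toLp (res z) else 0

theorem coeFn_resL2 {z : ℂ} (hz : z.im ≠ 0) : resL2 z =ᵐ[volume] res z := by
  rw [resL2, dif_pos hz]
  exact MemLp.coeFn_toLp _

theorem integral_mul_eq_inner {f g : LineL2} {k : ℝ → ℂ}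
    (h : ∀ᵐ s, (starRingEnd ℂ) (g s) = k s) :
    ∫ s, f s * k s = inner ℂ g f := by
  rw [L2.inner_def]
  refine integral_congr_ae ?_
  filter_upwards [h] with s hs
  rw [RCLike.inner_apply, hs]

theorem integral_mul_res (f : LineL2) {z : ℂ} (hz : z.im ≠ 0) :
    ∫ s, f s * res z s = inner ℂ (resL2 ((starRingEnd ℂ) z)) f := by
  apply integral_mul_eq_inner
  filter_upwards [coeFn_resL2 (z := (starRingEnd ℂ) z) (by simpa using hz)] with s hs
  rw [hs, conj_res, Complex.conj_conj]

/-- The Hardy space of the upper half plane, as the closed span of the Cauchy kernels with poles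
in the lower half plane. -/
noncomputable def lineHardy : Submodule ℂ LineL2 :=
  (Submodule.span ℂ (resL2 '' {z | z.im < 0})).topologicalClosure

instance : CompleteSpace lineHardy :=
  (Submodule.isClosed_topologicalClosure _).completeSpace_coe

/-- The Cauchy projection of `L²(ℝ)`: the orthogonal projection onto the Hardy space of the upper
half plane. -/
noncomputable def lineProj : LineL2 →L[ℂ] LineL2 := lineHardy.starProjection

theorem lineProj_resL2_of_neg {z : ℂ} (hz : z.im < 0) : lineProj (resL2 z) = resL2 z :=
  Submodule.starProjection_eq_self_iff.2
    (Submodule.le_topologicalClosure _ (Submodule.subset_span ⟨z, hz, rfl⟩))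

/-- Cauchy kernels with poles in the upper half plane are orthogonal to the Hardy space. -/
theorem lineProj_resL2_of_pos {z : ℂ} (hz : 0 < z.im) : lineProj (resL2 z) = 0 := by
  rw [lineProj, Submodule.starProjection_apply_eq_zero_iff, lineHardy,
    Submodule.orthogonal_closure, Submodule.mem_orthogonal]
  intro u hu
  induction hu using Submodule.span_induction with
  | mem x hx =>
    obtain ⟨w, hw, rfl⟩ := hx
    have hw' : w.im < 0 := hw
    have h := integral_mul_res (resL2 z) (z := (starRingEnd ℂ) w) (by simpa using hw'.ne)
    rw [Complex.conj_conj] at h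
    rw [← h, ← integral_res_mul_res hz (w := (starRingEnd ℂ) w) (by simpa using hw')]
    refine integral_congr_ae ?_
    filter_upwards [coeFn_resL2 hz.ne'] with s hs
    rw [hs]
  | zero => simp
  | add x y _ _ hx hy => rw [inner_add_left, hx, hy, add_zero]
  | smul c x _ hx => rw [inner_smul_left, hx, mul_zero]

theorem norm_lineProj_le (f : LineL2) : ‖lineProj f‖ ≤ ‖f‖ :=
  Submodule.norm_starProjection_apply_le _ f

/-- The Cauchy integral of `f` in the upper half plane is that of its Cauchy projection. -/
theorem integral_lineProj_mul_res_of_pos (f : LineL2) {z : ℂ} (hz : 0 < z.im) :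
    ∫ s, lineProj f s * res z s = ∫ s, f s * res z s := by
  rw [integral_mul_res _ hz.ne', integral_mul_res _ hz.ne', lineProj,
    ← Submodule.inner_starProjection_left_eq_right]
  congr 1
  exact lineProj_resL2_of_neg (by simpa using hz)

/-- The Cauchy integral of the Cauchy projection vanishes in the lower half plane. -/
theorem integral_lineProj_mul_res_of_neg (f : LineL2) {z : ℂ} (hz : z.im < 0) :
    ∫ s, lineProj f s * res z s = 0 := by
  rw [integral_mul_res _ hz.ne, lineProj, ← Submodule.inner_starProjection_left_eq_right]
  have : lineHardy.starProjection (resL2 ((starRingEnd ℂ) z)) = 0 :=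
    lineProj_resL2_of_pos (by simpa using hz)
  rw [this, inner_zero_left]

/-! ### Boundary values and the Hilbert transform -/

theorem LineL2.memLp (f : LineL2) : MemLp f 2 volume := Lp.memLp f

theorem LineL2.integrable_mul_res (f : LineL2) {z : ℂ} (hz : z.im ≠ 0) :
    Integrable fun s => f s * res z s :=
  (LineL2.memLp f).integrable_mul (memLp_res hz)

/-- Convergence at a Lebesgue point of means with respect to kernels dominated by the Poisson
kernel. -/
theorem tendsto_integral_of_norm_le_poisson {f : ℝ → ℂ} {t : ℝ}
    (ht : Tendsto (fun ε : ℝ => ∫⁻ s, ‖f s - f t‖ₑ * ENNReal.ofReal (ε / ((s - t) ^ 2 + ε ^ 2)))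
      (𝓝[>] 0) (𝓝 0)) {k : ℝ → ℝ → ℂ} {C : ℝ} (hC : 0 ≤ C)
    (hk : ∀ ε > 0, ∀ s, ‖k ε s‖ ≤ C * (ε / ((s - t) ^ 2 + ε ^ 2))) :
    Tendsto (fun ε : ℝ => ∫ s, (f s - f t) * k ε s) (𝓝[>] 0) (𝓝 0) := by
  rw [tendsto_zero_iff_enorm_tendsto_zero]
  have h := ENNReal.Tendsto.const_mul (a := ENNReal.ofReal C) ht (Or.inr ENNReal.ofReal_ne_top)
  rw [mul_zero] at h
  refine tendsto_of_tendsto_of_tendsto_of_le_of_le' tendsto_const_nhds h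
    (Eventually.of_forall fun _ => zero_le) ?_
  filter_upwards [self_mem_nhdsWithin] with ε (hε : 0 < ε)
  refine (enorm_integral_le_lintegral_enorm _).trans ?_
  rw [← lintegral_const_mul' _ _ ENNReal.ofReal_ne_top]
  refine lintegral_mono fun s => ?_
  rw [enorm_mul, mul_left_comm, ← ENNReal.ofReal_mul hC]
  refine mul_le_mul_right ?_ _
  rw [← ofReal_norm]
  exact ENNReal.ofReal_le_ofReal (hk ε hε s)

/-- The jump of the Cauchy kernel across the real line is a multiple of the Poisson kernel. -/
theorem res_sub_res_conj (t : ℝ) {ε : ℝ} (hε : 0 < ε) (s : ℝ) :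
    res (t + ε * Complex.I) s - res (t - ε * Complex.I) s =
      ((2 * ε * ((s - t) ^ 2 + ε ^ 2)⁻¹ : ℝ) : ℂ) * Complex.I := by
  have h0 : ((s : ℂ) - t) ^ 2 + ε ^ 2 ≠ 0 := by
    have : (s - t) ^ 2 + ε ^ 2 ≠ 0 := by positivity
    exact_mod_cast this
  rw [res_sub_res (by simp [hε.ne']) (by simp [hε.ne'])]
  simp only [res]
  rw [← mul_inv]
  have h1 : ((s : ℂ) - (t + ε * Complex.I)) * (s - (t - ε * Complex.I)) = (s - t) ^ 2 + ε ^ 2 := by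
    linear_combination (-(ε : ℂ) ^ 2) * Complex.I_sq
  rw [h1]
  push_cast
  field_simp
  ring

theorem res_add_res_conj (t : ℝ) {ε : ℝ} (hε : 0 < ε) (s : ℝ) :
    res (t + ε * Complex.I) s + res (t - ε * Complex.I) s =
      ((2 * ((s - t) / ((s - t) ^ 2 + ε ^ 2)) : ℝ) : ℂ) := by
  have h0 : ((s : ℂ) - t) ^ 2 + ε ^ 2 ≠ 0 := by
    have : (s - t) ^ 2 + ε ^ 2 ≠ 0 := by positivity
    exact_mod_cast this
  have h2 := ofReal_sub_ne_zero (z := t + ε * Complex.I) (by simp [hε.ne']) s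
  have h3 := ofReal_sub_ne_zero (z := t - ε * Complex.I) (by simp [hε.ne']) s
  have h1 : ((s : ℂ) - (t + ε * Complex.I)) * (s - (t - ε * Complex.I)) = (s - t) ^ 2 + ε ^ 2 := by
    linear_combination (-(ε : ℂ) ^ 2) * Complex.I_sq
  simp only [res]
  push_cast
  rw [← h1]
  field_simp
  ring

theorem norm_res_sub_res_conj (t : ℝ) {ε : ℝ} (hε : 0 < ε) (s : ℝ) :
    ‖res (t + ε * Complex.I) s - res (t - ε * Complex.I) s‖ =
      2 * (ε / ((s - t) ^ 2 + ε ^ 2)) := by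
  rw [res_sub_res_conj t hε, norm_mul, Complex.norm_I, mul_one, Complex.norm_real,
    Real.norm_of_nonneg (by positivity)]
  ring

theorem integral_res_sub_res_conj (t : ℝ) {ε : ℝ} (hε : 0 < ε) :
    ∫ s, (res (t + ε * Complex.I) s - res (t - ε * Complex.I) s) = 2 * Real.pi * Complex.I := by
  simp_rw [res_sub_res_conj t hε]
  rw [integral_mul_const, integral_complex_ofReal, integral_const_mul, integral_poisson t hε]
  push_cast
  have : (ε : ℂ) ≠ 0 := by exact_mod_cast hε.ne'
  field_simp

theorem integrable_res_sub_res_conj (t : ℝ) {ε : ℝ} (hε : 0 < ε) :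
    Integrable fun s => res (t + ε * Complex.I) s - res (t - ε * Complex.I) s := by
  simp_rw [res_sub_res_conj t hε]
  exact (((integrable_poisson t hε.ne').const_mul (2 * ε)).ofReal).mul_const _

/-- Jump relation: the difference of the Cauchy integrals from the two sides of the line
recovers the function almost everywhere. -/
theorem ae_tendsto_jump (h : LineL2) :
    ∀ᵐ t : ℝ, Tendsto (fun ε : ℝ => ∫ s, h s *
      (res (t + ε * Complex.I) s - res (t - ε * Complex.I) s)) (𝓝[>] 0)
      (𝓝 (2 * Real.pi * Complex.I * h t)) := by
  filter_upwards [ae_tendsto_lintegral_poisson (LineL2.memLp h)] with t ht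
  have h1 := tendsto_integral_of_norm_le_poisson ht (C := 2)
    (k := fun ε s => res (t + ε * Complex.I) s - res (t - ε * Complex.I) s) (by norm_num)
    fun ε hε s => (norm_res_sub_res_conj t hε s).le
  have h2 := h1.add_const (2 * Real.pi * Complex.I * h t)
  rw [zero_add] at h2
  refine h2.congr' ?_
  filter_upwards [self_mem_nhdsWithin] with ε (hε : 0 < ε)
  have i1 : Integrable fun s => h s * (res (t + ε * Complex.I) s - res (t - ε * Complex.I) s) := by
    simp_rw [mul_sub]
    exact (LineL2.integrable_mul_res h (by simp [hε.ne'])).sub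
      (LineL2.integrable_mul_res h (by simp [hε.ne']))
  simp_rw [sub_mul _ (h t)]
  rw [integral_sub i1 ((integrable_res_sub_res_conj t hε).const_mul _), integral_const_mul,
    integral_res_sub_res_conj t hε]
  ring

/-- Only the zero function has vanishing Cauchy integrals off the line. -/
theorem LineL2.eq_zero_of_integral_mul_res_eq_zero (h : LineL2)
    (hh : ∀ z : ℂ, z.im ≠ 0 → ∫ s, h s * res z s = 0) : h = 0 := by
  rw [Lp.eq_zero_iff_ae_eq_zero]
  filter_upwards [ae_tendsto_jump h] with t ht
  have h0 : Tendsto (fun ε : ℝ => ∫ s, h s *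
      (res (t + ε * Complex.I) s - res (t - ε * Complex.I) s)) (𝓝[>] 0) (𝓝 0) := by
    refine tendsto_const_nhds.congr' ?_
    filter_upwards [self_mem_nhdsWithin] with ε (hε : 0 < ε)
    simp_rw [mul_sub]
    rw [integral_sub (LineL2.integrable_mul_res h (by simp [hε.ne']))
      (LineL2.integrable_mul_res h (by simp [hε.ne'])), hh _ (by simp [hε.ne']),
      hh _ (by simp [hε.ne']), sub_zero]
  have := tendsto_nhds_unique ht h0
  simpa [Real.pi_ne_zero] using this

/-- The Hilbert transform on the line, normalised to be the principal value Cauchy integral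
`(π i)⁻¹ p.v. ∫ f(s) (s - t)⁻¹ ds`, as the reflection belonging to the Cauchy projection. -/
noncomputable def lineHilbert : LineL2 →L[ℂ] LineL2 :=
  (2 : ℂ) • lineProj - ContinuousLinearMap.id ℂ LineL2

theorem lineHilbert_apply (f : LineL2) : lineHilbert f = (2 : ℂ) • lineProj f - f := rfl

theorem coeFn_lineHilbert (f : LineL2) :
    ∀ᵐ t, lineHilbert f t = 2 * lineProj f t - f t := by
  filter_upwards [Lp.coeFn_sub ((2 : ℂ) • lineProj f) f, Lp.coeFn_smul (2 : ℂ) (lineProj f)]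
    with t h1 h2
  rw [lineHilbert_apply, h1, Pi.sub_apply, h2, Pi.smul_apply, smul_eq_mul]

theorem norm_lineHilbert_le (f : LineL2) : ‖lineHilbert f‖ ≤ 3 * ‖f‖ := by
  rw [lineHilbert_apply]
  refine (norm_sub_le _ _).trans ?_
  rw [norm_smul, Complex.norm_ofNat]
  linarith [norm_lineProj_le f]

theorem integral_lineHilbert_mul_res_of_pos (f : LineL2) {z : ℂ} (hz : 0 < z.im) :
    ∫ s, lineHilbert f s * res z s = ∫ s, f s * res z s := by
  have h : ∫ s, lineHilbert f s * res z s =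
      ∫ s, (2 * (lineProj f s * res z s) - f s * res z s) := by
    refine integral_congr_ae ?_
    filter_upwards [coeFn_lineHilbert f] with s hs
    rw [hs]; ring
  rw [h, integral_sub ((LineL2.integrable_mul_res _ hz.ne').const_mul 2)
    (LineL2.integrable_mul_res _ hz.ne'), integral_const_mul,
    integral_lineProj_mul_res_of_pos f hz]
  ring

theorem integral_lineHilbert_mul_res_of_neg (f : LineL2) {z : ℂ} (hz : z.im < 0) :
    ∫ s, lineHilbert f s * res z s = -∫ s, f s * res z s := by
  have h : ∫ s, lineHilbert f s * res z s =
      ∫ s, (2 * (lineProj f s * res z s) - f s * res z s) := by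
    refine integral_congr_ae ?_
    filter_upwards [coeFn_lineHilbert f] with s hs
    rw [hs]; ring
  rw [h, integral_sub ((LineL2.integrable_mul_res _ hz.ne).const_mul 2)
    (LineL2.integrable_mul_res _ hz.ne), integral_const_mul,
    integral_lineProj_mul_res_of_neg f hz]
  ring

/-- The Hilbert transform is the sum of the boundary values of the Cauchy integral from the two
sides of the line. -/
theorem ae_tendsto_lineHilbert (f : LineL2) :
    ∀ᵐ t : ℝ, Tendsto (fun ε : ℝ => (∫ s, f s * res (t + ε * Complex.I) s) +
      ∫ s, f s * res (t - ε * Complex.I) s) (𝓝[>] 0)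
      (𝓝 (2 * Real.pi * Complex.I * lineHilbert f t)) := by
  filter_upwards [ae_tendsto_jump (lineHilbert f)] with t ht
  refine ht.congr' ?_
  filter_upwards [self_mem_nhdsWithin] with ε (hε : 0 < ε)
  simp_rw [mul_sub]
  rw [integral_sub (LineL2.integrable_mul_res _ (by simp [hε.ne']))
    (LineL2.integrable_mul_res _ (by simp [hε.ne'])),
    integral_lineHilbert_mul_res_of_pos _ (by simpa using hε),
    integral_lineHilbert_mul_res_of_neg _ (by simpa using hε), sub_neg_eq_add]

/-- The difference between the truncated kernel `1_{|s - t| > ε} (s - t)⁻¹` and its smooth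
counterpart `(s - t) / ((s - t)² + ε²)`. -/
noncomputable def truncDiff (ε t s : ℝ) : ℝ :=
  {s : ℝ | ε < |s - t|}.indicator (fun s => (s - t)⁻¹) s - (s - t) / ((s - t) ^ 2 + ε ^ 2)

theorem abs_truncDiff_le {ε : ℝ} (hε : 0 < ε) (t s : ℝ) :
    |truncDiff ε t s| ≤ ε / ((s - t) ^ 2 + ε ^ 2) := by
  have hpos : 0 < (s - t) ^ 2 + ε ^ 2 := by positivity
  by_cases h : ε < |s - t|
  · have h0 : s - t ≠ 0 := fun h0 => by simp [h0] at h; linarith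
    have h1 : truncDiff ε t s = ε ^ 2 / ((s - t) * ((s - t) ^ 2 + ε ^ 2)) := by
      rw [truncDiff, Set.indicator_of_mem (by exact h)]
      field_simp
      ring
    rw [h1, abs_div, abs_mul, abs_of_pos hpos, abs_of_pos (by positivity : 0 < ε ^ 2),
      div_le_div_iff₀ (by positivity) hpos]
    have : ε ^ 2 ≤ ε * |s - t| := by nlinarith
    nlinarith
  · have h1 : truncDiff ε t s = -((s - t) / ((s - t) ^ 2 + ε ^ 2)) := by
      rw [truncDiff, Set.indicator_of_notMem (by exact h), zero_sub]
    rw [h1, abs_neg, abs_div, abs_of_pos hpos]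
    exact div_le_div_of_nonneg_right (not_lt.1 h) hpos.le

theorem measurable_truncDiff (ε t : ℝ) : Measurable (truncDiff ε t) := by
  refine Measurable.sub (Measurable.indicator (by fun_prop) ?_) (by fun_prop)
  exact measurableSet_lt measurable_const (by fun_prop)

/-- The kernel `truncDiff` is odd about `t`. -/
theorem integral_truncDiff (ε t : ℝ) : ∫ s, truncDiff ε t s = 0 := by
  have h1 : ∫ s, truncDiff ε t s = ∫ s, truncDiff ε 0 s := by
    rw [← integral_sub_right_eq_self (fun s => truncDiff ε 0 s) t]
    congr 1
    ext s
    simp [truncDiff, Set.indicator]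
  have h2 : ∫ s, truncDiff ε 0 s = -∫ s, truncDiff ε 0 s := by
    rw [← integral_neg, ← integral_neg_eq_self]
    congr 1
    ext s
    simp only [truncDiff, Set.indicator, sub_zero, Set.mem_ofPred_eq, abs_neg]
    split_ifs <;> simp [inv_neg, neg_div] ; ring
  rw [h1]
  linarith

theorem integrable_truncDiff {ε : ℝ} (hε : 0 < ε) (t : ℝ) : Integrable (truncDiff ε t) := by
  refine ((integrable_poisson t hε.ne').const_mul ε).mono'
    (measurable_truncDiff ε t).aestronglyMeasurable (Eventually.of_forall fun s => ?_)
  rw [Real.norm_eq_abs]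
  exact abs_truncDiff_le hε t s

theorem memLp_truncDiff {ε : ℝ} (hε : 0 < ε) (t : ℝ) : MemLp (truncDiff ε t) 2 volume := by
  refine (memLp_res (z := t + ε * Complex.I) (by simp [hε.ne'])).mono
    (measurable_truncDiff ε t).aestronglyMeasurable (Eventually.of_forall fun s => ?_)
  rw [Real.norm_eq_abs]
  refine (abs_truncDiff_le hε t s).trans ?_
  refine le_of_sq_le_sq ?_ (norm_nonneg _)
  rw [norm_res_sq]
  have : 0 < (s - t) ^ 2 + ε ^ 2 := by positivity
  simp only [Complex.add_re, Complex.ofReal_re, Complex.mul_re, Complex.I_re, Complex.ofReal_im,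
    Complex.I_im, Complex.add_im, Complex.mul_im]
  simp only [mul_zero, mul_one, sub_zero, add_zero, zero_add]
  rw [div_pow, inv_eq_one_div, div_le_div_iff₀ (by positivity) this]
  nlinarith [sq_nonneg (s - t), sq_nonneg ε]

/-- The truncated Cauchy integrals of an `L²` function on the line converge almost everywhere to
the Hilbert transform.  The truncated kernel differs from the mean of the Cauchy kernels at
`t ± iε` by an odd kernel dominated by the Poisson kernel. -/
theorem ae_tendsto_truncated_integral (f : LineL2) :
    ∀ᵐ t : ℝ, Tendsto (fun ε : ℝ => ∫ s in {s : ℝ | ε < |s - t|}, f s * ((s : ℂ) - t)⁻¹) (𝓝[>] 0)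
      (𝓝 (Real.pi * Complex.I * lineHilbert f t)) := by
  filter_upwards [ae_tendsto_lineHilbert f, ae_tendsto_lintegral_poisson (LineL2.memLp f)]
    with t h1 ht
  have h2 := tendsto_integral_of_norm_le_poisson ht (C := 1)
    (k := fun ε s => (truncDiff ε t s : ℂ)) (by norm_num)
    fun ε hε s => by
      rw [Complex.norm_real, one_mul]
      exact abs_truncDiff_le hε t s
  have h3 := (h1.const_mul (1 / 2 : ℂ)).add h2
  have e : (1 / 2 : ℂ) * (2 * Real.pi * Complex.I * lineHilbert f t) + 0 =
    Real.pi * Complex.I * lineHilbert f t := by ring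
  rw [e] at h3
  refine h3.congr' ?_
  filter_upwards [self_mem_nhdsWithin] with ε (hε : 0 < ε)
  have i1 := LineL2.integrable_mul_res f (z := t + ε * Complex.I) (by simp [hε.ne'])
  have i2 := LineL2.integrable_mul_res f (z := t - ε * Complex.I) (by simp [hε.ne'])
  have i3 : Integrable fun s => f s * (truncDiff ε t s : ℂ) :=
    (LineL2.memLp f).integrable_mul (memLp_truncDiff hε t).ofReal
  have i4 : Integrable fun s => f t * (truncDiff ε t s : ℂ) :=
    (integrable_truncDiff hε t).ofReal.const_mul _
  have e2 : ∫ s, (f s - f t) * (truncDiff ε t s : ℂ) = ∫ s, f s * (truncDiff ε t s : ℂ) := by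
    simp_rw [sub_mul _ (f t)]
    rw [integral_sub i3 i4, integral_const_mul, integral_complex_ofReal, integral_truncDiff,
      Complex.ofReal_zero, mul_zero, sub_zero]
  have i5 : Integrable fun s => (1 / 2 : ℂ) * (f s * res (t + ε * Complex.I) s +
      f s * res (t - ε * Complex.I) s) := (i1.add i2).const_mul _
  rw [e2, ← integral_add i1 i2, ← integral_const_mul, ← integral_add i5 i3,
    ← integral_indicator (measurableSet_lt measurable_const (by fun_prop))]
  congr 1
  ext s
  have e1 : f s * res (t + ε * Complex.I) s + f s * res (t - ε * Complex.I) s =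
      f s * ((2 * ((s - t) / ((s - t) ^ 2 + ε ^ 2)) : ℝ) : ℂ) := by
    rw [← mul_add, res_add_res_conj t hε]
  rw [e1]
  by_cases h : ε < |s - t|
  · rw [Set.indicator_of_mem (by exact h), truncDiff, Set.indicator_of_mem (by exact h)]
    push_cast
    ring
  · rw [Set.indicator_of_notMem (by exact h), truncDiff, Set.indicator_of_notMem (by exact h)]
    push_cast
    ring

/-! ### Conjugation and restriction to half-lines -/

/-- Pointwise complex conjugation on `L²(ℝ)`. -/
noncomputable def lineConj : LineL2 →L[ℝ] LineL2 :=
  (Complex.conjCLE : ℂ →L[ℝ] ℂ).compLpL 2 volume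

theorem coeFn_lineConj (f : LineL2) : ∀ᵐ s, lineConj f s = (starRingEnd ℂ) (f s) := by
  filter_upwards [ContinuousLinearMap.coeFn_compLpL (p := 2) (μ := (volume : Measure ℝ))
    (Complex.conjCLE : ℂ →L[ℝ] ℂ) f] with s hs
  rw [lineConj, hs]
  rfl

theorem lineConj_lineConj (f : LineL2) : lineConj (lineConj f) = f := by
  apply Lp.ext
  filter_upwards [coeFn_lineConj f, coeFn_lineConj (lineConj f)] with s h1 h2
  rw [h2, h1, Complex.conj_conj]

theorem integral_lineConj_mul_res (f : LineL2) (z : ℂ) :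
    ∫ s, lineConj f s * res z s = (starRingEnd ℂ) (∫ s, f s * res ((starRingEnd ℂ) z) s) := by
  rw [← integral_conj]
  refine integral_congr_ae ?_
  filter_upwards [coeFn_lineConj f] with s hs
  rw [hs, map_mul, conj_res, Complex.conj_conj]

/-- The Hilbert transform, with its factor `1 / i`, maps real functions to imaginary ones. -/
theorem lineHilbert_lineConj (f : LineL2) :
    lineHilbert (lineConj f) = -lineConj (lineHilbert f) := by
  rw [← sub_eq_zero]
  apply LineL2.eq_zero_of_integral_mul_res_eq_zero
  intro z hz
  have h : ∫ s, (lineHilbert (lineConj f) - -lineConj (lineHilbert f) : LineL2) s * res z s =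
      (∫ s, lineHilbert (lineConj f) s * res z s) + ∫ s, lineConj (lineHilbert f) s * res z s := by
    rw [← integral_add (LineL2.integrable_mul_res _ hz) (LineL2.integrable_mul_res _ hz)]
    refine integral_congr_ae ?_
    rw [sub_neg_eq_add]
    filter_upwards [Lp.coeFn_add (lineHilbert (lineConj f)) (lineConj (lineHilbert f))] with s hs
    rw [hs, Pi.add_apply, add_mul]
  rw [h, integral_lineConj_mul_res]
  rcases hz.lt_or_gt with hz | hz
  · rw [integral_lineHilbert_mul_res_of_neg _ hz, integral_lineConj_mul_res,
      integral_lineHilbert_mul_res_of_pos _ (by simpa using hz), neg_add_cancel]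
  · rw [integral_lineHilbert_mul_res_of_pos _ hz, integral_lineConj_mul_res,
      integral_lineHilbert_mul_res_of_neg _ (by simpa using hz), map_neg, add_neg_cancel]

theorem inner_lineHilbert (f g : LineL2) :
    inner ℂ (lineHilbert f) g = inner ℂ f (lineHilbert g) := by
  have h : inner ℂ (lineProj f) g = inner ℂ f (lineProj g) :=
    Submodule.inner_starProjection_left_eq_right _ f g
  rw [lineHilbert_apply, lineHilbert_apply, inner_sub_left, inner_sub_right, inner_smul_left,
    inner_smul_right, h, Complex.conj_ofNat]

theorem integral_mul_eq_inner_lineConj (f g : LineL2) :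
    ∫ s, f s * g s = inner ℂ (lineConj g) f := by
  apply integral_mul_eq_inner
  filter_upwards [coeFn_lineConj g] with s hs
  rw [hs, Complex.conj_conj]

/-- The Hilbert transform is skew for the bilinear pairing. -/
theorem integral_lineHilbert_mul (f g : LineL2) :
    ∫ s, lineHilbert f s * g s = -∫ s, f s * lineHilbert g s := by
  rw [integral_mul_eq_inner_lineConj, integral_mul_eq_inner_lineConj, ← inner_lineHilbert,
    lineHilbert_lineConj, inner_neg_left]

/-- An almost everywhere linear rule that is bounded on `L²(ℝ)` defines a bounded operator. -/
theorem exists_continuousLinearMap_of_ae {Φ : LineL2 → ℝ → ℂ} (hΦ : ∀ f, MemLp (Φ f) 2 volume)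
    (hadd : ∀ f g, ∀ᵐ s, Φ (f + g) s = Φ f s + Φ g s)
    (hsmul : ∀ (c : ℂ) (f), ∀ᵐ s, Φ (c • f) s = c * Φ f s) {C : ℝ}
    (hC : 0 ≤ C) (hb : ∀ f : LineL2, eLpNorm (Φ f) 2 volume ≤ ENNReal.ofReal C * ‖f‖ₑ) :
    ∃ T : LineL2 →L[ℂ] LineL2, (∀ f, ‖T f‖ ≤ C * ‖f‖) ∧ ∀ f, ∀ᵐ s, T f s = Φ f s := by
  have e1 : ∀ f g, (hΦ (f + g)).toLp (Φ (f + g)) = (hΦ f).toLp (Φ f) + (hΦ g).toLp (Φ g) :=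
    fun f g => by
      rw [← MemLp.toLp_add]
      exact (MemLp.toLp_eq_toLp_iff _ _).2 (hadd f g)
  have e2 : ∀ (c : ℂ) (f), (hΦ (c • f)).toLp (Φ (c • f)) = c • (hΦ f).toLp (Φ f) :=
    fun c f => by
      rw [← MemLp.toLp_const_smul]
      exact (MemLp.toLp_eq_toLp_iff _ _).2 (hsmul c f)
  let L : LineL2 →ₗ[ℂ] LineL2 :=
    { toFun := fun f => (hΦ f).toLp (Φ f)
      map_add' := e1
      map_smul' := e2 }
  have e3 : ∀ f, ‖L f‖ ≤ C * ‖f‖ := fun f => by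
    have h := ENNReal.toReal_mono (ENNReal.mul_ne_top ENNReal.ofReal_ne_top enorm_ne_top) (hb f)
    rw [ENNReal.toReal_mul, ENNReal.toReal_ofReal hC, toReal_enorm] at h
    exact (Lp.norm_toLp (Φ f) (hΦ f)).trans_le h
  exact ⟨L.mkContinuous C e3, e3, fun f => MemLp.coeFn_toLp (hΦ f)⟩

theorem exists_cutoff (A : Set ℝ) (hA : MeasurableSet A) :
    ∃ T : LineL2 →L[ℂ] LineL2, (∀ f, ‖T f‖ ≤ 1 * ‖f‖) ∧ ∀ f, ∀ᵐ s, T f s = A.indicator f s := by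
  refine exists_continuousLinearMap_of_ae (Φ := fun f => A.indicator f)
    (fun f => (Lp.memLp f).indicator hA) (fun f g => ?_) (fun c f => ?_) zero_le_one fun f => ?_
  · filter_upwards [Lp.coeFn_add f g] with s h
    by_cases hs : s ∈ A
    · simp only [Set.indicator_of_mem hs]
      exact h
    · simp only [Set.indicator_of_notMem hs, add_zero]
  · filter_upwards [Lp.coeFn_smul c f] with s h
    by_cases hs : s ∈ A
    · simp only [Set.indicator_of_mem hs]
      exact h
    · simp only [Set.indicator_of_notMem hs, mul_zero]
  · rw [ENNReal.ofReal_one, one_mul, Lp.enorm_def]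
    exact eLpNorm_indicator_le _

/-- Restriction of functions in `L²(ℝ)` to a measurable set, extended by zero. -/
noncomputable def cutoff (A : Set ℝ) (hA : MeasurableSet A) : LineL2 →L[ℂ] LineL2 :=
  (exists_cutoff A hA).choose

theorem coeFn_cutoff (A : Set ℝ) (hA : MeasurableSet A) (f : LineL2) :
    ∀ᵐ s, cutoff A hA f s = A.indicator f s :=
  (exists_cutoff A hA).choose_spec.2 f

theorem norm_cutoff_le (A : Set ℝ) (hA : MeasurableSet A) (f : LineL2) :
    ‖cutoff A hA f‖ ≤ ‖f‖ :=
  ((exists_cutoff A hA).choose_spec.1 f).trans_eq (one_mul _)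

/-- Restriction to the positive half-line. -/
noncomputable abbrev cutPos : LineL2 →L[ℂ] LineL2 := cutoff (Set.Ioi 0) measurableSet_Ioi

/-- Restriction to the negative half-line. -/
noncomputable abbrev cutNeg : LineL2 →L[ℂ] LineL2 := cutoff (Set.Iio 0) measurableSet_Iio

theorem integral_cutoff_mul (A : Set ℝ) (hA : MeasurableSet A) (f : LineL2) (k : ℝ → ℂ) :
    ∫ s, cutoff A hA f s * k s = ∫ s in A, f s * k s := by
  rw [← integral_indicator hA]
  refine integral_congr_ae ?_
  filter_upwards [coeFn_cutoff A hA f] with s hs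
  rw [hs]
  by_cases h : s ∈ A <;> simp [h]

theorem integral_cutoff_mul_comm (A : Set ℝ) (hA : MeasurableSet A) (f g : LineL2) :
    ∫ s, cutoff A hA f s * g s = ∫ s, f s * cutoff A hA g s := by
  refine integral_congr_ae ?_
  filter_upwards [coeFn_cutoff A hA f, coeFn_cutoff A hA g] with s h1 h2
  rw [h1, h2]
  by_cases h : s ∈ A <;> simp [h]

theorem lineConj_cutoff (A : Set ℝ) (hA : MeasurableSet A) (f : LineL2) :
    lineConj (cutoff A hA f) = cutoff A hA (lineConj f) := by
  apply Lp.ext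
  filter_upwards [coeFn_cutoff A hA f, coeFn_cutoff A hA (lineConj f), coeFn_lineConj f,
    coeFn_lineConj (cutoff A hA f)] with s h1 h2 h3 h4
  rw [h4, h1, h2]
  by_cases h : s ∈ A <;> simp [h, h3]

/-! ### Schur's test -/

/-- Schur's test for nonnegative kernels, in terms of lower Lebesgue integrals. -/
theorem lintegral_sq_lintegral_le_of_schur {k : ℝ → ℝ → ENNReal}
    (hk : Measurable (Function.uncurry k)) {w : ℝ → ENNReal} (hw : Measurable w)
    (hw0 : ∀ᵐ s, w s ≠ 0) (hwt : ∀ s, w s ≠ ⊤) {A : ENNReal} (hA : A ≠ ⊤)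
    (h1 : ∀ᵐ t, ∫⁻ s, k t s * w s ≤ A * w t) (h2 : ∀ᵐ s, ∫⁻ t, k t s * w t ≤ A * w s)
    {F : ℝ → ENNReal} (hF : AEMeasurable F) :
    ∫⁻ t, (∫⁻ s, k t s * F s) ^ 2 ≤ A ^ 2 * ∫⁻ s, F s ^ 2 := by
  have hkt : ∀ t, Measurable (k t) := fun t => hk.comp measurable_prodMk_left
  -- Cauchy-Schwarz with the factors `(k w)^(1/2)` and `(k F² / w)^(1/2)`.
  have step : ∀ᵐ t, (∫⁻ s, k t s * F s) ^ 2 ≤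
      ∫⁻ s, A * w t * (k t s * (F s ^ 2 / w s)) := by
    filter_upwards [h1] with t ht
    have hm : AEMeasurable (fun s => k t s * (F s ^ 2 / w s)) volume :=
      (hkt t).aemeasurable.mul ((hF.pow_const 2).div hw.aemeasurable)
    have e : ∫⁻ s, k t s * F s = ∫⁻ s, ((fun s => (k t s * w s) ^ (1 / 2 : ℝ)) *
        fun s => (k t s * (F s ^ 2 / w s)) ^ (1 / 2 : ℝ)) s := by
      refine lintegral_congr_ae ?_
      filter_upwards [hw0] with s hs
      simp only [Pi.mul_apply]
      rw [← ENNReal.mul_rpow_of_nonneg _ _ (by norm_num : (0:ℝ) ≤ 1 / 2)]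
      have : k t s * w s * (k t s * (F s ^ 2 / w s)) = (k t s * F s) ^ (2 : ℝ) := by
        rw [ENNReal.rpow_two, mul_pow, mul_mul_mul_comm, ENNReal.mul_div_cancel hs (hwt s), sq (k t s)]
      rw [this, ← ENNReal.rpow_mul]
      norm_num
    have hold := ENNReal.lintegral_mul_le_Lp_mul_Lq volume Real.HolderConjugate.two_two
      (f := fun s => (k t s * w s) ^ (1 / 2 : ℝ))
      (g := fun s => (k t s * (F s ^ 2 / w s)) ^ (1 / 2 : ℝ))
      (((hkt t).mul hw).pow_const _).aemeasurable (hm.pow_const _)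
    rw [← e] at hold
    simp only [← ENNReal.rpow_mul] at hold
    norm_num at hold
    have h3 := pow_le_pow_left₀ zero_le hold 2
    rw [mul_pow, ← ENNReal.rpow_two, ← ENNReal.rpow_two, ← ENNReal.rpow_two, ← ENNReal.rpow_mul,
      ← ENNReal.rpow_mul] at h3
    norm_num at h3
    rw [lintegral_const_mul'' _ hm]
    refine h3.trans ?_
    gcongr
  calc ∫⁻ t, (∫⁻ s, k t s * F s) ^ 2
      ≤ ∫⁻ t, ∫⁻ s, A * w t * (k t s * (F s ^ 2 / w s)) := lintegral_mono_ae step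
    _ = ∫⁻ s, ∫⁻ t, A * w t * (k t s * (F s ^ 2 / w s)) := by
        refine lintegral_lintegral_swap ?_
        refine ((measurable_const.mul (hw.comp measurable_fst)).aemeasurable).mul
          (hk.aemeasurable.mul ?_)
        exact ((hF.comp_quasiMeasurePreserving Measure.quasiMeasurePreserving_snd).pow_const 2).div
          (hw.comp measurable_snd).aemeasurable
    _ ≤ ∫⁻ s, A ^ 2 * F s ^ 2 := by
        refine lintegral_mono_ae ?_
        filter_upwards [h2, hw0] with s hs hs0
        have hm : Measurable fun t => k t s * w t :=
          (hk.comp measurable_prodMk_right).mul hw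
        have e : ∀ t, A * w t * (k t s * (F s ^ 2 / w s)) = A * (F s ^ 2 / w s) * (k t s * w t) :=
          fun t => by ring
        simp_rw [e]
        rw [lintegral_const_mul _ hm]
        calc A * (F s ^ 2 / w s) * ∫⁻ t, k t s * w t ≤ A * (F s ^ 2 / w s) * (A * w s) := by gcongr
          _ = A ^ 2 * (w s * (F s ^ 2 / w s)) := by ring
          _ = A ^ 2 * F s ^ 2 := by rw [ENNReal.mul_div_cancel hs0 (hwt s)]
    _ = A ^ 2 * ∫⁻ s, F s ^ 2 := lintegral_const_mul' _ _ (by simp [hA])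

theorem eLpNorm_two_sq (f : ℝ → ℂ) : eLpNorm f 2 volume ^ 2 = ∫⁻ s, ‖f s‖ₑ ^ 2 := by
  simpa using eLpNorm_nnreal_pow_eq_lintegral (μ := (volume : Measure ℝ)) (f := f) (p := 2)
    two_ne_zero

theorem LineL2.lintegral_enorm_sq (f : LineL2) : ∫⁻ s, ‖f s‖ₑ ^ 2 = ‖f‖ₑ ^ 2 := by
  rw [Lp.enorm_def, eLpNorm_two_sq]

/-- The weight `|s|^(-1/2)` of Schur's test for kernels that are homogeneous of degree `-1`. -/
noncomputable def schurWeight (s : ℝ) : ENNReal := ENNReal.ofReal (√|s|)⁻¹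

theorem measurable_schurWeight : Measurable schurWeight := by
  unfold schurWeight
  fun_prop

theorem ae_ne_zero : ∀ᵐ s : ℝ, s ≠ 0 := by
  simp [ae_iff]

theorem schurWeight_ne_zero {s : ℝ} (hs : s ≠ 0) : schurWeight s ≠ 0 := by
  have : 0 < |s| := abs_pos.2 hs
  simp [schurWeight, this]

/-- Schur's hypothesis with constant `A` and weight `|s|^(-1/2)`, for a nonnegative kernel on the
line. -/
structure IsSchurKernel (k : ℝ → ℝ → ℝ) (A : ℝ) : Prop where
  measurable : Measurable (Function.uncurry k)
  nonneg : ∀ t s, 0 ≤ k t s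
  const_nonneg : 0 ≤ A
  row : ∀ t ≠ 0, ∫⁻ s, ENNReal.ofReal (k t s) * schurWeight s ≤ ENNReal.ofReal A * schurWeight t
  col : ∀ s ≠ 0, ∫⁻ t, ENNReal.ofReal (k t s) * schurWeight t ≤ ENNReal.ofReal A * schurWeight s

namespace IsSchurKernel

variable {k : ℝ → ℝ → ℝ} {A : ℝ}

theorem lintegral_le (h : IsSchurKernel k A) {F : ℝ → ENNReal} (hF : AEMeasurable F) :
    ∫⁻ t, (∫⁻ s, ENNReal.ofReal (k t s) * F s) ^ 2 ≤ ENNReal.ofReal A ^ 2 * ∫⁻ s, F s ^ 2 :=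
  lintegral_sq_lintegral_le_of_schur (k := fun t s => ENNReal.ofReal (k t s))
    h.measurable.ennreal_ofReal measurable_schurWeight
    (ae_ne_zero.mono fun _ hs => schurWeight_ne_zero hs) (fun _ => ENNReal.ofReal_ne_top)
    ENNReal.ofReal_ne_top (ae_ne_zero.mono h.row) (ae_ne_zero.mono h.col) hF

theorem measurable_row (h : IsSchurKernel k A) (t : ℝ) : Measurable (k t) :=
  h.measurable.comp measurable_prodMk_left

theorem lintegral_ofReal_mul_enorm_sq_le (h : IsSchurKernel k A) (f : LineL2) :
    ∫⁻ t, (∫⁻ s, ENNReal.ofReal (k t s) * ‖f s‖ₑ) ^ 2 ≤ ENNReal.ofReal A ^ 2 * ‖f‖ₑ ^ 2 := by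
  rw [← LineL2.lintegral_enorm_sq]
  exact h.lintegral_le (Lp.aestronglyMeasurable f).enorm

theorem enorm_mul (h : IsSchurKernel k A) (f : LineL2) (t s : ℝ) :
    ‖(k t s : ℂ) * f s‖ₑ = ENNReal.ofReal (k t s) * ‖f s‖ₑ := by
  rw [_root_.enorm_mul]
  congr 1
  rw [← ofReal_norm, Complex.norm_real, Real.norm_of_nonneg (h.nonneg t s)]

theorem aemeasurable_lintegral (h : IsSchurKernel k A) (f : LineL2) :
    AEMeasurable (fun t => ∫⁻ s, ENNReal.ofReal (k t s) * ‖f s‖ₑ) :=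
  AEMeasurable.lintegral_prod_right' (f := fun p : ℝ × ℝ => ENNReal.ofReal (k p.1 p.2) * ‖f p.2‖ₑ)
    (h.measurable.ennreal_ofReal.aemeasurable.mul
      ((Lp.aestronglyMeasurable f).enorm.comp_quasiMeasurePreserving
        Measure.quasiMeasurePreserving_snd))

/-- The integral defining the operator converges absolutely almost everywhere. -/
theorem ae_integrable (h : IsSchurKernel k A) (f : LineL2) :
    ∀ᵐ t, Integrable fun s => (k t s : ℂ) * f s := by
  have h1 := ae_lt_top' ((h.aemeasurable_lintegral f).pow_const 2)
    ((h.lintegral_ofReal_mul_enorm_sq_le f).trans_lt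
      (ENNReal.mul_lt_top (by simp) (by simp))).ne
  filter_upwards [h1] with t ht
  refine ⟨(Complex.measurable_ofReal.comp (h.measurable_row t)).aestronglyMeasurable.mul
    (Lp.aestronglyMeasurable f), ?_⟩
  rw [HasFiniteIntegral]
  simp_rw [h.enorm_mul]
  exact (ENNReal.pow_lt_top_iff.1 ht).resolve_right (by norm_num)

theorem aestronglyMeasurable_integral (h : IsSchurKernel k A) (f : LineL2) :
    AEStronglyMeasurable (fun t => ∫ s, (k t s : ℂ) * f s) :=
  AEStronglyMeasurable.integral_prod_right' (f := fun p : ℝ × ℝ => (k p.1 p.2 : ℂ) * f p.2)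
    ((Complex.measurable_ofReal.comp h.measurable).aestronglyMeasurable.mul
      ((Lp.aestronglyMeasurable f).comp_quasiMeasurePreserving
        Measure.quasiMeasurePreserving_snd))

theorem eLpNorm_integral_le (h : IsSchurKernel k A) (f : LineL2) :
    eLpNorm (fun t => ∫ s, (k t s : ℂ) * f s) 2 volume ≤ ENNReal.ofReal A * ‖f‖ₑ := by
  rw [← ENNReal.pow_le_pow_left_iff two_ne_zero, mul_pow, eLpNorm_two_sq]
  refine le_trans (lintegral_mono fun t => ?_) (h.lintegral_ofReal_mul_enorm_sq_le f)
  refine pow_le_pow_left₀ zero_le ?_ 2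
  refine (enorm_integral_le_lintegral_enorm _).trans_eq ?_
  simp_rw [h.enorm_mul]

theorem exists_operator (h : IsSchurKernel k A) : ∃ T : LineL2 →L[ℂ] LineL2,
    (∀ f, ‖T f‖ ≤ A * ‖f‖) ∧ ∀ f, ∀ᵐ t, T f t = ∫ s, (k t s : ℂ) * f s := by
  refine exists_continuousLinearMap_of_ae (Φ := fun f t => ∫ s, (k t s : ℂ) * f s)
    (fun f => ⟨h.aestronglyMeasurable_integral f, (h.eLpNorm_integral_le f).trans_lt
      (ENNReal.mul_lt_top (by simp) (by simp))⟩) (fun f g => ?_) (fun c f => ?_) h.const_nonneg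
    h.eLpNorm_integral_le
  · filter_upwards [h.ae_integrable f, h.ae_integrable g] with t h1 h2
    rw [← integral_add h1 h2]
    refine integral_congr_ae ?_
    filter_upwards [Lp.coeFn_add f g] with s hs
    rw [hs, Pi.add_apply, mul_add]
  · refine Eventually.of_forall fun t => ?_
    rw [← integral_const_mul]
    refine integral_congr_ae ?_
    filter_upwards [Lp.coeFn_smul c f] with s hs
    rw [hs, Pi.smul_apply, smul_eq_mul, mul_left_comm]

/-- The integral operator on `L²(ℝ)` of a Schur kernel. -/
noncomputable def operator (h : IsSchurKernel k A) : LineL2 →L[ℂ] LineL2 :=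
  h.exists_operator.choose

theorem norm_operator_le (h : IsSchurKernel k A) (f : LineL2) : ‖h.operator f‖ ≤ A * ‖f‖ :=
  h.exists_operator.choose_spec.1 f

theorem coeFn_operator (h : IsSchurKernel k A) (f : LineL2) :
    ∀ᵐ t, h.operator f t = ∫ s, (k t s : ℂ) * f s :=
  h.exists_operator.choose_spec.2 f

/-- Absolute convergence of the bilinear form of a Schur kernel. -/
theorem lintegral_bilin_lt_top (h : IsSchurKernel k A) (f g : LineL2) :
    ∫⁻ t, ‖g t‖ₑ * ∫⁻ s, ENNReal.ofReal (k t s) * ‖f s‖ₑ < ⊤ := by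
  have hold := ENNReal.lintegral_mul_le_Lp_mul_Lq volume Real.HolderConjugate.two_two
    (f := fun t => ‖g t‖ₑ) (g := fun t => ∫⁻ s, ENNReal.ofReal (k t s) * ‖f s‖ₑ)
    (Lp.aestronglyMeasurable g).enorm (h.aemeasurable_lintegral f)
  refine hold.trans_lt ?_
  simp only [ENNReal.rpow_two]
  refine ENNReal.mul_lt_top (ENNReal.rpow_lt_top_of_nonneg (by norm_num) ?_)
    (ENNReal.rpow_lt_top_of_nonneg (by norm_num) ?_)
  · rw [LineL2.lintegral_enorm_sq]; simp
  · exact ((h.lintegral_ofReal_mul_enorm_sq_le f).trans_lt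
      (ENNReal.mul_lt_top (by simp) (by simp))).ne

end IsSchurKernel

/-! ### The Poisson kernel along a ray -/

/-- Poisson kernel of the half plane along the ray of angle `φ` to the positive half-line: `t` is
the distance of the evaluation point to the vertex and `s > 0` is the boundary point. -/
noncomputable def rayKer (φ t s : ℝ) : ℝ :=
  Real.sin φ * t / (Real.pi * (s ^ 2 - 2 * s * t * Real.cos φ + t ^ 2))

section Primitive

variable {φ : ℝ}

theorem quad_pos {s : ℝ} (hs : 0 < s) {c : ℝ} (h : s ^ 2 + c ^ 2 = 1) (u : ℝ) :
    0 < u ^ 2 + 2 * c * u + 1 := by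
  nlinarith [sq_nonneg (u + c), mul_pos hs hs]

/-- Primitive of `u ↦ (2 / π) sin φ / (u⁴ - 2 u² cos φ + 1)` for `σ = 1`, and of `u²` times that
function for `σ = -1`. -/
noncomputable def rayPrim (σ φ u : ℝ) : ℝ :=
  1 / Real.pi * (σ * (Real.sin (φ / 2) / 2) * (Real.log (u ^ 2 + 2 * Real.cos (φ / 2) * u + 1) -
      Real.log (u ^ 2 + 2 * (-Real.cos (φ / 2)) * u + 1)) +
    Real.cos (φ / 2) * (Real.arctan ((u + Real.cos (φ / 2)) / Real.sin (φ / 2)) +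
      Real.arctan ((u - Real.cos (φ / 2)) / Real.sin (φ / 2))))

theorem sin_half_pos (hφ : φ ∈ Set.Ioo 0 Real.pi) : 0 < Real.sin (φ / 2) :=
  Real.sin_pos_of_pos_of_lt_pi (by linarith [hφ.1]) (by linarith [hφ.1, hφ.2])

theorem cos_half_pos (hφ : φ ∈ Set.Ioo 0 Real.pi) : 0 < Real.cos (φ / 2) :=
  Real.cos_pos_of_mem_Ioo ⟨by linarith [hφ.1, Real.pi_pos], by linarith [hφ.2]⟩

theorem hasDerivAt_rayPrim (hφ : φ ∈ Set.Ioo 0 Real.pi) (σ u : ℝ) :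
    HasDerivAt (rayPrim σ φ) (Real.sin φ / Real.pi * ((1 + σ) + (1 - σ) * u ^ 2) /
      (u ^ 4 - 2 * u ^ 2 * Real.cos φ + 1)) u := by
  have hs := sin_half_pos hφ
  have hsc := Real.sin_sq_add_cos_sq (φ / 2)
  have e1 : Real.sin φ = 2 * Real.sin (φ / 2) * Real.cos (φ / 2) := by
    rw [← Real.sin_two_mul]; congr 1; ring
  have e2 : Real.cos φ = 2 * Real.cos (φ / 2) ^ 2 - 1 := by
    rw [← Real.cos_two_mul]; congr 1; ring
  rw [e1, e2]
  unfold rayPrim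
  generalize Real.sin (φ / 2) = s at *
  generalize Real.cos (φ / 2) = c at *
  have hp := quad_pos hs hsc u
  have hm := quad_pos hs (c := -c) (by rwa [neg_sq]) u
  have d1 : ∀ c : ℝ, HasDerivAt (fun u : ℝ => u ^ 2 + 2 * c * u + 1) (2 * u + 2 * c) u :=
    fun c => by
    have := ((hasDerivAt_pow 2 u).add ((hasDerivAt_id u).const_mul (2 * c))).add_const 1
    refine this.congr_deriv ?_
    simp
  have d2 : ∀ c : ℝ, HasDerivAt (fun u : ℝ => (u + c) / s) (1 / s) u := fun c =>
    ((hasDerivAt_id u).add_const c).div_const s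
  have d3 : HasDerivAt (fun u : ℝ => (u - c) / s) (1 / s) u :=
    ((hasDerivAt_id u).sub_const c).div_const s
  have D := ((((d1 c).log hp.ne').sub ((d1 (-c)).log hm.ne')).const_mul (σ * (s / 2))).add
    (((d2 c).arctan.add d3.arctan).const_mul c) |>.const_mul (1 / Real.pi)
  refine D.congr_deriv ?_
  have a1 : 1 / (1 + ((u + c) / s) ^ 2) * (1 / s) = s / (u ^ 2 + 2 * c * u + 1) := by
    have : u ^ 2 + 2 * c * u + 1 = s ^ 2 + (u + c) ^ 2 := by linear_combination -hsc
    rw [this]; field_simp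
  have a2 : 1 / (1 + ((u - c) / s) ^ 2) * (1 / s) = s / (u ^ 2 + 2 * (-c) * u + 1) := by
    have : u ^ 2 + 2 * (-c) * u + 1 = s ^ 2 + (u - c) ^ 2 := by linear_combination -hsc
    rw [this]; field_simp
  have a3 : u ^ 4 - 2 * u ^ 2 * (2 * c ^ 2 - 1) + 1 =
      (u ^ 2 + 2 * c * u + 1) * (u ^ 2 + 2 * (-c) * u + 1) := by ring
  rw [a1, a2, a3]
  generalize hP : u ^ 2 + 2 * c * u + 1 = P at *
  generalize hM : u ^ 2 + 2 * (-c) * u + 1 = M at *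
  field_simp
  rw [← hP, ← hM]
  ring

theorem rayPrim_zero (σ φ : ℝ) : rayPrim σ φ 0 = 0 := by
  simp [rayPrim, neg_div, Real.arctan_neg]

theorem tendsto_rayPrim (hφ : φ ∈ Set.Ioo 0 Real.pi) (σ : ℝ) :
    Tendsto (rayPrim σ φ) atTop (𝓝 (Real.cos (φ / 2))) := by
  have hs := sin_half_pos hφ
  have hsc := Real.sin_sq_add_cos_sq (φ / 2)
  unfold rayPrim
  generalize Real.sin (φ / 2) = s at *
  generalize Real.cos (φ / 2) = c at *
  have hat : ∀ c : ℝ, Tendsto (fun u : ℝ => Real.arctan ((u + c) / s)) atTop (𝓝 (Real.pi / 2)) :=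
    fun c => (Real.tendsto_arctan_atTop.mono_right nhdsWithin_le_nhds).comp
      ((tendsto_atTop_add_const_right _ c tendsto_id).atTop_div_const hs)
  have hinv : Tendsto (fun u : ℝ => u⁻¹) atTop (𝓝 0) := tendsto_inv_atTop_zero
  have hlog1 : ∀ c : ℝ, Tendsto (fun u : ℝ => Real.log (1 + 2 * c * u⁻¹ + u⁻¹ ^ 2)) atTop (𝓝 0) :=
    fun c => by
    have h1 : Tendsto (fun u : ℝ => 1 + 2 * c * u⁻¹ + u⁻¹ ^ 2) atTop (𝓝 (1 + 2 * c * 0 + 0 ^ 2)) :=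
      ((hinv.const_mul (2 * c)).const_add 1).add (hinv.pow 2)
    have h2 := h1.log (by norm_num)
    simpa using h2
  have hlog : Tendsto (fun u : ℝ => Real.log (u ^ 2 + 2 * c * u + 1) -
      Real.log (u ^ 2 + 2 * (-c) * u + 1)) atTop (𝓝 0) := by
    have := (hlog1 c).sub (hlog1 (-c))
    rw [sub_zero] at this
    refine this.congr' ?_
    filter_upwards [eventually_gt_atTop 0] with u hu
    have e : ∀ c : ℝ, 1 + 2 * c * u⁻¹ + u⁻¹ ^ 2 = (u ^ 2 + 2 * c * u + 1) / u ^ 2 := fun c => by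
      field_simp
    rw [e, e, Real.log_div (quad_pos hs hsc u).ne' (by positivity),
      Real.log_div (quad_pos hs (c := -c) (by rwa [neg_sq]) u).ne' (by positivity)]
    ring
  have := ((hlog.const_mul (σ * (s / 2))).add (((hat c).add (hat (-c))).const_mul c)).const_mul
    (1 / Real.pi)
  have e : 1 / Real.pi * (σ * (s / 2) * 0 + c * (Real.pi / 2 + Real.pi / 2)) = c := by
    field_simp
    ring
  rw [e] at this
  exact this.congr fun u => by rw [← sub_eq_add_neg u c]

theorem rayKer_denom_pos (hφ : φ ∈ Set.Ioo 0 Real.pi) {t : ℝ} (ht : t ≠ 0) (s : ℝ) :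
    0 < s ^ 2 - 2 * s * t * Real.cos φ + t ^ 2 := by
  have h1 := Real.sin_pos_of_pos_of_lt_pi hφ.1 hφ.2
  have h2 := Real.sin_sq_add_cos_sq φ
  have : s ^ 2 - 2 * s * t * Real.cos φ + t ^ 2 =
      (s - t * Real.cos φ) ^ 2 + (t * Real.sin φ) ^ 2 := by linear_combination (-t ^ 2) * h2
  rw [this]
  have : 0 < (t * Real.sin φ) ^ 2 := by positivity
  positivity

theorem rayKer_nonneg (hφ : φ ∈ Set.Ioo 0 Real.pi) {t : ℝ} (ht : 0 ≤ t) (s : ℝ) :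
    0 ≤ rayKer φ t s := by
  rcases ht.eq_or_lt with rfl | ht
  · simp [rayKer]
  · have h1 := Real.sin_pos_of_pos_of_lt_pi hφ.1 hφ.2
    have := rayKer_denom_pos hφ ht.ne' s
    have := Real.pi_pos
    unfold rayKer
    positivity

theorem hasDerivAt_rayPrim_sqrt (hφ : φ ∈ Set.Ioo 0 Real.pi) (σ : ℝ) {a x : ℝ} (ha : 0 < a)
    (hx : 0 < x) : HasDerivAt (fun x => rayPrim σ φ √(x / a))
      (Real.sin φ / Real.pi * ((1 + σ) * a + (1 - σ) * x) * a /
        (2 * √x * √a * (x ^ 2 - 2 * x * a * Real.cos φ + a ^ 2))) x := by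
  have hxa : 0 < x / a := by positivity
  have h1 : HasDerivAt (fun x : ℝ => √(x / a)) (1 / (2 * √(x / a)) * (1 / a)) x :=
    (Real.hasDerivAt_sqrt hxa.ne').comp x ((hasDerivAt_id x).div_const a)
  refine ((hasDerivAt_rayPrim hφ σ √(x / a)).comp x h1).congr_deriv ?_
  have e4 : √(x / a) ^ 4 = (x / a) ^ 2 := by
    rw [show √(x / a) ^ 4 = (√(x / a) ^ 2) ^ 2 by ring, Real.sq_sqrt hxa.le]
  rw [e4, Real.sq_sqrt hxa.le, Real.sqrt_div hx.le]
  have hd := rayKer_denom_pos hφ ha.ne' x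
  have e5 : (x / a) ^ 2 - 2 * (x / a) * Real.cos φ + 1 =
      (x ^ 2 - 2 * x * a * Real.cos φ + a ^ 2) / a ^ 2 := by field_simp
  rw [e5]
  have h3 : 0 < √x := Real.sqrt_pos.2 hx
  have h4 : 0 < √a := Real.sqrt_pos.2 ha
  have h5 := Real.sq_sqrt ha.le
  have h6 := Real.sq_sqrt hx.le
  have h7 := Real.pi_pos
  generalize x ^ 2 - 2 * x * a * Real.cos φ + a ^ 2 = D at *
  field_simp
  rw [h5]
  ring

theorem hasDerivAt_rayPrim_row (hφ : φ ∈ Set.Ioo 0 Real.pi) {t s : ℝ} (ht : 0 < t) (hs : 0 < s) :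
    HasDerivAt (fun s => (√t)⁻¹ * rayPrim 1 φ √(s / t)) (rayKer φ t s * (√s)⁻¹) s := by
  refine ((hasDerivAt_rayPrim_sqrt hφ 1 ht hs).const_mul (√t)⁻¹).congr_deriv ?_
  have hd := rayKer_denom_pos hφ ht.ne' s
  have h3 : 0 < √s := Real.sqrt_pos.2 hs
  have h4 : 0 < √t := Real.sqrt_pos.2 ht
  have h5 := Real.sq_sqrt ht.le
  unfold rayKer
  generalize s ^ 2 - 2 * s * t * Real.cos φ + t ^ 2 = D at *
  field_simp
  rw [h5]
  ring

theorem hasDerivAt_rayPrim_col (hφ : φ ∈ Set.Ioo 0 Real.pi) {t s : ℝ} (ht : 0 < t) (hs : 0 < s) :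
    HasDerivAt (fun t => (√s)⁻¹ * rayPrim (-1) φ √(t / s)) (rayKer φ t s * (√t)⁻¹) t := by
  refine ((hasDerivAt_rayPrim_sqrt hφ (-1) hs ht).const_mul (√s)⁻¹).congr_deriv ?_
  have hd := rayKer_denom_pos hφ ht.ne' s
  have e : t ^ 2 - 2 * t * s * Real.cos φ + s ^ 2 = s ^ 2 - 2 * s * t * Real.cos φ + t ^ 2 := by
    ring
  rw [e]
  have h3 : 0 < √s := Real.sqrt_pos.2 hs
  have h4 : 0 < √t := Real.sqrt_pos.2 ht
  have h5 := Real.sq_sqrt hs.le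
  unfold rayKer
  generalize s ^ 2 - 2 * s * t * Real.cos φ + t ^ 2 = D at *
  field_simp
  rw [h5]
  ring

theorem lintegral_of_hasDerivAt_rayPrim (hφ : φ ∈ Set.Ioo 0 Real.pi) (σ : ℝ) {a : ℝ} (ha : 0 < a)
    {G : ℝ → ℝ} (hG : ∀ x > 0, 0 ≤ G x)
    (hd : ∀ x > 0, HasDerivAt (fun x => (√a)⁻¹ * rayPrim σ φ √(x / a)) (G x) x) :
    ∫⁻ x in Set.Ioi 0, ENNReal.ofReal (G x) =
      ENNReal.ofReal (Real.cos (φ / 2)) * schurWeight a := by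
  have hcont : Continuous (rayPrim σ φ) := continuous_iff_continuousAt.2 fun u =>
    (hasDerivAt_rayPrim hφ σ u).continuousAt
  have hc : ContinuousWithinAt (fun x => (√a)⁻¹ * rayPrim σ φ √(x / a)) (Set.Ici 0) 0 :=
    (continuous_const.mul (hcont.comp
      (Real.continuous_sqrt.comp (continuous_id.div_const a)))).continuousWithinAt
  have hlim : Tendsto (fun x => (√a)⁻¹ * rayPrim σ φ √(x / a)) atTop
      (𝓝 ((√a)⁻¹ * Real.cos (φ / 2))) :=
    ((tendsto_rayPrim hφ σ).comp (Real.tendsto_sqrt_atTop.comp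
      (tendsto_id.atTop_div_const ha))).const_mul _
  have hint := integrableOn_Ioi_deriv_of_nonneg hc hd hG hlim
  have hval := integral_Ioi_of_hasDerivAt_of_nonneg hc hd hG hlim
  rw [← ofReal_integral_eq_lintegral_ofReal hint
    ((ae_restrict_iff' measurableSet_Ioi).2 (Eventually.of_forall hG)), hval]
  simp only [zero_div, Real.sqrt_zero, rayPrim_zero, mul_zero, sub_zero]
  rw [schurWeight, ← ENNReal.ofReal_mul (cos_half_pos hφ).le, abs_of_pos ha, mul_comm]

theorem lintegral_rayKer_row (hφ : φ ∈ Set.Ioo 0 Real.pi) {t : ℝ} (ht : 0 < t) :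
    ∫⁻ s in Set.Ioi 0, ENNReal.ofReal (rayKer φ t s) * schurWeight s =
      ENNReal.ofReal (Real.cos (φ / 2)) * schurWeight t := by
  rw [← lintegral_of_hasDerivAt_rayPrim hφ 1 ht (G := fun s => rayKer φ t s * (√s)⁻¹)
    (fun s _ => mul_nonneg (rayKer_nonneg hφ ht.le s) (by positivity))
    fun s hs => hasDerivAt_rayPrim_row hφ ht hs]
  refine setLIntegral_congr_fun measurableSet_Ioi fun s (hs : 0 < s) => ?_
  rw [schurWeight, abs_of_pos hs, ENNReal.ofReal_mul (rayKer_nonneg hφ ht.le s)]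

theorem lintegral_rayKer_col (hφ : φ ∈ Set.Ioo 0 Real.pi) {s : ℝ} (hs : 0 < s) :
    ∫⁻ t in Set.Ioi 0, ENNReal.ofReal (rayKer φ t s) * schurWeight t =
      ENNReal.ofReal (Real.cos (φ / 2)) * schurWeight s := by
  rw [← lintegral_of_hasDerivAt_rayPrim hφ (-1) hs (G := fun t => rayKer φ t s * (√t)⁻¹)
    (fun t ht => mul_nonneg (rayKer_nonneg hφ ht.le s) (by positivity))
    fun t ht => hasDerivAt_rayPrim_col hφ ht hs]
  refine setLIntegral_congr_fun measurableSet_Ioi fun t (ht : 0 < t) => ?_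
  rw [schurWeight, abs_of_pos ht, ENNReal.ofReal_mul (rayKer_nonneg hφ ht.le s)]

end Primitive

theorem lintegral_abs_ite_pos {ε : ℝ} (hε : ε ≠ 0) (G : ℝ → ENNReal) :
    ∫⁻ s, (if 0 < ε * s then G |s| else 0) = ∫⁻ s in Set.Ioi 0, G s := by
  rw [← lintegral_indicator measurableSet_Ioi]
  rcases hε.lt_or_gt with h | h
  · rw [← (Measure.measurePreserving_neg (volume : Measure ℝ)).lintegral_comp_emb
      (MeasurableEquiv.neg ℝ).measurableEmbedding]
    refine lintegral_congr fun s => ?_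
    by_cases hs : 0 < s
    · rw [if_pos (mul_pos_of_neg_of_neg h (neg_lt_zero.2 hs)),
        Set.indicator_of_mem (by simpa using hs), abs_neg, abs_of_pos hs]
    · rw [if_neg (not_lt.2 (mul_nonpos_of_nonpos_of_nonneg h.le (neg_nonneg.2 (not_lt.1 hs)))),
        Set.indicator_of_notMem (by simpa using hs)]
  · refine lintegral_congr fun s => ?_
    by_cases hs : 0 < s
    · rw [if_pos (mul_pos h hs), Set.indicator_of_mem (by simpa using hs), abs_of_pos hs]
    · rw [if_neg (not_lt.2 (mul_nonpos_of_nonneg_of_nonpos h.le (not_lt.1 hs))),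
        Set.indicator_of_notMem (by simpa using hs)]

/-- The kernel `rayKer φ |t| |s|` restricted to points `s`, `t` of equal sign (`σ > 0`) or of
opposite signs (`σ < 0`). -/
noncomputable def sideKer (σ φ t s : ℝ) : ℝ := if 0 < σ * (s * t) then rayKer φ |t| |s| else 0

theorem measurable_sideKer (σ φ : ℝ) : Measurable (Function.uncurry (sideKer σ φ)) := by
  unfold sideKer rayKer Function.uncurry
  refine Measurable.ite (measurableSet_lt measurable_const (by fun_prop)) (by fun_prop)
    measurable_const

theorem isSchurKernel_sideKer {φ : ℝ} (hφ : φ ∈ Set.Ioo 0 Real.pi) {σ : ℝ} (hσ : σ ≠ 0) :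
    IsSchurKernel (sideKer σ φ) (Real.cos (φ / 2)) where
  measurable := measurable_sideKer σ φ
  nonneg t s := by
    unfold sideKer
    split_ifs
    · exact rayKer_nonneg hφ (abs_nonneg t) _
    · exact le_rfl
  const_nonneg := (cos_half_pos hφ).le
  row t ht := by
    have e : ∀ s, ENNReal.ofReal (sideKer σ φ t s) * schurWeight s =
        if 0 < (σ * t) * s then ENNReal.ofReal (rayKer φ |t| |s|) * schurWeight |s| else 0 :=
      fun s => by
      rw [sideKer, show σ * (s * t) = σ * t * s by ring]
      split_ifs <;> simp [schurWeight]
    simp_rw [e]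
    rw [lintegral_abs_ite_pos (mul_ne_zero hσ ht)
      (fun s => ENNReal.ofReal (rayKer φ |t| s) * schurWeight s),
      lintegral_rayKer_row hφ (abs_pos.2 ht)]
    simp [schurWeight]
  col s hs := by
    have e : ∀ t, ENNReal.ofReal (sideKer σ φ t s) * schurWeight t =
        if 0 < (σ * s) * t then ENNReal.ofReal (rayKer φ |t| |s|) * schurWeight |t| else 0 :=
      fun t => by
      rw [sideKer, show σ * (s * t) = σ * s * t by ring]
      split_ifs <;> simp [schurWeight]
    simp_rw [e]
    rw [lintegral_abs_ite_pos (mul_ne_zero hσ hs)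
      (fun t => ENNReal.ofReal (rayKer φ t |s|) * schurWeight t),
      lintegral_rayKer_col hφ (abs_pos.2 hs)]
    simp [schurWeight]

/-! ### The Cauchy operator in the arc length parameter -/

/-- The pole, as a function of the position `t` on the flattened boundary of the cone, of the
Cauchy kernel in the variable of the opposite edge. -/
noncomputable def oppPole (θ t : ℝ) : ℂ := ⟨-(t * Real.cos θ), |t| * Real.sin θ⟩

theorem sin_pos_of_mem {θ : ℝ} (hθ : θ ∈ Set.Ioo 0 Real.pi) : 0 < Real.sin θ :=
  Real.sin_pos_of_pos_of_lt_pi hθ.1 hθ.2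

theorem pi_sub_mem {θ : ℝ} (hθ : θ ∈ Set.Ioo 0 Real.pi) : Real.pi - θ ∈ Set.Ioo 0 Real.pi :=
  ⟨by linarith [hθ.2], by linarith [hθ.1]⟩

theorem oppPole_im_pos {θ : ℝ} (hθ : θ ∈ Set.Ioo 0 Real.pi) {t : ℝ} (ht : t ≠ 0) :
    0 < (oppPole θ t).im :=
  mul_pos (abs_pos.2 ht) (sin_pos_of_mem hθ)

theorem oppPole_denom_pos {θ : ℝ} (hθ : θ ∈ Set.Ioo 0 Real.pi) {t : ℝ} (ht : t ≠ 0) (s : ℝ) :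
    0 < s ^ 2 + 2 * s * t * Real.cos θ + t ^ 2 := by
  have := rayKer_denom_pos hθ (t := -t) (neg_ne_zero.2 ht) s
  linarith [this]

theorem res_sub_res_oppPole {θ : ℝ} (hθ : θ ∈ Set.Ioo 0 Real.pi) {t : ℝ} (ht : t ≠ 0) (s : ℝ) :
    res (oppPole θ t) s - res ((starRingEnd ℂ) (oppPole θ t)) s =
      2 * Real.pi * Complex.I * (|t| * Real.sin θ /
        (Real.pi * (s ^ 2 + 2 * s * t * Real.cos θ + t ^ 2)) : ℝ) := by
  have him := oppPole_im_pos hθ ht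
  rw [res_sub_res him.ne' (by simpa using him.ne'), Complex.sub_conj]
  have h1 : res (oppPole θ t) s * res ((starRingEnd ℂ) (oppPole θ t)) s =
      ((s ^ 2 + 2 * s * t * Real.cos θ + t ^ 2 : ℝ) : ℂ)⁻¹ := by
    have e : (s - (oppPole θ t).re) ^ 2 + (oppPole θ t).im ^ 2 =
        s ^ 2 + 2 * s * t * Real.cos θ + t ^ 2 := by
      simp only [oppPole]
      rw [mul_pow, sq_abs]
      linear_combination t ^ 2 * Real.sin_sq_add_cos_sq θ
    rw [← conj_res, Complex.mul_conj, Complex.normSq_eq_norm_sq, norm_res_sq, Complex.ofReal_inv, e]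
  rw [h1]
  have hd := oppPole_denom_pos hθ ht s
  generalize s ^ 2 + 2 * s * t * Real.cos θ + t ^ 2 = D at *
  have hD : (D : ℂ) ≠ 0 := by exact_mod_cast hd.ne'
  have hpi : (Real.pi : ℂ) ≠ 0 := by exact_mod_cast Real.pi_ne_zero
  simp only [oppPole]
  push_cast
  field_simp

theorem sideKer_neg_eq {θ : ℝ} {t s : ℝ} (h : s * t < 0) : sideKer (-1) θ t s =
    |t| * Real.sin θ / (Real.pi * (s ^ 2 + 2 * s * t * Real.cos θ + t ^ 2)) := by
  rw [sideKer, if_pos (by linarith), rayKer, sq_abs, sq_abs, mul_assoc 2, ← abs_mul, abs_of_neg h,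
    mul_comm |t|]
  congr 2
  ring

theorem sideKer_pos_eq {θ : ℝ} {t s : ℝ} (h : 0 < s * t) : sideKer 1 (Real.pi - θ) t s =
    |t| * Real.sin θ / (Real.pi * (s ^ 2 + 2 * s * t * Real.cos θ + t ^ 2)) := by
  rw [sideKer, if_pos (by linarith), rayKer, sq_abs, sq_abs, mul_assoc 2, ← abs_mul, abs_of_pos h,
    mul_comm |t|, Real.sin_pi_sub, Real.cos_pi_sub]
  congr 2
  ring

/-- The two-sided kernel is the Poisson kernel of the upper half plane with pole `oppPole θ t`. -/
theorem sideKer_add_sideKer {θ : ℝ} (hθ : θ ∈ Set.Ioo 0 Real.pi) {t s : ℝ} (ht : t ≠ 0)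
    (hs : s ≠ 0) :
    2 * Real.pi * Complex.I * ((sideKer (-1) θ t s : ℂ) + sideKer 1 (Real.pi - θ) t s) =
      res (oppPole θ t) s - res ((starRingEnd ℂ) (oppPole θ t)) s := by
  rw [res_sub_res_oppPole hθ ht]
  rcases (mul_ne_zero hs ht).lt_or_gt with h | h
  · have h0 : sideKer 1 (Real.pi - θ) t s = 0 := by
      rw [sideKer, if_neg (by linarith)]
    rw [h0, sideKer_neg_eq h, Complex.ofReal_zero, add_zero]
  · have h0 : sideKer (-1) θ t s = 0 := by
      rw [sideKer, if_neg (by linarith)]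
    rw [h0, sideKer_pos_eq h, Complex.ofReal_zero, zero_add]

section Operators

variable {θ : ℝ} (hθ : θ ∈ Set.Ioo 0 Real.pi)

/-- The double layer potential operator, with its nonnegative kernel, on the flattened boundary of
the cone. -/
noncomputable def flatDoubleLayer : LineL2 →L[ℂ] LineL2 :=
  (isSchurKernel_sideKer hθ (σ := -1) (by norm_num)).operator

theorem norm_flatDoubleLayer_le (f : LineL2) :
    ‖flatDoubleLayer hθ f‖ ≤ Real.cos (θ / 2) * ‖f‖ :=
  IsSchurKernel.norm_operator_le _ f

theorem coeFn_flatDoubleLayer (f : LineL2) :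
    ∀ᵐ t, flatDoubleLayer hθ f t = ∫ s, (sideKer (-1) θ t s : ℂ) * f s :=
  IsSchurKernel.coeFn_operator _ f

/-- Poisson extension from the line to the curve `t ↦ oppPole θ t`. -/
noncomputable def poissonOp : LineL2 →L[ℂ] LineL2 :=
  flatDoubleLayer hθ +
    (isSchurKernel_sideKer (pi_sub_mem hθ) (σ := 1) (by norm_num)).operator

theorem norm_poissonOp_le (f : LineL2) : ‖poissonOp hθ f‖ ≤ 2 * ‖f‖ := by
  have h0 : ‖poissonOp hθ f‖ ≤ ‖flatDoubleLayer hθ f‖ +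
    ‖(isSchurKernel_sideKer (pi_sub_mem hθ) (σ := 1) (by norm_num)).operator f‖ := norm_add_le _ _
  have h1 := norm_flatDoubleLayer_le hθ f
  have h2 := (isSchurKernel_sideKer (pi_sub_mem hθ) (σ := 1) (by norm_num)).norm_operator_le f
  have h3 := mul_le_mul_of_nonneg_right (Real.cos_le_one (θ / 2)) (norm_nonneg f)
  have h4 := mul_le_mul_of_nonneg_right (Real.cos_le_one ((Real.pi - θ) / 2)) (norm_nonneg f)
  linarith

theorem coeFn_poissonOp (f : LineL2) : ∀ᵐ t, 2 * Real.pi * Complex.I * poissonOp hθ f t =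
    (∫ s, f s * res (oppPole θ t) s) - ∫ s, f s * res ((starRingEnd ℂ) (oppPole θ t)) s := by
  have K1 := isSchurKernel_sideKer hθ (σ := -1) (by norm_num)
  have K2 := isSchurKernel_sideKer (pi_sub_mem hθ) (σ := 1) (by norm_num)
  filter_upwards [Lp.coeFn_add (K1.operator f) (K2.operator f), K1.coeFn_operator f,
    K2.coeFn_operator f, K1.ae_integrable f, K2.ae_integrable f, ae_ne_zero]
    with t h h1 h2 i1 i2 ht
  have him := oppPole_im_pos hθ ht
  have h' : poissonOp hθ f t = K1.operator f t + K2.operator f t := h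
  rw [h', h1, h2, ← integral_add i1 i2, ← integral_const_mul,
    ← integral_sub (LineL2.integrable_mul_res f him.ne')
      (LineL2.integrable_mul_res f (by simpa using him.ne'))]
  refine integral_congr_ae ?_
  filter_upwards [ae_ne_zero] with s hs
  rw [← mul_sub, ← sideKer_add_sideKer hθ ht hs]
  ring

/-- Along `t ↦ oppPole θ t`, the Cauchy integral of `f` is the Poisson integral of its Cauchy
projection. -/
theorem coeFn_poissonOp_lineProj (f : LineL2) :
    ∀ᵐ t, 2 * Real.pi * Complex.I * poissonOp hθ (lineProj f) t =
      ∫ s, f s * res (oppPole θ t) s := by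
  filter_upwards [coeFn_poissonOp hθ (lineProj f), ae_ne_zero] with t h ht
  have him := oppPole_im_pos hθ ht
  rw [h, integral_lineProj_mul_res_of_pos _ him,
    integral_lineProj_mul_res_of_neg _ (by simpa using him), sub_zero]

/-- The Cauchy integral operator of the cone, on functions of the arc length parameter.  The own
edge contributes a Hilbert transform.  The opposite edge contributes the Cauchy integral at
`oppPole θ t`, written as the Poisson integral of a Cauchy projection, as the Poisson kernel is
accessible to Schur's test. -/
noncomputable def flatCauchy : LineL2 →L[ℂ] LineL2 :=
  cutPos ∘L (lineHilbert ∘L cutPos + (2 : ℂ) • (poissonOp hθ ∘L lineProj ∘L cutNeg)) +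
  cutNeg ∘L (lineHilbert ∘L cutNeg + (2 : ℂ) • (poissonOp hθ ∘L lineProj ∘L cutPos))

theorem flatCauchy_apply (f : LineL2) : flatCauchy hθ f =
    cutPos (lineHilbert (cutPos f) + (2 : ℂ) • poissonOp hθ (lineProj (cutNeg f))) +
    cutNeg (lineHilbert (cutNeg f) + (2 : ℂ) • poissonOp hθ (lineProj (cutPos f))) := rfl

/-- The Cauchy operator is bounded uniformly in the opening angle. -/
theorem norm_flatCauchy_le (f : LineL2) : ‖flatCauchy hθ f‖ ≤ 14 * ‖f‖ := by
  have key : ∀ (A B C : Set ℝ) (hA : MeasurableSet A) (hB : MeasurableSet B)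
      (hC : MeasurableSet C), ‖cutoff A hA (lineHilbert (cutoff B hB f) +
      (2 : ℂ) • poissonOp hθ (lineProj (cutoff C hC f)))‖ ≤ 7 * ‖f‖ := fun A B C hA hB hC => by
    refine (norm_cutoff_le _ _ _).trans ((norm_add_le _ _).trans ?_)
    rw [norm_smul, Complex.norm_ofNat]
    have h1 := norm_lineHilbert_le (cutoff B hB f)
    have h2 := norm_poissonOp_le hθ (lineProj (cutoff C hC f))
    have h3 := norm_lineProj_le (cutoff C hC f)
    have h4 := norm_cutoff_le B hB f
    have h5 := norm_cutoff_le C hC f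
    linarith
  rw [flatCauchy_apply]
  refine (norm_add_le _ _).trans ?_
  have h1 := key (Set.Ioi 0) (Set.Ioi 0) (Set.Iio 0) measurableSet_Ioi measurableSet_Ioi
    measurableSet_Iio
  have h2 := key (Set.Iio 0) (Set.Iio 0) (Set.Ioi 0) measurableSet_Iio measurableSet_Iio
    measurableSet_Ioi
  linarith

theorem coeFn_flatCauchy_aux (A : Set ℝ) (hA : MeasurableSet A) (u f : LineL2) :
    ∀ᵐ t, t ∈ A → cutoff A hA (u + (2 : ℂ) • poissonOp hθ (lineProj f)) t =
      u t + (Real.pi * Complex.I)⁻¹ * ∫ s, f s * res (oppPole θ t) s := by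
  filter_upwards [coeFn_cutoff A hA (u + (2 : ℂ) • poissonOp hθ (lineProj f)),
    Lp.coeFn_add u ((2 : ℂ) • poissonOp hθ (lineProj f)),
    Lp.coeFn_smul (2 : ℂ) (poissonOp hθ (lineProj f)), coeFn_poissonOp_lineProj hθ f]
    with t h1 h2 h3 h4 ht
  rw [h1, Set.indicator_of_mem ht, h2, Pi.add_apply, h3, Pi.smul_apply, ← h4, smul_eq_mul]
  have hpi : (Real.pi : ℂ) ≠ 0 := by exact_mod_cast Real.pi_ne_zero
  field_simp

theorem coeFn_flatCauchy_of_pos (f : LineL2) :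
    ∀ᵐ t, 0 < t → flatCauchy hθ f t = lineHilbert (cutPos f) t +
      (Real.pi * Complex.I)⁻¹ * ∫ s, cutNeg f s * res (oppPole θ t) s := by
  filter_upwards [coeFn_flatCauchy_aux hθ (Set.Ioi 0) measurableSet_Ioi (lineHilbert (cutPos f))
    (cutNeg f), coeFn_cutoff (Set.Iio 0) measurableSet_Iio (lineHilbert (cutNeg f) +
      (2 : ℂ) • poissonOp hθ (lineProj (cutPos f))), Lp.coeFn_add
    (cutPos (lineHilbert (cutPos f) + (2 : ℂ) • poissonOp hθ (lineProj (cutNeg f))))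
    (cutNeg (lineHilbert (cutNeg f) + (2 : ℂ) • poissonOp hθ (lineProj (cutPos f))))]
    with t h1 h2 h3 ht
  rw [flatCauchy_apply, h3, Pi.add_apply, h1 ht, h2,
    Set.indicator_of_notMem (by simpa using ht.le), add_zero]

theorem coeFn_flatCauchy_of_neg (f : LineL2) :
    ∀ᵐ t, t < 0 → flatCauchy hθ f t = lineHilbert (cutNeg f) t +
      (Real.pi * Complex.I)⁻¹ * ∫ s, cutPos f s * res (oppPole θ t) s := by
  filter_upwards [coeFn_flatCauchy_aux hθ (Set.Iio 0) measurableSet_Iio (lineHilbert (cutNeg f))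
    (cutPos f), coeFn_cutoff (Set.Ioi 0) measurableSet_Ioi (lineHilbert (cutPos f) +
      (2 : ℂ) • poissonOp hθ (lineProj (cutNeg f))), Lp.coeFn_add
    (cutPos (lineHilbert (cutPos f) + (2 : ℂ) • poissonOp hθ (lineProj (cutNeg f))))
    (cutNeg (lineHilbert (cutNeg f) + (2 : ℂ) • poissonOp hθ (lineProj (cutPos f))))]
    with t h1 h2 h3 ht
  rw [flatCauchy_apply, h3, Pi.add_apply, h1 ht, h2,
    Set.indicator_of_notMem (by simpa using ht.le), zero_add]

/-- The real part of the opposite edge contribution is the double layer potential. -/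
theorem cross_add_conj (hθ : θ ∈ Set.Ioo 0 Real.pi) (A : Set ℝ) (hA : MeasurableSet A)
    (f : LineL2) {t : ℝ} (ht : t ≠ 0) (hAt : ∀ s, s ≠ 0 → (s ∈ A ↔ s * t < 0)) :
    (Real.pi * Complex.I)⁻¹ * (∫ s, cutoff A hA f s * res (oppPole θ t) s) +
      (starRingEnd ℂ) ((Real.pi * Complex.I)⁻¹ *
        ∫ s, cutoff A hA (lineConj f) s * res (oppPole θ t) s) =
      2 * ∫ s, (sideKer (-1) θ t s : ℂ) * f s := by
  have him := oppPole_im_pos hθ ht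
  rw [← lineConj_cutoff, integral_lineConj_mul_res, map_mul, Complex.conj_conj]
  have e1 : (starRingEnd ℂ) (Real.pi * Complex.I)⁻¹ = -(Real.pi * Complex.I)⁻¹ := by
    rw [map_inv₀, map_mul, Complex.conj_ofReal, Complex.conj_I, mul_neg, inv_neg]
  rw [e1, neg_mul, ← sub_eq_add_neg, ← mul_sub,
    ← integral_sub (LineL2.integrable_mul_res _ him.ne')
      (LineL2.integrable_mul_res _ (by simpa using him.ne')), ← integral_const_mul,
    ← integral_const_mul]
  refine integral_congr_ae ?_
  filter_upwards [coeFn_cutoff A hA f, ae_ne_zero] with s hs hs0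
  rw [← mul_sub, res_sub_res_oppPole hθ ht, hs]
  by_cases h : s * t < 0
  · rw [Set.indicator_of_mem ((hAt s hs0).2 h), sideKer_neg_eq h]
    have hpi : (Real.pi : ℂ) ≠ 0 := by exact_mod_cast Real.pi_ne_zero
    field_simp
  · rw [Set.indicator_of_notMem (fun hm => h ((hAt s hs0).1 hm)), sideKer, if_neg (by linarith)]
    simp

/-- The real part of the Cauchy operator is the double layer potential. -/
theorem flatCauchy_add_conj (f : LineL2) :
    flatCauchy hθ f + lineConj (flatCauchy hθ (lineConj f)) = (2 : ℂ) • flatDoubleLayer hθ f := by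
  have hH : ∀ (A : Set ℝ) (hA : MeasurableSet A), ∀ᵐ t, lineHilbert (cutoff A hA f) t +
      (starRingEnd ℂ) (lineHilbert (cutoff A hA (lineConj f)) t) = 0 := fun A hA => by
    have e : lineHilbert (cutoff A hA (lineConj f)) = -lineConj (lineHilbert (cutoff A hA f)) := by
      rw [← lineConj_cutoff, lineHilbert_lineConj]
    rw [e]
    filter_upwards [Lp.coeFn_neg (lineConj (lineHilbert (cutoff A hA f))),
      coeFn_lineConj (lineHilbert (cutoff A hA f))] with t h1 h2
    rw [h1, Pi.neg_apply, h2, map_neg, Complex.conj_conj, add_neg_cancel]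
  apply Lp.ext
  filter_upwards [Lp.coeFn_add (flatCauchy hθ f) (lineConj (flatCauchy hθ (lineConj f))),
    coeFn_lineConj (flatCauchy hθ (lineConj f)), Lp.coeFn_smul (2 : ℂ) (flatDoubleLayer hθ f),
    coeFn_flatDoubleLayer hθ f, coeFn_flatCauchy_of_pos hθ f, coeFn_flatCauchy_of_neg hθ f,
    coeFn_flatCauchy_of_pos hθ (lineConj f), coeFn_flatCauchy_of_neg hθ (lineConj f),
    hH (Set.Ioi 0) measurableSet_Ioi, hH (Set.Iio 0) measurableSet_Iio, ae_ne_zero]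
    with t h1 h2 h3 h4 p n cp cn Hp Hn ht
  rw [h1, Pi.add_apply, h2, h3, Pi.smul_apply, h4, smul_eq_mul]
  rcases ht.lt_or_gt with h | h
  · rw [n h, cn h, ← cross_add_conj hθ (Set.Ioi 0) measurableSet_Ioi f ht fun s _ =>
      ⟨fun hs => mul_neg_of_pos_of_neg hs h, fun hs => (pos_iff_neg_of_mul_neg hs).2 h⟩, map_add]
    linear_combination Hn
  · rw [p h, cp h, ← cross_add_conj hθ (Set.Iio 0) measurableSet_Iio f ht fun s _ =>
      ⟨fun hs => mul_neg_of_neg_of_pos hs h, fun hs => (neg_iff_pos_of_mul_neg hs).2 h⟩, map_add]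
    linear_combination Hp

end Operators

/-! ### Skew symmetry for the pairing `∫ f g dz` -/

theorem cutoff_cutoff_self (A : Set ℝ) (hA : MeasurableSet A) (f : LineL2) :
    cutoff A hA (cutoff A hA f) = cutoff A hA f := by
  apply Lp.ext
  filter_upwards [coeFn_cutoff A hA f, coeFn_cutoff A hA (cutoff A hA f)] with s h1 h2
  rw [h2]
  by_cases hs : s ∈ A
  · rw [Set.indicator_of_mem hs]
  · rw [Set.indicator_of_notMem hs, h1, Set.indicator_of_notMem hs]

theorem cutoff_cutoff_of_disjoint {A B : Set ℝ} (hA : MeasurableSet A) (hB : MeasurableSet B)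
    (hAB : Disjoint A B) (f : LineL2) : cutoff A hA (cutoff B hB f) = 0 := by
  apply Lp.ext
  filter_upwards [coeFn_cutoff B hB f, coeFn_cutoff A hA (cutoff B hB f),
    Lp.coeFn_zero ℂ 2 (volume : Measure ℝ)] with s h1 h2 h3
  rw [h2, h3]
  by_cases hs : s ∈ A
  · rw [Set.indicator_of_mem hs, h1, Set.indicator_of_notMem (hAB.notMem_of_mem_left hs)]
    rfl
  · rw [Set.indicator_of_notMem hs]
    rfl

theorem disjoint_Ioi_Iio : Disjoint (Set.Ioi (0 : ℝ)) (Set.Iio 0) :=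
  Set.disjoint_left.2 fun _ h1 h2 =>
    lt_asymm (Set.mem_Ioi.1 h1) (Set.mem_Iio.1 h2)

theorem cutPos_add_cutNeg (f : LineL2) : cutPos f + cutNeg f = f := by
  apply Lp.ext
  filter_upwards [Lp.coeFn_add (cutPos f) (cutNeg f), coeFn_cutoff (Set.Ioi 0) measurableSet_Ioi f,
    coeFn_cutoff (Set.Iio 0) measurableSet_Iio f, ae_ne_zero] with s h1 h2 h3 hs
  rw [h1, Pi.add_apply, h2, h3]
  rcases hs.lt_or_gt with h | h
  · rw [Set.indicator_of_notMem (by simpa using h.le), Set.indicator_of_mem (by exact h), zero_add]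
  · rw [Set.indicator_of_mem (by exact h), Set.indicator_of_notMem (by simpa using h.le), add_zero]

theorem LineL2.integrable_mul (f g : LineL2) : Integrable fun s => f s * g s :=
  (LineL2.memLp f).integrable_mul (LineL2.memLp g)

theorem integral_add_mul (f g h : LineL2) :
    ∫ s, (f + g : LineL2) s * h s = (∫ s, f s * h s) + ∫ s, g s * h s := by
  rw [← integral_add (LineL2.integrable_mul f h) (LineL2.integrable_mul g h)]
  refine integral_congr_ae ?_
  filter_upwards [Lp.coeFn_add f g] with s hs
  rw [hs, Pi.add_apply, add_mul]

theorem integral_mul_comm (f g : LineL2) : ∫ s, f s * g s = ∫ s, g s * f s := by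
  simp_rw [mul_comm]

theorem integral_smul_mul (c : ℂ) (f : LineL2) (k : ℝ → ℂ) :
    ∫ s, (c • f : LineL2) s * k s = c * ∫ s, f s * k s := by
  rw [← integral_const_mul]
  refine integral_congr_ae ?_
  filter_upwards [Lp.coeFn_smul c f] with s hs
  rw [hs, Pi.smul_apply, smul_eq_mul, mul_assoc]

theorem exp_neg_mul_exp (θ : ℝ) :
    Complex.exp (-(θ * Complex.I)) * Complex.exp (θ * Complex.I) = 1 := by
  rw [← Complex.exp_add, neg_add_cancel, Complex.exp_zero]

theorem oppPole_of_pos {t : ℝ} (θ : ℝ) (ht : 0 < t) :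
    oppPole θ t = -(t * Complex.exp (-(θ * Complex.I))) := by
  rw [show -(θ * Complex.I) = ((-θ : ℝ) : ℂ) * Complex.I by push_cast; ring, Complex.exp_mul_I]
  apply Complex.ext <;>
    simp [oppPole, abs_of_pos ht, ← Complex.ofReal_cos, ← Complex.ofReal_sin]

theorem oppPole_of_neg {t : ℝ} (θ : ℝ) (ht : t < 0) :
    oppPole θ t = -(t * Complex.exp (θ * Complex.I)) := by
  rw [Complex.exp_mul_I]
  apply Complex.ext <;>
    simp [oppPole, abs_of_neg ht, ← Complex.ofReal_cos, ← Complex.ofReal_sin]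

theorem measurable_oppPole (θ : ℝ) : Measurable (oppPole θ) := by
  have h : oppPole θ = fun t => ((-(t * Real.cos θ) : ℝ) : ℂ) +
      ((|t| * Real.sin θ : ℝ) : ℂ) * Complex.I := by
    ext t
    exact (Complex.re_add_im _).symm
  rw [h]
  fun_prop

/-- The Cauchy kernel between opposite edges is dominated by the symmetrised double layer
kernel. -/
theorem norm_res_oppPole_le {θ : ℝ} (hθ : θ ∈ Set.Ioo 0 Real.pi) {t s : ℝ} (h : s * t < 0) :
    ‖res (oppPole θ t) s‖ ≤
      Real.pi / Real.sin θ * (sideKer (-1) θ t s + sideKer (-1) θ s t) := by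
  have ht : t ≠ 0 := fun h0 => by simp [h0] at h
  have hd := oppPole_denom_pos hθ ht s
  have hsin := sin_pos_of_mem hθ
  rw [sideKer_neg_eq h, sideKer_neg_eq (by rwa [mul_comm] at h),
    show t ^ 2 + 2 * t * s * Real.cos θ + s ^ 2 = s ^ 2 + 2 * s * t * Real.cos θ + t ^ 2 by ring]
  have e : ‖res (oppPole θ t) s‖ ^ 2 = (s ^ 2 + 2 * s * t * Real.cos θ + t ^ 2)⁻¹ := by
    rw [norm_res_sq]
    congr 1
    simp only [oppPole]
    rw [mul_pow (|t|), sq_abs]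
    linear_combination t ^ 2 * Real.sin_sq_add_cos_sq θ
  have hle : s ^ 2 + 2 * s * t * Real.cos θ + t ^ 2 ≤ (|t| + |s|) ^ 2 := by
    have h1 : |s * t * Real.cos θ| ≤ |s| * |t| := by
      rw [abs_mul, abs_mul]
      exact mul_le_of_le_one_right (by positivity) (Real.abs_cos_le_one θ)
    nlinarith [le_abs_self (s * t * Real.cos θ), sq_abs s, sq_abs t]
  generalize s ^ 2 + 2 * s * t * Real.cos θ + t ^ 2 = D at *
  have e2 : Real.pi / Real.sin θ * (|t| * Real.sin θ / (Real.pi * D) +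
      |s| * Real.sin θ / (Real.pi * D)) = (|t| + |s|) / D := by
    field_simp
  rw [e2]
  refine le_of_sq_le_sq ?_ (by positivity)
  rw [e, div_pow, inv_eq_one_div, div_le_div_iff₀ hd (by positivity)]
  nlinarith

section Skew

variable {θ : ℝ}

/-- Absolute convergence of the double integral over the two edges, by domination with the double
layer kernel and its transpose. -/
theorem integrable_cross (hθ : θ ∈ Set.Ioo 0 Real.pi) (f g : LineL2) :
    Integrable (fun p : ℝ × ℝ => (Set.Ioi 0).indicator g p.1 *
      ((Set.Iio 0).indicator f p.2 * res (oppPole θ p.1) p.2)) (volume.prod volume) := by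
  have K := isSchurKernel_sideKer hθ (σ := -1) (by norm_num)
  have hfm : AEStronglyMeasurable (fun p : ℝ × ℝ => (Set.Iio 0).indicator f p.2)
      (volume.prod volume) :=
    ((Lp.aestronglyMeasurable f).indicator measurableSet_Iio).comp_quasiMeasurePreserving
      Measure.quasiMeasurePreserving_snd
  have hgm : AEStronglyMeasurable (fun p : ℝ × ℝ => (Set.Ioi 0).indicator g p.1)
      (volume.prod volume) :=
    ((Lp.aestronglyMeasurable g).indicator measurableSet_Ioi).comp_quasiMeasurePreserving
      Measure.quasiMeasurePreserving_fst
  have hrm : Measurable fun p : ℝ × ℝ => res (oppPole θ p.1) p.2 :=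
    ((Complex.measurable_ofReal.comp measurable_snd).sub
      ((measurable_oppPole θ).comp measurable_fst)).inv
  refine ⟨hgm.mul (hfm.mul hrm.aestronglyMeasurable), ?_⟩
  have m1 : Measurable fun p : ℝ × ℝ => ENNReal.ofReal (sideKer (-1) θ p.1 p.2) :=
    K.measurable.ennreal_ofReal
  have mf : AEMeasurable (fun p : ℝ × ℝ => ‖f p.2‖ₑ) (volume.prod volume) :=
    (Lp.aestronglyMeasurable f).enorm.comp_quasiMeasurePreserving
      Measure.quasiMeasurePreserving_snd
  have mg : AEMeasurable (fun p : ℝ × ℝ => ‖g p.1‖ₑ) (volume.prod volume) :=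
    (Lp.aestronglyMeasurable g).enorm.comp_quasiMeasurePreserving
      Measure.quasiMeasurePreserving_fst
  have m2 : Measurable fun p : ℝ × ℝ => ENNReal.ofReal (sideKer (-1) θ p.2 p.1) :=
    K.measurable.ennreal_ofReal.comp measurable_swap
  have n1 : AEMeasurable (fun p : ℝ × ℝ => ‖g p.1‖ₑ * (ENNReal.ofReal (sideKer (-1) θ p.1 p.2) *
      ‖f p.2‖ₑ)) (volume.prod volume) := mg.mul (m1.aemeasurable.mul mf)
  have n2 : AEMeasurable (fun p : ℝ × ℝ => ‖f p.2‖ₑ * (ENNReal.ofReal (sideKer (-1) θ p.2 p.1) *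
      ‖g p.1‖ₑ)) (volume.prod volume) := mf.mul (m2.aemeasurable.mul mg)
  have b1 : ∫⁻ p : ℝ × ℝ, ‖g p.1‖ₑ * (ENNReal.ofReal (sideKer (-1) θ p.1 p.2) * ‖f p.2‖ₑ)
      ∂(volume.prod volume) < ⊤ := by
    rw [lintegral_prod _ n1]
    refine lt_of_eq_of_lt (lintegral_congr fun t => ?_) (K.lintegral_bilin_lt_top f g)
    exact lintegral_const_mul' ‖g t‖ₑ (fun s => ENNReal.ofReal (sideKer (-1) θ t s) * ‖f s‖ₑ)
      enorm_ne_top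
  have b2 : ∫⁻ p : ℝ × ℝ, ‖f p.2‖ₑ * (ENNReal.ofReal (sideKer (-1) θ p.2 p.1) * ‖g p.1‖ₑ)
      ∂(volume.prod volume) < ⊤ := by
    rw [lintegral_prod_symm _ n2]
    refine lt_of_eq_of_lt (lintegral_congr fun t => ?_) (K.lintegral_bilin_lt_top g f)
    exact lintegral_const_mul' ‖f t‖ₑ (fun s => ENNReal.ofReal (sideKer (-1) θ t s) * ‖g s‖ₑ)
      enorm_ne_top
  have hb := ENNReal.mul_lt_top (ENNReal.ofReal_lt_top (r := Real.pi / Real.sin θ))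
    (ENNReal.add_lt_top.2 ⟨b1, b2⟩)
  rw [← lintegral_add_left' n1,
    ← lintegral_const_mul' _ _ ENNReal.ofReal_ne_top] at hb
  refine lt_of_le_of_lt (lintegral_mono fun p => ?_) hb
  obtain ⟨t, s⟩ := p
  dsimp only
  by_cases ht : 0 < t
  · by_cases hs : s < 0
    · rw [Set.indicator_of_mem (by exact ht), Set.indicator_of_mem (by exact hs), enorm_mul,
        enorm_mul]
      have h := norm_res_oppPole_le hθ (mul_neg_of_neg_of_pos hs ht)
      have h' : ‖res (oppPole θ t) s‖ₑ ≤ ENNReal.ofReal (Real.pi / Real.sin θ) *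
          (ENNReal.ofReal (sideKer (-1) θ t s) + ENNReal.ofReal (sideKer (-1) θ s t)) := by
        rw [← ofReal_norm, ← ENNReal.ofReal_add (K.nonneg _ _) (K.nonneg _ _),
          ← ENNReal.ofReal_mul (div_pos Real.pi_pos (sin_pos_of_mem hθ)).le]
        exact ENNReal.ofReal_le_ofReal h
      calc ‖g t‖ₑ * (‖f s‖ₑ * ‖res (oppPole θ t) s‖ₑ) ≤ ‖g t‖ₑ * (‖f s‖ₑ *
          (ENNReal.ofReal (Real.pi / Real.sin θ) *
          (ENNReal.ofReal (sideKer (-1) θ t s) + ENNReal.ofReal (sideKer (-1) θ s t)))) := by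
            gcongr
        _ = _ := by ring
    · rw [Set.indicator_of_notMem (s := Set.Iio 0) (by exact hs)]
      simp
  · rw [Set.indicator_of_notMem (s := Set.Ioi 0) (by exact ht)]
    simp

/-- The contributions of the two opposite edges to the Cauchy operator are transposes of each
other for the pairing `∫ f g dz`. -/
theorem integral_cross (hθ : θ ∈ Set.Ioo 0 Real.pi) (f g : LineL2) :
    ∫ t, cutPos ((2 : ℂ) • poissonOp hθ (lineProj (cutNeg f))) t * g t =
      Complex.exp (θ * Complex.I) *
        ∫ s, f s * cutNeg ((2 : ℂ) • poissonOp hθ (lineProj (cutPos g))) s := by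
  have cut : ∀ (A B : Set ℝ) (hA : MeasurableSet A) (hB : MeasurableSet B) (u : LineL2),
      ∀ᵐ t, cutoff A hA ((2 : ℂ) • poissonOp hθ (lineProj (cutoff B hB u))) t =
        A.indicator (fun t => (Real.pi * Complex.I)⁻¹ *
          ∫ s, B.indicator u s * res (oppPole θ t) s) t := fun A B hA hB u => by
    filter_upwards [coeFn_flatCauchy_aux hθ A hA 0 (cutoff B hB u),
      coeFn_cutoff A hA ((2 : ℂ) • poissonOp hθ (lineProj (cutoff B hB u))),
      Lp.coeFn_zero ℂ 2 (volume : Measure ℝ)] with t h1 h2 h3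
    by_cases ht : t ∈ A
    · rw [zero_add] at h1
      rw [h1 ht, Set.indicator_of_mem ht, h3, Pi.zero_apply, zero_add]
      congr 1
      refine integral_congr_ae ?_
      filter_upwards [coeFn_cutoff B hB u] with s hs
      rw [hs]
    · rw [h2, Set.indicator_of_notMem ht, Set.indicator_of_notMem ht]
  have e1 : ∫ t, cutPos ((2 : ℂ) • poissonOp hθ (lineProj (cutNeg f))) t * g t =
      (Real.pi * Complex.I)⁻¹ * ∫ t, ∫ s, (Set.Ioi 0).indicator g t *
      ((Set.Iio 0).indicator f s * res (oppPole θ t) s) := by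
    rw [← integral_const_mul]
    refine integral_congr_ae ?_
    filter_upwards [cut (Set.Ioi 0) (Set.Iio 0) measurableSet_Ioi measurableSet_Iio f] with t ht
    rw [ht, integral_const_mul]
    by_cases h : t ∈ Set.Ioi (0 : ℝ)
    · rw [Set.indicator_of_mem h, Set.indicator_of_mem h]
      ring
    · rw [Set.indicator_of_notMem h, Set.indicator_of_notMem h]
      ring
  have e2 : ∫ s, f s * cutNeg ((2 : ℂ) • poissonOp hθ (lineProj (cutPos g))) s =
      (Real.pi * Complex.I)⁻¹ * ∫ s, ∫ t, (Set.Iio 0).indicator f s *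
      ((Set.Ioi 0).indicator g t * res (oppPole θ s) t) := by
    rw [← integral_const_mul]
    refine integral_congr_ae ?_
    filter_upwards [cut (Set.Iio 0) (Set.Ioi 0) measurableSet_Iio measurableSet_Ioi g] with s hs
    rw [hs, integral_const_mul]
    by_cases h : s ∈ Set.Iio (0 : ℝ)
    · rw [Set.indicator_of_mem h, Set.indicator_of_mem h]
      ring
    · rw [Set.indicator_of_notMem h, Set.indicator_of_notMem h]
      ring
  rw [e1, e2, integral_integral_swap (integrable_cross hθ f g), mul_left_comm]
  congr 1
  rw [← integral_const_mul]
  congr 1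
  ext s
  rw [← integral_const_mul]
  congr 1
  ext t
  by_cases hs : s ∈ Set.Iio (0 : ℝ)
  · by_cases ht : t ∈ Set.Ioi (0 : ℝ)
    · -- The two kernels agree up to the ratio of the tangents of the edges.
      have ht' : 0 < t := ht
      have hs' : s < 0 := hs
      have e3 : res (oppPole θ t) s = Complex.exp (θ * Complex.I) * res (oppPole θ s) t := by
        have n1 := ofReal_sub_ne_zero (oppPole_im_pos hθ ht'.ne').ne' s
        have n2 := ofReal_sub_ne_zero (oppPole_im_pos hθ hs'.ne).ne' t
        have hexp := exp_neg_mul_exp θ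
        rw [res, res, inv_eq_iff_eq_inv, mul_inv, inv_inv, ← Complex.exp_neg,
          oppPole_of_pos θ ht', oppPole_of_neg θ hs']
        linear_combination (-(s : ℂ)) * hexp
      rw [e3]
      ring
    · rw [Set.indicator_of_notMem ht]
      ring
  · rw [Set.indicator_of_notMem hs]
    ring

/-- The bilinear pairing `∫ f g dz` over the boundary of the cone, in the arc length parameter. -/
noncomputable def flatPairing (θ : ℝ) (f g : LineL2) : ℂ :=
  (∫ s, cutPos f s * g s) - Complex.exp (θ * Complex.I) * ∫ s, cutNeg f s * g s

/-- The Cauchy operator is skew for the pairing `∫ f g dz`. -/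
theorem flatPairing_flatCauchy (hθ : θ ∈ Set.Ioo 0 Real.pi) (f g : LineL2) :
    flatPairing θ (flatCauchy hθ f) g = -flatPairing θ f (flatCauchy hθ g) := by
  have hp : ∀ u : LineL2, cutPos (flatCauchy hθ u) = cutPos (lineHilbert (cutPos u)) +
      cutPos ((2 : ℂ) • poissonOp hθ (lineProj (cutNeg u))) := fun u => by
    rw [flatCauchy_apply, map_add, cutoff_cutoff_self,
      cutoff_cutoff_of_disjoint _ _ disjoint_Ioi_Iio, add_zero, map_add]
  have hn : ∀ u : LineL2, cutNeg (flatCauchy hθ u) = cutNeg (lineHilbert (cutNeg u)) +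
      cutNeg ((2 : ℂ) • poissonOp hθ (lineProj (cutPos u))) := fun u => by
    rw [flatCauchy_apply, map_add, cutoff_cutoff_self,
      cutoff_cutoff_of_disjoint _ _ disjoint_Ioi_Iio.symm, zero_add, map_add]
  have hH : ∀ (A : Set ℝ) (hA : MeasurableSet A) (u v : LineL2),
      ∫ s, cutoff A hA (lineHilbert (cutoff A hA u)) s * v s =
      -∫ s, u s * cutoff A hA (lineHilbert (cutoff A hA v)) s := fun A hA u v => by
    rw [integral_cutoff_mul_comm, integral_lineHilbert_mul, integral_cutoff_mul_comm]
  have hr : ∀ (u v w : LineL2), ∫ s, u s * (v + w : LineL2) s =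
      (∫ s, u s * v s) + ∫ s, u s * w s := fun u v w => by
    rw [integral_mul_comm, integral_add_mul, integral_mul_comm v, integral_mul_comm w]
  have c1 := integral_cross hθ f g
  have c2 := integral_cross hθ g f
  rw [integral_mul_comm _ f, integral_mul_comm g] at c2
  rw [flatPairing, flatPairing, integral_cutoff_mul_comm _ _ f, integral_cutoff_mul_comm _ _ f,
    hp, hn, hp, hn, integral_add_mul, integral_add_mul, hr, hr, hH, hH]
  linear_combination c1 + c2

end Skew

/-! ### Cauchy kernels integrated over half-lines -/

theorem ofReal_sub_mem_slitPlane {p : ℂ} (hp : p.im ≠ 0) (s : ℝ) :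
    (s : ℂ) - p ∈ Complex.slitPlane :=
  Or.inr (by simpa using hp)

theorem tendsto_log_sub_log {p : ℂ} :
    Tendsto (fun s : ℝ => Complex.log ((s : ℂ) - p) - Real.log s) atTop (𝓝 0) := by
  have h1 : Tendsto (fun s : ℝ => 1 - p * ((s : ℂ))⁻¹) atTop (𝓝 1) := by
    have h := (((tendsto_res_atTop 0).const_mul p).const_sub 1)
    rw [mul_zero, sub_zero] at h
    refine h.congr fun s => ?_
    simp [res]
  have h2 := h1.clog (by simp)
  rw [Complex.log_one] at h2
  refine h2.congr' ?_
  filter_upwards [eventually_gt_atTop 0, h1.eventually_ne one_ne_zero] with s hs hne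
  have hs' : (s : ℂ) ≠ 0 := by exact_mod_cast hs.ne'
  have e : (s : ℂ) - p = s * (1 - p * ((s : ℂ))⁻¹) := by field_simp
  rw [e, Complex.log_ofReal_mul hs hne]
  ring

/-- The difference quotient of the logarithm. -/
noncomputable def logQuot (c z : ℂ) : ℂ := (Complex.log z - Complex.log c) / (z - c)

/-- The Cauchy integral of a Cauchy kernel over a half-line. -/
theorem integral_Ioi_res_mul_res {p z : ℂ} (hp : p.im ≠ 0) (hz : z.im ≠ 0) (hpz : p ≠ z) :
    ∫ s in Set.Ioi (0 : ℝ), res p s * res z s = logQuot (-p) (-z) := by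
  have hint : IntegrableOn (fun s : ℝ => res p s * res z s) (Set.Ioi 0) :=
    ((memLp_res hp).integrable_mul (memLp_res hz)).integrableOn
  have hd : ∀ s : ℝ, HasDerivAt (fun s : ℝ => (p - z)⁻¹ *
      (Complex.log ((s : ℂ) - p) - Complex.log ((s : ℂ) - z))) (res p s * res z s) s := fun s => by
    have h1 := (hasDerivAt_ofReal_sub p s).clog_real (ofReal_sub_mem_slitPlane hp s)
    have h2 := (hasDerivAt_ofReal_sub z s).clog_real (ofReal_sub_mem_slitPlane hz s)
    refine ((h1.sub h2).const_mul (p - z)⁻¹).congr_deriv ?_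
    have e1 := ofReal_sub_ne_zero hp s
    have e2 := ofReal_sub_ne_zero hz s
    have e3 := sub_ne_zero.2 hpz
    simp only [res]
    field_simp
    ring
  have hl : Tendsto (fun s : ℝ => (p - z)⁻¹ *
      (Complex.log ((s : ℂ) - p) - Complex.log ((s : ℂ) - z))) atTop (𝓝 0) := by
    have h := ((tendsto_log_sub_log (p := p)).sub (tendsto_log_sub_log (p := z))).const_mul
      (p - z)⁻¹
    rw [sub_zero, mul_zero] at h
    refine h.congr fun s => ?_
    ring
  rw [integral_Ioi_of_hasDerivAt_of_tendsto (hd 0).continuousAt.continuousWithinAt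
    (fun s _ => hd s) hint hl, logQuot, Complex.ofReal_zero, zero_sub, zero_sub, zero_sub,
    ← mul_neg, neg_sub, div_eq_inv_mul, neg_sub_neg]

theorem integral_Iio_res_mul_res {p z : ℂ} (hp : p.im ≠ 0) (hz : z.im ≠ 0) (hpz : p ≠ z) :
    ∫ s in Set.Iio (0 : ℝ), res p s * res z s = logQuot p z := by
  have h := integral_Ioi_res_mul_res (p := -p) (z := -z) (by simpa using hp) (by simpa using hz)
    (by simpa using hpz)
  rw [neg_neg, neg_neg] at h
  have h2 := integral_comp_neg_Ioi (0 : ℝ) fun s => res p s * res z s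
  rw [neg_zero, integral_Iic_eq_integral_Iio] at h2
  rw [← h2, ← h]
  congr 1
  ext s
  have e : ∀ w : ℂ, res w (-s) = -res (-w) s := fun w => by
    rw [res, res, ← inv_neg]
    push_cast
    congr 1
    ring
  rw [e, e, neg_mul_neg]

/-- The two boundary values of the difference quotient on the cut of the logarithm have a mean
without the jump `± π i`. -/
theorem tendsto_logQuot_sum {x : ℝ} (hx : x < 0) {c : ℂ} (hc : c.im ≠ 0) :
    Tendsto (fun ε : ℝ => logQuot c (x + ε * Complex.I) + logQuot c (x - ε * Complex.I)) (𝓝[>] 0)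
      (𝓝 (2 * (Real.log |x| - Complex.log c) / (x - c))) := by
  have hxc : (x : ℂ) - c ≠ 0 := ofReal_sub_ne_zero hc x
  have hxs : ((-x : ℝ) : ℂ) ∈ Complex.slitPlane := Complex.ofReal_mem_slitPlane.2 (by linarith)
  have l1 : ∀ σ : ℂ, Tendsto (fun ε : ℝ => (x : ℂ) + σ * (ε * Complex.I)) (𝓝[>] 0) (𝓝 (x : ℂ)) :=
    fun σ => by
    have : Continuous fun ε : ℝ => (x : ℂ) + σ * (ε * Complex.I) := by fun_prop
    have h := this.tendsto 0
    simp only [Complex.ofReal_zero, zero_mul, mul_zero, add_zero] at h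
    exact h.mono_left nhdsWithin_le_nhds
  have l2 : ∀ σ : ℂ, Tendsto (fun ε : ℝ => Complex.log (-((x : ℂ) + σ * (ε * Complex.I))))
      (𝓝[>] 0) (𝓝 (Real.log |x|)) := fun σ => by
    have h := (l1 σ).neg
    rw [← Complex.ofReal_neg] at h
    have h2 := h.clog hxs
    rwa [← Complex.ofReal_log (by linarith), ← abs_of_neg hx] at h2
  have q : ∀ (σ k : ℂ), (∀ ε : ℝ, 0 < ε → Complex.log ((x : ℂ) + σ * (ε * Complex.I)) =
      Complex.log (-((x : ℂ) + σ * (ε * Complex.I))) + k) →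
      Tendsto (fun ε : ℝ => logQuot c (x + σ * (ε * Complex.I))) (𝓝[>] 0)
        (𝓝 ((Real.log |x| + k - Complex.log c) / (x - c))) := fun σ k hk => by
    refine ((((l2 σ).add_const k).sub_const (Complex.log c)).div ((l1 σ).sub_const c) hxc).congr' ?_
    filter_upwards [self_mem_nhdsWithin] with ε (hε : 0 < ε)
    simp only [Pi.div_apply]
    rw [logQuot, hk ε hε]
  have logneg : ∀ z : ℂ, 0 < z.im → Complex.log (-z) = Complex.log z - Real.pi * Complex.I :=
    fun z hz => by
    rw [Complex.log, Complex.log, norm_neg, Complex.arg_neg_eq_arg_sub_pi_of_im_pos hz]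
    push_cast
    ring
  -- The logarithms at `x ± iε` differ from those of the opposite points by `± π i`.
  have q1 := q 1 (Real.pi * Complex.I) fun ε hε => by
    rw [logneg _ (by simpa using hε)]
    ring
  have q2 := q (-1) (-(Real.pi * Complex.I)) fun ε hε => by
    have := logneg (-((x : ℂ) + -1 * (ε * Complex.I))) (by simpa using hε)
    rw [neg_neg] at this
    rw [this]
    ring
  have h := q1.add q2
  have e : (Real.log |x| + Real.pi * Complex.I - Complex.log c) / (x - c) +
      (Real.log |x| + -(Real.pi * Complex.I) - Complex.log c) / (x - c) =
      2 * (Real.log |x| - Complex.log c) / (x - c) := by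
    rw [← add_div]
    congr 1
    ring
  rw [e] at h
  refine h.congr fun ε => ?_
  rw [one_mul, neg_one_mul, ← sub_eq_add_neg]

theorem integral_cutoff_resL2_mul_res (A : Set ℝ) (hA : MeasurableSet A) {p : ℂ} (hp : p.im ≠ 0)
    (z : ℂ) : ∫ s, cutoff A hA (resL2 p) s * res z s = ∫ s in A, res p s * res z s := by
  rw [integral_cutoff_mul]
  refine setIntegral_congr_ae hA ?_
  filter_upwards [coeFn_resL2 hp] with s hs _
  rw [hs]

theorem eventually_add_ne {p : ℂ} (hp : p.im ≠ 0) (t : ℝ) (σ : ℝ) :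
    ∀ᶠ ε : ℝ in 𝓝[>] 0, p ≠ t + σ * (ε * Complex.I) := by
  have h : Tendsto (fun ε : ℝ => (t : ℂ) + σ * (ε * Complex.I)) (𝓝[>] 0) (𝓝 (t : ℂ)) := by
    have : Continuous fun ε : ℝ => (t : ℂ) + σ * (ε * Complex.I) := by fun_prop
    have h := this.tendsto 0
    simp only [Complex.ofReal_zero, zero_mul, mul_zero, add_zero] at h
    exact h.mono_left nhdsWithin_le_nhds
  exact (h.eventually_ne fun h => hp (by rw [← h]; simp)).mono fun _ h => h.symm

/-- The Hilbert transform of a Cauchy kernel cut off to a half-line, on that half-line. -/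
theorem lineHilbert_cutPos_resL2 {a : ℂ} (ha : a.im ≠ 0) :
    ∀ᵐ t : ℝ, 0 < t → Real.pi * Complex.I * lineHilbert (cutPos (resL2 a)) t =
      (Real.log |t| - Complex.log (-a)) / (a - t) := by
  filter_upwards [ae_tendsto_lineHilbert (cutPos (resL2 a))] with t h ht
  have h2 := tendsto_logQuot_sum (x := -t) (by linarith) (c := -a) (by simpa using ha)
  have h3 : Tendsto (fun ε : ℝ => (∫ s, cutPos (resL2 a) s * res (t + ε * Complex.I) s) +
      ∫ s, cutPos (resL2 a) s * res (t - ε * Complex.I) s) (𝓝[>] 0)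
      (𝓝 (2 * (Real.log |-t| - Complex.log (-a)) / ((-t : ℝ) - (-a)))) := by
    refine h2.congr' ?_
    filter_upwards [self_mem_nhdsWithin, eventually_add_ne ha t 1, eventually_add_ne ha t (-1)]
      with ε (hε : 0 < ε) n1 n2
    simp only [Complex.ofReal_one, one_mul, Complex.ofReal_neg, neg_one_mul,
      ← sub_eq_add_neg] at n1 n2
    rw [integral_cutoff_resL2_mul_res _ _ ha, integral_cutoff_resL2_mul_res _ _ ha,
      integral_Ioi_res_mul_res ha (by simp [hε.ne']) n1,
      integral_Ioi_res_mul_res ha (by simp [hε.ne']) n2, add_comm]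
    congr 2 <;> push_cast <;> ring
  have e := tendsto_nhds_unique h h3
  have e2 : (2 : ℂ) * (Real.pi * Complex.I * lineHilbert (cutPos (resL2 a)) t) =
      2 * ((Real.log |t| - Complex.log (-a)) / (a - t)) := by
    rw [← mul_assoc, ← mul_assoc, e, abs_neg]
    push_cast
    rw [sub_neg_eq_add, neg_add_eq_sub, mul_div_assoc]
  exact mul_left_cancel₀ two_ne_zero e2

theorem lineHilbert_cutNeg_resL2 {b : ℂ} (hb : b.im ≠ 0) :
    ∀ᵐ t : ℝ, t < 0 → Real.pi * Complex.I * lineHilbert (cutNeg (resL2 b)) t =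
      (Real.log |t| - Complex.log b) / (t - b) := by
  filter_upwards [ae_tendsto_lineHilbert (cutNeg (resL2 b))] with t h ht
  have h2 := tendsto_logQuot_sum ht hb
  have h3 : Tendsto (fun ε : ℝ => (∫ s, cutNeg (resL2 b) s * res (t + ε * Complex.I) s) +
      ∫ s, cutNeg (resL2 b) s * res (t - ε * Complex.I) s) (𝓝[>] 0)
      (𝓝 (2 * (Real.log |t| - Complex.log b) / (t - b))) := by
    refine h2.congr' ?_
    filter_upwards [self_mem_nhdsWithin, eventually_add_ne hb t 1, eventually_add_ne hb t (-1)]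
      with ε (hε : 0 < ε) n1 n2
    simp only [Complex.ofReal_one, one_mul, Complex.ofReal_neg, neg_one_mul,
      ← sub_eq_add_neg] at n1 n2
    rw [integral_cutoff_resL2_mul_res _ _ hb, integral_cutoff_resL2_mul_res _ _ hb,
      integral_Iio_res_mul_res hb (by simp [hε.ne']) n1,
      integral_Iio_res_mul_res hb (by simp [hε.ne']) n2]
  have e := tendsto_nhds_unique h h3
  have e2 : (2 : ℂ) * (Real.pi * Complex.I * lineHilbert (cutNeg (resL2 b)) t) =
      2 * ((Real.log |t| - Complex.log b) / (t - b)) := by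
    rw [← mul_assoc, ← mul_assoc, e]
    ring
  exact mul_left_cancel₀ two_ne_zero e2

/-! ### Eigenfunctions of the Cauchy operator -/

theorem cutoff_smul (A : Set ℝ) (hA : MeasurableSet A) (c : ℂ) (f : LineL2) :
    cutoff A hA (c • f) = c • cutoff A hA f := map_smul _ _ _

/-- The restriction of `z ↦ (z - a)⁻¹` to the boundary of the cone, in the arc length
parameter. -/
noncomputable def coneRes (θ : ℝ) (a : ℂ) : LineL2 :=
  cutPos (resL2 a) +
    (-Complex.exp (-(θ * Complex.I))) • cutNeg (resL2 (-(a * Complex.exp (-(θ * Complex.I)))))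

section Eigen

variable {θ : ℝ}

theorem cutPos_coneRes (θ : ℝ) (a : ℂ) : cutPos (coneRes θ a) = cutPos (resL2 a) := by
  rw [coneRes, map_add, cutoff_cutoff_self, cutoff_smul,
    cutoff_cutoff_of_disjoint _ _ disjoint_Ioi_Iio, smul_zero, add_zero]

theorem cutNeg_coneRes (θ : ℝ) (a : ℂ) : cutNeg (coneRes θ a) =
    (-Complex.exp (-(θ * Complex.I))) •
      cutNeg (resL2 (-(a * Complex.exp (-(θ * Complex.I))))) := by
  rw [coneRes, map_add, cutoff_smul, cutoff_cutoff_self,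
    cutoff_cutoff_of_disjoint _ _ disjoint_Ioi_Iio.symm, zero_add]

/-- The pairing with the kernel `(z - a)⁻¹` is the Cauchy integral at `a`. -/
theorem flatPairing_coneRes (θ : ℝ) (h : LineL2) (a : ℂ) : flatPairing θ h (coneRes θ a) =
    (∫ s, cutPos h s * resL2 a s) +
      ∫ s, cutNeg h s * resL2 (-(a * Complex.exp (-(θ * Complex.I)))) s := by
  rw [flatPairing, integral_cutoff_mul_comm, integral_cutoff_mul_comm, cutPos_coneRes,
    cutNeg_coneRes, integral_mul_comm _ (_ • _), integral_smul_mul, ← integral_cutoff_mul_comm,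
    integral_mul_comm _ h, ← integral_cutoff_mul_comm, ← mul_assoc, mul_neg,
    mul_comm (Complex.exp _), exp_neg_mul_exp, neg_one_mul, sub_neg_eq_add]

/-- The eigenvalue of the Cauchy operator on `z ↦ (z - a)⁻¹`: it is `1` if `a` lies outside the
cone and `-1` if it lies inside. -/
noncomputable def coneSign (θ : ℝ) (a : ℂ) : ℂ :=
  (Real.pi * Complex.I)⁻¹ * (Complex.log (-a) -
    Complex.log (-(a * Complex.exp (-(θ * Complex.I)))) + (Real.pi - θ) * Complex.I)

theorem coneSign_sq (hθ : θ ∈ Set.Ioo 0 Real.pi) {a : ℂ} (ha : a.im ≠ 0)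
    (hb : (-(a * Complex.exp (-(θ * Complex.I)))).im ≠ 0) : coneSign θ a * coneSign θ a = 1 := by
  set b := -(a * Complex.exp (-(θ * Complex.I))) with hbdef
  have ha0 : -a ≠ 0 := fun h => ha (by rw [neg_eq_zero.1 h]; rfl)
  have hb0 : b ≠ 0 := fun h => hb (by rw [h]; rfl)
  let w : ℂ := Complex.log (-a) - Complex.log b - θ * Complex.I
  have hw : Complex.exp w = 1 := by
    rw [Complex.exp_sub, Complex.exp_sub, Complex.exp_log ha0, Complex.exp_log hb0,
      div_div, div_eq_one_iff_eq (mul_ne_zero hb0 (Complex.exp_ne_zero _)), hbdef, neg_mul,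
      mul_assoc, exp_neg_mul_exp, mul_one]
  obtain ⟨n, hn⟩ := Complex.exp_eq_one_iff.1 hw
  have him : (-a).arg - b.arg - θ = n * (2 * Real.pi) := by
    have := congrArg Complex.im hn
    simpa [w, Complex.log_im] using this
  have hpi := Real.pi_pos
  have h1 := Complex.arg_le_pi (-a)
  have h2 := Complex.neg_pi_lt_arg (-a)
  have h3 := Complex.arg_le_pi b
  have h4 := Complex.neg_pi_lt_arg b
  have n1 : n < 1 := by
    by_contra hc
    have : (1 : ℝ) ≤ n := by exact_mod_cast not_lt.1 hc
    nlinarith [hθ.1]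
  have n2 : -2 < n := by
    by_contra hc
    have : (n : ℝ) ≤ -2 := by exact_mod_cast not_lt.1 hc
    nlinarith [hθ.2]
  have hpi' : (Real.pi : ℂ) ≠ 0 := by exact_mod_cast hpi.ne'
  have e : coneSign θ a = 2 * n + 1 := by
    have : Complex.log (-a) - Complex.log b + (Real.pi - θ) * Complex.I =
        w + Real.pi * Complex.I := by
      simp only [w]
      ring
    rw [coneSign, ← hbdef, this, hn]
    field_simp [Complex.I_ne_zero]
  rw [e]
  obtain rfl | rfl : n = 0 ∨ n = -1 := by omega
  · simp
  · push_cast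
    ring

theorem log_ofReal_mul_exp {r : ℝ} (hr : 0 < r) {α : ℝ} (h1 : -Real.pi < α) (h2 : α ≤ Real.pi) :
    Complex.log (r * Complex.exp (α * Complex.I)) = Real.log r + α * Complex.I := by
  rw [Complex.log_ofReal_mul hr (Complex.exp_ne_zero _), Complex.log_exp (by simpa using h1)
    (by simpa using h2)]

/-- The functions `z ↦ (z - a)⁻¹` are eigenfunctions of the Cauchy operator of the cone. -/
theorem flatCauchy_coneRes (hθ : θ ∈ Set.Ioo 0 Real.pi) {a : ℂ} (ha : a.im ≠ 0)
    (hb : (-(a * Complex.exp (-(θ * Complex.I)))).im ≠ 0) :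
    flatCauchy hθ (coneRes θ a) = coneSign θ a • coneRes θ a := by
  have hexp := exp_neg_mul_exp θ
  have hpi' : (Real.pi : ℂ) * Complex.I ≠ 0 :=
    mul_ne_zero (by exact_mod_cast Real.pi_ne_zero) Complex.I_ne_zero
  apply Lp.ext
  filter_upwards [coeFn_flatCauchy_of_pos hθ (coneRes θ a),
    coeFn_flatCauchy_of_neg hθ (coneRes θ a), Lp.coeFn_smul (coneSign θ a) (coneRes θ a),
    lineHilbert_cutPos_resL2 ha, lineHilbert_cutNeg_resL2 hb, coeFn_resL2 ha, coeFn_resL2 hb,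
    Lp.coeFn_add (cutPos (resL2 a)) ((-Complex.exp (-(θ * Complex.I))) •
      cutNeg (resL2 (-(a * Complex.exp (-(θ * Complex.I)))))),
    coeFn_cutoff (Set.Ioi 0) measurableSet_Ioi (resL2 a),
    coeFn_cutoff (Set.Iio 0) measurableSet_Iio
      (resL2 (-(a * Complex.exp (-(θ * Complex.I))))),
    Lp.coeFn_smul (-Complex.exp (-(θ * Complex.I)))
      (cutNeg (resL2 (-(a * Complex.exp (-(θ * Complex.I)))))),
    Lp.coeFn_smul (-Complex.exp (-(θ * Complex.I)))
      (lineHilbert (cutNeg (resL2 (-(a * Complex.exp (-(θ * Complex.I))))))), ae_ne_zero]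
    with t p n h1 Hp Hn ra rb radd cp cn cs hs ht
  have hr : coneRes θ a t = (cutPos (resL2 a) + (-Complex.exp (-(θ * Complex.I))) •
      cutNeg (resL2 (-(a * Complex.exp (-(θ * Complex.I))))) : LineL2) t := rfl
  have him := oppPole_im_pos hθ ht
  set b := -(a * Complex.exp (-(θ * Complex.I))) with hbdef
  have hba : b * Complex.exp (θ * Complex.I) = -a := by
    rw [hbdef, neg_mul, mul_assoc, hexp, mul_one]
  rw [h1, Pi.smul_apply, smul_eq_mul, hr, radd, Pi.add_apply, cs, Pi.smul_apply, cp, cn]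
  rcases ht.lt_or_gt with h | h
  · have hat : (0:ℝ) < |t| := abs_pos.2 h.ne
    have hneg : -oppPole θ t = |t| * Complex.exp (((θ - Real.pi : ℝ) : ℂ) * Complex.I) := by
      rw [oppPole_of_neg θ h, neg_neg, abs_of_neg h]
      push_cast
      rw [sub_mul, Complex.exp_sub, Complex.exp_pi_mul_I]
      ring
    have hlog : Complex.log (-oppPole θ t) = Real.log |t| + (θ - Real.pi) * Complex.I := by
      rw [hneg, log_ofReal_mul_exp hat (by linarith [hθ.1]) (by linarith [hθ.2, Real.pi_pos])]
      push_cast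
      ring
    have hne : a ≠ oppPole θ t := by
      intro hc
      apply hb
      rw [hbdef, hc, oppPole_of_neg θ h, neg_mul, neg_neg, mul_assoc, mul_comm (Complex.exp _),
        hexp, mul_one]
      simp
    rw [n h, cutNeg_coneRes, map_smul, hs, Pi.smul_apply, smul_eq_mul, cutPos_coneRes,
      integral_cutoff_resL2_mul_res _ _ ha, integral_Ioi_res_mul_res ha him.ne' hne, logQuot, hlog,
      Set.indicator_of_notMem (by simpa using h.le), Set.indicator_of_mem (by exact h), rb, res,
      coneSign, ← hbdef]
    have hH : lineHilbert (cutNeg (resL2 b)) t = (Real.pi * Complex.I)⁻¹ *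
        ((Real.log |t| - Complex.log b) / (t - b)) := by
      rw [← Hn h, inv_mul_cancel_left₀ hpi']
    have htb := ofReal_sub_ne_zero hb t
    have hq : -oppPole θ t - -a = Complex.exp (θ * Complex.I) * (t - b) := by
      rw [oppPole_of_neg θ h]
      linear_combination hba
    have hdiv (x : ℂ) : x / (Complex.exp (θ * Complex.I) * (t - b)) =
        Complex.exp (-(θ * Complex.I)) * (x * (t - b)⁻¹) := by
      rw [Complex.exp_neg]
      field_simp
    rw [hH, hq, hdiv]
    ring
  · have hat : (0:ℝ) < |t| := abs_pos.2 h.ne'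
    have hexpo : oppPole θ t = |t| * Complex.exp (((Real.pi - θ : ℝ) : ℂ) * Complex.I) := by
      rw [oppPole_of_pos θ h, abs_of_pos h]
      push_cast
      rw [sub_mul, Complex.exp_sub, Complex.exp_pi_mul_I, Complex.exp_neg]
      ring
    have hlog : Complex.log (oppPole θ t) = Real.log |t| + (Real.pi - θ) * Complex.I := by
      rw [hexpo, log_ofReal_mul_exp hat (by linarith [hθ.2, Real.pi_pos]) (by linarith [hθ.1])]
      push_cast
      ring
    have hne : b ≠ oppPole θ t := by
      intro hc
      apply ha
      rw [hc, oppPole_of_pos θ h, neg_mul, mul_assoc, hexp, mul_one] at hba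
      rw [← neg_inj.1 hba]
      simp
    rw [p h, cutPos_coneRes, cutNeg_coneRes, integral_smul_mul,
      integral_cutoff_resL2_mul_res _ _ hb, integral_Iio_res_mul_res hb him.ne' hne, logQuot, hlog,
      Set.indicator_of_mem (by exact h), Set.indicator_of_notMem (by simpa using h.le), ra, res,
      coneSign, ← hbdef]
    have hH : lineHilbert (cutPos (resL2 a)) t = (Real.pi * Complex.I)⁻¹ *
        ((Real.log |t| - Complex.log (-a)) / (a - t)) := by
      rw [← Hp h, inv_mul_cancel_left₀ hpi']
    have hta := ofReal_sub_ne_zero ha t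
    have hta' : a - t ≠ 0 := by rwa [← neg_sub, neg_ne_zero]
    have hq : oppPole θ t - b = Complex.exp (-(θ * Complex.I)) * (a - t) := by
      rw [oppPole_of_pos θ h, hbdef]
      ring
    have hdiv (x : ℂ) : -Complex.exp (-(θ * Complex.I)) *
        (x / (Complex.exp (-(θ * Complex.I)) * (a - t))) = x * (t - a)⁻¹ := by
      have := Complex.exp_ne_zero (-(θ * Complex.I))
      rw [← neg_sub a, inv_neg]
      field_simp
    have hdiv2 (x : ℂ) : x / (a - t) = - (x * (t - a)⁻¹) := by
      rw [← neg_sub a, inv_neg]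
      field_simp
    rw [hH, hq, hdiv, hdiv2]
    ring

end Eigen

/-! ### The Cauchy operator is an involution -/

theorem norm_res_le_two_mul {z w : ℂ} (hw : w.im ≠ 0) (h : ‖z - w‖ ≤ |w.im| / 2) (s : ℝ) :
    ‖res z s‖ ≤ 2 * ‖res w s‖ := by
  have h1 : |w.im| ≤ ‖(s : ℂ) - w‖ := by
    have := Complex.abs_im_le_norm ((s : ℂ) - w)
    simpa using this
  have h2 : ‖(s : ℂ) - w‖ ≤ ‖(s : ℂ) - z‖ + ‖z - w‖ := by
    have := norm_add_le ((s : ℂ) - z) (z - w)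
    simpa using this
  have h0 : 0 < |w.im| := abs_pos.2 hw
  rw [res, res, norm_inv, norm_inv, ← div_eq_mul_inv, inv_le_comm₀ (by linarith) (by
    apply div_pos two_pos; linarith), inv_div]
  linarith

/-- Cauchy integrals are continuous off the line. -/
theorem continuousAt_integral_mul_res (f : LineL2) {w : ℂ} (hw : w.im ≠ 0) :
    ContinuousAt (fun z => ∫ s, f s * res z s) w := by
  have h0 : 0 < |w.im| / 2 := half_pos (abs_pos.2 hw)
  refine continuousAt_of_dominated (bound := fun s => 2 * ‖f s * res w s‖) ?_ ?_ ?_ ?_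
  · filter_upwards with z
    exact (LineL2.memLp f).aestronglyMeasurable.mul (measurable_res z).aestronglyMeasurable
  · filter_upwards [Metric.closedBall_mem_nhds w h0] with z hz
    filter_upwards with s
    rw [mem_closedBall_iff_norm] at hz
    rw [norm_mul, norm_mul, mul_left_comm]
    exact mul_le_mul_of_nonneg_left (norm_res_le_two_mul hw hz s) (norm_nonneg _)
  · exact (LineL2.integrable_mul_res f hw).norm.const_mul 2
  · filter_upwards with s
    have := ofReal_sub_ne_zero hw s
    unfold res
    fun_prop (disch := assumption)

/-- If two Cauchy integrals cancel after a change of variables `m`, then the first density vanishes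
wherever `m` maps the line to a point at which the second integral is continuous. -/
theorem ae_eq_zero_of_cauchy_cancel (f g : LineL2) {m : ℂ → ℂ} (hm : Continuous m)
    (h : ∀ z : ℂ, z.im ≠ 0 → (m z).im ≠ 0 →
      (∫ s, f s * res z s) + ∫ s, g s * res (m z) s = 0) :
    ∀ᵐ t : ℝ, (m t).im ≠ 0 → f t = 0 := by
  filter_upwards [ae_tendsto_jump f] with t ht hmt
  have hlim (σ : ℂ) : Tendsto (fun ε : ℝ => (t : ℂ) + σ * (ε * Complex.I)) (𝓝[>] 0) (𝓝 t) := by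
    have : Continuous fun ε : ℝ => (t : ℂ) + σ * (ε * Complex.I) := by fun_prop
    have h0 := this.tendsto 0
    simp only [Complex.ofReal_zero, zero_mul, mul_zero, add_zero] at h0
    exact h0.mono_left nhdsWithin_le_nhds
  have hm' (σ : ℂ) := (hm.tendsto (t : ℂ)).comp (hlim σ)
  have hg (σ : ℂ) := (continuousAt_integral_mul_res g hmt).tendsto.comp (hm' σ)
  have hne (σ : ℂ) : ∀ᶠ ε : ℝ in 𝓝[>] 0, (m ((t : ℂ) + σ * (ε * Complex.I))).im ≠ 0 :=
    ((Complex.continuous_im.tendsto _).comp (hm' σ)).eventually (isOpen_ne.mem_nhds hmt)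
  have h0 : Tendsto (fun ε : ℝ => ∫ s, f s *
      (res (t + ε * Complex.I) s - res (t - ε * Complex.I) s)) (𝓝[>] 0) (𝓝 0) := by
    have := (hg (-1)).sub (hg 1)
    rw [sub_self] at this
    refine this.congr' ?_
    filter_upwards [self_mem_nhdsWithin, hne 1, hne (-1)] with ε (hε : 0 < ε) e1 e2
    have k1 := h (t + 1 * (ε * Complex.I)) (by simp [hε.ne']) e1
    have k2 := h (t + -1 * (ε * Complex.I)) (by simp [hε.ne']) e2
    simp_rw [mul_sub]
    rw [integral_sub (LineL2.integrable_mul_res f (by simp [hε.ne']))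
      (LineL2.integrable_mul_res f (by simp [hε.ne']))]
    simp only [Function.comp_def]
    rw [one_mul] at k1
    rw [neg_one_mul, ← sub_eq_add_neg] at k2
    rw [one_mul, neg_one_mul, ← sub_eq_add_neg]
    linear_combination k2 - k1
  have := tendsto_nhds_unique ht h0
  simpa [Real.pi_ne_zero] using this

section Involution

variable {θ : ℝ}

/-- The functions `z ↦ (z - a)⁻¹` separate: only `0` pairs trivially with all of them. -/
theorem eq_zero_of_flatPairing_coneRes (hθ : θ ∈ Set.Ioo 0 Real.pi) (h : LineL2)
    (hh : ∀ a : ℂ, a.im ≠ 0 → (-(a * Complex.exp (-(θ * Complex.I)))).im ≠ 0 →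
      flatPairing θ h (coneRes θ a) = 0) : h = 0 := by
  have hh (a : ℂ) (ha : a.im ≠ 0) (hb : (-(a * Complex.exp (-(θ * Complex.I)))).im ≠ 0) :
      (∫ s, cutPos h s * res a s) +
        ∫ s, cutNeg h s * res (-(a * Complex.exp (-(θ * Complex.I)))) s = 0 := by
    rw [← hh a ha hb, flatPairing_coneRes]
    congr 1 <;> apply integral_congr_ae
    · filter_upwards [coeFn_resL2 ha] with s hs
      rw [hs]
    · filter_upwards [coeFn_resL2 hb] with s hs
      rw [hs]
  have hexp := exp_neg_mul_exp θ
  have hsin := sin_pos_of_mem hθ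
  rw [Lp.eq_zero_iff_ae_eq_zero]
  have h1 := ae_eq_zero_of_cauchy_cancel (cutPos h) (cutNeg h)
    (m := fun a => -(a * Complex.exp (-(θ * Complex.I)))) (by fun_prop) hh
  have h2 := ae_eq_zero_of_cauchy_cancel (cutNeg h) (cutPos h)
    (m := fun b => -(b * Complex.exp (θ * Complex.I))) (by fun_prop) fun z hz hmz => by
      have e : -(-(z * Complex.exp (θ * Complex.I)) * Complex.exp (-(θ * Complex.I))) = z := by
        rw [neg_mul, neg_neg, mul_assoc, mul_comm (Complex.exp _), hexp, mul_one]
      have := hh (-(z * Complex.exp (θ * Complex.I))) hmz (by rwa [e])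
      rwa [e, add_comm] at this
  filter_upwards [h1, h2, coeFn_cutoff (Set.Ioi 0) measurableSet_Ioi h,
    coeFn_cutoff (Set.Iio 0) measurableSet_Iio h, ae_ne_zero] with t h1 h2 c1 c2 ht
  rcases ht.lt_or_gt with h0 | h0
  · rw [c2, Set.indicator_of_mem (by exact h0)] at h2
    refine h2 ?_
    simp only [Complex.neg_im, Complex.im_ofReal_mul, Complex.exp_ofReal_mul_I_im]
    exact neg_ne_zero.2 (mul_ne_zero ht hsin.ne')
  · rw [c1, Set.indicator_of_mem (by exact h0)] at h1
    refine h1 ?_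
    rw [← neg_mul (θ : ℂ), ← Complex.ofReal_neg]
    simp only [Complex.neg_im, Complex.im_ofReal_mul, Complex.exp_ofReal_mul_I_im, Real.sin_neg]
    exact neg_ne_zero.2 (mul_ne_zero ht (neg_ne_zero.2 hsin.ne'))

theorem flatPairing_sub_left (f g h : LineL2) :
    flatPairing θ (f - g) h = flatPairing θ f h - flatPairing θ g h := by
  have key (u v : LineL2) : ∫ s, (u - v : LineL2) s * h s = (∫ s, u s * h s) - ∫ s, v s * h s := by
    have := integral_add_mul (u - v) v h
    rw [sub_add_cancel] at this
    rw [this, add_sub_cancel_right]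
  rw [flatPairing, map_sub, map_sub, key, key, flatPairing, flatPairing]
  ring

theorem flatPairing_smul_right (c : ℂ) (f g : LineL2) :
    flatPairing θ f (c • g) = c * flatPairing θ f g := by
  have key (u : LineL2) : ∫ s, u s * (c • g : LineL2) s = c * ∫ s, u s * g s := by
    rw [integral_mul_comm, integral_smul_mul, integral_mul_comm]
  rw [flatPairing, key, key, flatPairing]
  ring

/-- The Cauchy operator of the cone is an involution: by skew symmetry it suffices that
its square fixes the functions `z ↦ (z - a)⁻¹`. -/
theorem flatCauchy_flatCauchy (hθ : θ ∈ Set.Ioo 0 Real.pi) (f : LineL2) :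
    flatCauchy hθ (flatCauchy hθ f) = f := by
  rw [← sub_eq_zero]
  refine eq_zero_of_flatPairing_coneRes hθ _ fun a ha hb => ?_
  rw [flatPairing_sub_left, flatPairing_flatCauchy, flatPairing_flatCauchy, neg_neg,
    flatCauchy_coneRes hθ ha hb, map_smul, flatCauchy_coneRes hθ ha hb, smul_smul,
    coneSign_sq hθ ha hb, one_smul, sub_self]

end Involution

/-! ### The Rellich estimate -/

theorem norm_lineConj (f : LineL2) : ‖lineConj f‖ = ‖f‖ := by
  apply le_antisymm
  · refine Lp.norm_le_norm_of_ae_le ?_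
    filter_upwards [coeFn_lineConj f] with s hs
    rw [hs, Complex.norm_conj]
  · refine Lp.norm_le_norm_of_ae_le ?_
    filter_upwards [coeFn_lineConj f] with s hs
    rw [hs, Complex.norm_conj]

theorem lineConj_smul (c : ℂ) (f : LineL2) :
    lineConj (c • f) = (starRingEnd ℂ) c • lineConj f := by
  apply Lp.ext
  filter_upwards [coeFn_lineConj (c • f), coeFn_lineConj f, Lp.coeFn_smul c f,
    Lp.coeFn_smul ((starRingEnd ℂ) c) (lineConj f)] with s h1 h2 h3 h4
  rw [h1, h3, h4, Pi.smul_apply, Pi.smul_apply, h2, smul_eq_mul, smul_eq_mul, map_mul]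

section RealFunctions

variable {u v : LineL2}

theorem norm_integral_cutoff_mul_le (A : Set ℝ) (hA : MeasurableSet A) (f g : LineL2) :
    ‖∫ s, cutoff A hA f s * g s‖ ≤ ‖f‖ * ‖g‖ := by
  rw [integral_mul_eq_inner_lineConj]
  refine (norm_inner_le_norm _ _).trans ?_
  rw [norm_lineConj, mul_comm]
  exact mul_le_mul_of_nonneg_right (norm_cutoff_le A hA f) (norm_nonneg _)

theorem im_integral_cutoff_mul (A : Set ℝ) (hA : MeasurableSet A) (hu : lineConj u = u)
    (hv : lineConj v = v) : (∫ s, cutoff A hA u s * v s).im = 0 := by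
  rw [← Complex.conj_eq_iff_im]
  nth_rewrite 1 [integral_mul_eq_inner_lineConj]
  rw [inner_conj_symm, integral_mul_comm, integral_mul_eq_inner_lineConj, lineConj_cutoff, hu, hv]

theorem integral_cutPos_add_cutNeg_self (hu : lineConj u = u) :
    (∫ s, cutPos u s * u s) + ∫ s, cutNeg u s * u s = (‖u‖ ^ 2 : ℝ) := by
  rw [← integral_add_mul, cutPos_add_cutNeg, integral_mul_eq_inner_lineConj, hu,
    inner_self_eq_norm_sq_to_K]
  push_cast
  rfl

end RealFunctions

section Rellich

variable {θ : ℝ} {u v : LineL2}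

/-- The Rellich identity.  If the square of `F = u + i v` has vanishing integral against `dz` along
the boundary of the cone, multiply by `exp (-iθ/2)` and take imaginary parts: the tangent has
imaginary part `- sin (θ/2)` on both edges. -/
theorem rellich_identity (hu : lineConj u = u) (hv : lineConj v = v)
    (h : flatPairing θ (u + Complex.I • v) (u + Complex.I • v) = 0) :
    Real.sin (θ / 2) * (‖u‖ ^ 2 - ‖v‖ ^ 2) = 2 * Real.cos (θ / 2) *
      ((∫ s, cutPos u s * v s).re - (∫ s, cutNeg u s * v s).re) := by
  have key (A : Set ℝ) (hA : MeasurableSet A) :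
      ∫ s, cutoff A hA (u + Complex.I • v) s * (u + Complex.I • v : LineL2) s =
        (∫ s, cutoff A hA u s * u s) - (∫ s, cutoff A hA v s * v s) +
          2 * Complex.I * ∫ s, cutoff A hA u s * v s := by
    have e (f : LineL2) : ∫ s, f s * (u + Complex.I • v : LineL2) s =
        (∫ s, f s * u s) + Complex.I * ∫ s, f s * v s := by
      rw [integral_mul_comm, integral_add_mul, integral_smul_mul, integral_mul_comm u,
        integral_mul_comm v]
    have e2 : ∫ s, cutoff A hA v s * u s = ∫ s, cutoff A hA u s * v s := by
      rw [integral_cutoff_mul_comm, integral_mul_comm]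
    rw [map_add, map_smul, integral_add_mul, integral_smul_mul, e, e, e2]
    linear_combination (∫ s, cutoff A hA v s * v s) * Complex.I_mul_I
  have hp := im_integral_cutoff_mul (Set.Ioi 0) measurableSet_Ioi hu hv
  have hn := im_integral_cutoff_mul (Set.Iio 0) measurableSet_Iio hu hv
  have pu := im_integral_cutoff_mul (Set.Ioi 0) measurableSet_Ioi hu hu
  have nu := im_integral_cutoff_mul (Set.Iio 0) measurableSet_Iio hu hu
  have pv := im_integral_cutoff_mul (Set.Ioi 0) measurableSet_Ioi hv hv
  have nv := im_integral_cutoff_mul (Set.Iio 0) measurableSet_Iio hv hv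
  have su := congrArg Complex.re (integral_cutPos_add_cutNeg_self hu)
  have sv := congrArg Complex.re (integral_cutPos_add_cutNeg_self hv)
  rw [Complex.add_re, Complex.ofReal_re] at su sv
  have h1 : Complex.exp (((-(θ / 2) : ℝ) : ℂ) * Complex.I) *
      flatPairing θ (u + Complex.I • v) (u + Complex.I • v) = 0 := by rw [h, mul_zero]
  have hexp : Complex.exp (((-(θ / 2) : ℝ) : ℂ) * Complex.I) * Complex.exp (θ * Complex.I) =
      Complex.exp (((θ / 2 : ℝ) : ℂ) * Complex.I) := by
    rw [← Complex.exp_add]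
    congr 1
    push_cast
    ring
  rw [flatPairing, key, key, mul_sub, ← mul_assoc, hexp] at h1
  have h2 := congrArg Complex.im h1
  simp only [Complex.sub_im, Complex.mul_im, Complex.add_im, Complex.add_re, Complex.mul_re,
    Complex.sub_re, Complex.exp_ofReal_mul_I_re, Complex.exp_ofReal_mul_I_im, hp, hn, pu, nu, pv,
    nv, Complex.I_re, Complex.I_im, Complex.re_ofNat, Complex.im_ofNat, Complex.zero_im,
    Real.cos_neg, Real.sin_neg] at h2
  rw [← su, ← sv]
  linear_combination -h2

/-- The Rellich estimate: the real and the imaginary part of an eigenfunction of the Cauchy operator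
control each other, with a constant of order `1 / θ`. -/
theorem sin_mul_abs_le (hu : lineConj u = u) (hv : lineConj v = v)
    (h : flatPairing θ (u + Complex.I • v) (u + Complex.I • v) = 0) :
    |Real.sin (θ / 2) * (‖u‖ ^ 2 - ‖v‖ ^ 2)| ≤ 4 * (‖u‖ * ‖v‖) := by
  have hc : |Real.cos (θ / 2)| ≤ 1 := Real.abs_cos_le_one _
  have hp := (Complex.abs_re_le_norm _).trans
    (norm_integral_cutoff_mul_le (Set.Ioi 0) measurableSet_Ioi u v)
  have hn := (Complex.abs_re_le_norm _).trans
    (norm_integral_cutoff_mul_le (Set.Iio 0) measurableSet_Iio u v)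
  rw [rellich_identity hu hv h, abs_mul, abs_mul, abs_two]
  have := (abs_sub _ _).trans (add_le_add hp hn)
  calc 2 * |Real.cos (θ / 2)| * _ ≤ 2 * 1 * (‖u‖ * ‖v‖ + ‖u‖ * ‖v‖) := by gcongr
    _ = _ := by ring

theorem mul_add_le_of_abs_le {s x y : ℝ} (hs : 0 < s) (hs1 : s ≤ 1) (hx : 0 ≤ x) (hy : 0 ≤ y)
    (h : |s * (x ^ 2 - y ^ 2)| ≤ 4 * (x * y)) : s * (x + y) ≤ 6 * x := by
  have h1 := (abs_le.1 h).1
  rcases le_total y x with hxy | hxy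
  · nlinarith
  · have : s * y ≤ 5 * x := by
      rcases hy.eq_or_lt with rfl | hy
      · simpa using hx
      · refine le_of_mul_le_mul_right ?_ hy
        nlinarith [mul_le_mul_of_nonneg_left hxy hx, mul_nonneg hx hx]
    nlinarith

theorem sin_mul_norm_le_of_flatPairing_eq_zero (hθ : θ ∈ Set.Ioo 0 Real.pi) {F : LineL2}
    (h : flatPairing θ F F = 0) : Real.sin (θ / 2) * ‖F‖ ≤ 3 * ‖F + lineConj F‖ ∧
      Real.sin (θ / 2) * ‖F‖ ≤ 3 * ‖F - lineConj F‖ := by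
  set u : LineL2 := (1 / 2 : ℂ) • (F + lineConj F) with hu
  set v : LineL2 := (-Complex.I / 2) • (F - lineConj F) with hv
  have hF : u + Complex.I • v = F := by
    have : Complex.I * (-Complex.I / 2) = 1 / 2 := by linear_combination -Complex.I_mul_I / 2
    rw [hu, hv, smul_smul, this, ← smul_add, add_add_sub_cancel, ← two_smul ℂ, smul_smul]
    norm_num
  have cu : lineConj u = u := by
    rw [hu, lineConj_smul, map_add, lineConj_lineConj, add_comm]
    simp [Complex.conj_ofNat]
  have cv : lineConj v = v := by
    rw [hv, lineConj_smul, map_sub, lineConj_lineConj, ← neg_sub F, smul_neg, ← neg_smul]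
    simp [neg_div, Complex.conj_ofNat]
  have nu : ‖u‖ = ‖F + lineConj F‖ / 2 := by
    rw [hu, norm_smul]
    norm_num
    ring
  have nv : ‖v‖ = ‖F - lineConj F‖ / 2 := by
    rw [hv, norm_smul]
    norm_num
    ring
  have key := sin_mul_abs_le cu cv (by rwa [hF])
  have hle : ‖F‖ ≤ ‖u‖ + ‖v‖ := by
    rw [← hF]
    refine (norm_add_le _ _).trans_eq ?_
    rw [norm_smul Complex.I, Complex.norm_I, one_mul]
  have hs := sin_half_pos hθ
  have hs1 := Real.sin_le_one (θ / 2)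
  have key' := key
  rw [← abs_neg, ← mul_neg, neg_sub, mul_comm ‖u‖] at key'
  have k1 := mul_add_le_of_abs_le hs hs1 (norm_nonneg u) (norm_nonneg v) key
  have k2 := mul_add_le_of_abs_le hs hs1 (norm_nonneg v) (norm_nonneg u) key'
  have := mul_le_mul_of_nonneg_left hle hs.le
  constructor <;> linarith

/-- On either eigenspace of the Cauchy operator the pairing vanishes, by skew symmetry. -/
theorem flatPairing_self_eq_zero (hθ : θ ∈ Set.Ioo 0 Real.pi) {F : LineL2} {c : ℂ} (hc : c ≠ 0)
    (hF : flatCauchy hθ F = c • F) : flatPairing θ F F = 0 := by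
  have h := flatPairing_flatCauchy hθ F F
  have hl : flatPairing θ (c • F) F = c * flatPairing θ F F := by
    rw [flatPairing, map_smul, map_smul, integral_smul_mul, integral_smul_mul, flatPairing]
    ring
  rw [hF, hl, flatPairing_smul_right, self_eq_neg] at h
  exact (mul_eq_zero.1 h).resolve_left hc

end Rellich

/-! ### Test functions for the double layer potential -/

theorem integral_ite_pos_comp_abs {ε : ℝ} (hε : ε ≠ 0) (G : ℝ → ℝ) :
    ∫ s, (if 0 < ε * s then G |s| else 0) = ∫ s in Set.Ioi 0, G s := by
  rcases hε.lt_or_gt with h | h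
  · have := integral_comp_neg_Iic (0 : ℝ) G
    rw [neg_zero, integral_Iic_eq_integral_Iio] at this
    rw [← this, ← integral_indicator measurableSet_Iio]
    refine integral_congr_ae (Eventually.of_forall fun s => ?_)
    rcases le_or_gt 0 s with hs | hs
    · simp [hs, mul_nonpos_of_nonpos_of_nonneg h.le hs, not_lt.2]
    · simp [hs, mul_pos_of_neg_of_neg h hs, abs_of_neg hs]
  · rw [← integral_indicator measurableSet_Ioi]
    refine integral_congr_ae (Eventually.of_forall fun s => ?_)
    rcases le_or_gt s 0 with hs | hs
    · simp [hs, mul_nonpos_of_nonneg_of_nonpos h.le hs, not_lt.2]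
    · simp [hs, mul_pos h hs, abs_of_pos hs]

/-- The function `|s|⁻¹` on the two intervals `a ≤ |s| ≤ b`. -/
noncomputable def invShell (a b s : ℝ) : ℝ := (Set.Icc a b).indicator (fun x => x⁻¹) |s|

theorem integral_invShell {a b : ℝ} (ha : 0 < a) (hab : a ≤ b) :
    ∫ s, invShell a b s = 2 * Real.log (b / a) := by
  have h := integral_comp_abs (f := (Set.Icc a b).indicator fun x => x⁻¹)
  unfold invShell
  rw [h, setIntegral_indicator measurableSet_Icc, Set.inter_eq_right.2
    fun x hx => Set.mem_Ioi.2 (ha.trans_le hx.1), integral_Icc_eq_integral_Ioc,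
    ← intervalIntegral.integral_of_le hab, integral_inv_of_pos ha (ha.trans_le hab)]

theorem integrable_invShell {a b : ℝ} (ha : 0 < a) (hab : a < b) : Integrable (invShell a b) := by
  refine Integrable.of_integral_ne_zero ?_
  rw [integral_invShell ha hab.le]
  exact (mul_pos two_pos (Real.log_pos ((one_lt_div ha).2 hab))).ne'

/-- The odd function `sgn s |s|^(-1/2)`, cut off to `1 ≤ |s| ≤ R`.  Without the cut-off it would be
an eigenfunction of the double layer potential. -/
noncomputable def oddTest (R s : ℝ) : ℝ :=
  SignType.sign s * (Set.Icc 1 R).indicator (fun x => (√x)⁻¹) |s|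

theorem oddTest_sq (R : ℝ) {s : ℝ} (hs : s ≠ 0) : oddTest R s ^ 2 = invShell 1 R s := by
  have : ((SignType.sign s : SignType) : ℝ) ^ 2 = 1 := by
    rcases hs.lt_or_gt with h | h <;> simp [h]
  rw [oddTest, invShell, mul_pow, this, one_mul]
  by_cases h : |s| ∈ Set.Icc 1 R
  · rw [Set.indicator_of_mem h, Set.indicator_of_mem h, inv_pow, Real.sq_sqrt (abs_nonneg s)]
  · rw [Set.indicator_of_notMem h, Set.indicator_of_notMem h]
    norm_num

theorem measurable_oddTest (R : ℝ) : Measurable (oddTest R) := by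
  unfold oddTest
  refine Measurable.mul ?_ (Measurable.comp (g := (Set.Icc 1 R).indicator fun x => (√x)⁻¹) ?_
    measurable_norm)
  · have : (fun s : ℝ => ((SignType.sign s : SignType) : ℝ)) =
        fun s => if 0 < s then 1 else if s < 0 then -1 else 0 := by
      funext s
      rcases lt_trichotomy s 0 with h | h | h
      · simp [h, h.not_gt]
      · simp [h]
      · simp [h]
    rw [this]
    exact Measurable.ite measurableSet_Ioi measurable_const
      (Measurable.ite measurableSet_Iio measurable_const measurable_const)
  · exact (Measurable.inv (by fun_prop)).indicator measurableSet_Icc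

theorem memLp_oddTest {R : ℝ} (hR : 1 < R) : MemLp (fun s => (oddTest R s : ℂ)) 2 volume := by
  refine MemLp.ofReal (f := oddTest R) ?_
  rw [memLp_two_iff_integrable_sq (measurable_oddTest R).aestronglyMeasurable]
  refine (integrable_invShell one_pos hR).congr ?_
  filter_upwards [ae_ne_zero] with s hs
  rw [oddTest_sq R hs]

section TestFunctions

variable {θ : ℝ}

theorem monotone_rayPrim_one (hθ : θ ∈ Set.Ioo 0 Real.pi) {x y : ℝ} (h : x ≤ y) :
    rayPrim 1 θ x ≤ rayPrim 1 θ y := by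
  refine monotone_of_hasDerivAt_nonneg (hasDerivAt_rayPrim hθ 1) (fun u => ?_) h
  have h1 := (sin_pos_of_mem hθ).le
  have h2 := (rayKer_denom_pos hθ one_ne_zero (u ^ 2)).le
  have e : (u ^ 2) ^ 2 - 2 * u ^ 2 * 1 * Real.cos θ + 1 ^ 2 =
      u ^ 4 - 2 * u ^ 2 * Real.cos θ + 1 := by ring
  rw [e] at h2
  exact div_nonneg (mul_nonneg (div_nonneg h1 Real.pi_pos.le) (by norm_num)) h2

/-- The double layer potential of `oddTest`, computed with the primitive of the kernel. -/
theorem integral_sideKer_oddTest (hθ : θ ∈ Set.Ioo 0 Real.pi) {R : ℝ} (hR : 1 < R) {t : ℝ}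
    (ht : t ≠ 0) : ∫ s, sideKer (-1) θ t s * oddTest R s = -SignType.sign t *
      ((√|t|)⁻¹ * (rayPrim 1 θ √(R / |t|) - rayPrim 1 θ √(1 / |t|))) := by
  have hta := abs_pos.2 ht
  have e (s : ℝ) : sideKer (-1) θ t s * oddTest R s = -SignType.sign t * (if 0 < (-t) * s then
      (Set.Icc 1 R).indicator (fun x => rayKer θ |t| x * (√x)⁻¹) |s| else 0) := by
    rw [sideKer, show -1 * (s * t) = -t * s by ring]
    split_ifs with h
    · have hs : ((SignType.sign s : SignType) : ℝ) = -SignType.sign t := by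
        rcases ht.lt_or_gt with h0 | h0
        · have : 0 < s := pos_of_mul_pos_right h (by linarith)
          simp [h0, this]
        · have : s < 0 := by
            by_contra hc
            nlinarith [not_lt.1 hc]
          simp [h0, this]
      rw [oddTest, hs, Set.indicator_mul_right]
      ring
    · simp
  simp_rw [e]
  rw [integral_const_mul, integral_ite_pos_comp_abs (neg_ne_zero.2 ht),
    setIntegral_indicator measurableSet_Icc, Set.inter_eq_right.2
    fun x hx => Set.mem_Ioi.2 (one_pos.trans_le hx.1), integral_Icc_eq_integral_Ioc,
    ← intervalIntegral.integral_of_le hR.le]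
  congr 1
  have hpos : ∀ x ∈ Set.uIcc 1 R, 0 < x := fun x hx => by
    rw [Set.uIcc_of_le hR.le] at hx
    exact one_pos.trans_le hx.1
  rw [intervalIntegral.integral_eq_sub_of_hasDerivAt
    (fun x hx => hasDerivAt_rayPrim_row hθ hta (hpos x hx)), mul_sub]
  refine ContinuousOn.intervalIntegrable fun x hx => ContinuousAt.continuousWithinAt ?_
  have h1 := rayKer_denom_pos hθ hta.ne' x
  have h2 := (Real.sqrt_pos.2 (hpos x hx)).ne'
  have h3 := (mul_pos Real.pi_pos h1).ne'
  unfold rayKer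
  fun_prop (disch := assumption)

/-- The primitive of the kernel climbs almost all of its height between `M⁻¹` and `M`. -/
theorem exists_shell (hθ : θ ∈ Set.Ioo 0 Real.pi) {η : ℝ} (hη : 0 < η) :
    ∃ M : ℝ, 1 ≤ M ∧ Real.cos (θ / 2) - η ≤ rayPrim 1 θ M - rayPrim 1 θ M⁻¹ := by
  have h0 : Tendsto (fun M => rayPrim 1 θ M - rayPrim 1 θ M⁻¹) atTop
      (𝓝 (Real.cos (θ / 2) - 0)) := by
    refine (tendsto_rayPrim hθ 1).sub ?_
    have := (hasDerivAt_rayPrim hθ 1 0).continuousAt.tendsto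
    rw [rayPrim_zero] at this
    exact this.comp tendsto_inv_atTop_zero
  rw [sub_zero] at h0
  obtain ⟨M, h1, h2⟩ := ((h0.eventually (lt_mem_nhds (sub_lt_self _ hη))).and
    (eventually_ge_atTop 1)).exists
  exact ⟨M, h2, h1.le⟩

/-- Approximate eigenfunctions of the double layer potential near the bottom `- cos (θ/2)` of its
numerical range. -/
theorem exists_inner_flatDoubleLayer_le (hθ : θ ∈ Set.Ioo 0 Real.pi) {η : ℝ} (hη : 0 < η)
    (hη1 : η ≤ 1) : ∃ f : LineL2, f ≠ 0 ∧ lineConj f = f ∧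
      (inner ℂ f (flatDoubleLayer hθ f)).re ≤ -(Real.cos (θ / 2) - 2 * η) * ‖f‖ ^ 2 := by
  obtain ⟨M, hM1, hM⟩ := exists_shell hθ hη
  have hM0 : 0 < M := by linarith
  have hlM : 0 ≤ Real.log M := Real.log_nonneg hM1
  -- The interval is so long that its parts near the ends, where the cut-off is felt, do not count.
  set L : ℝ := 4 * Real.log M / η + 1 with hL
  have hL4 : 4 * Real.log M ≤ η * L := by
    rw [hL, mul_add, mul_div_cancel₀ _ hη.ne']
    linarith
  have hL5 : 4 * Real.log M < L := by
    have : 4 * Real.log M ≤ 4 * Real.log M / η := le_div_self (by linarith) hη hη1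
    linarith
  set R : ℝ := Real.exp L with hRdef
  have hR : 1 < R := Real.one_lt_exp_iff.2 (by linarith)
  have hMR : M ^ 2 < R / M ^ 2 := by
    rw [lt_div_iff₀ (by positivity), ← Real.log_lt_log_iff (by positivity) (by positivity),
      hRdef, Real.log_exp, ← pow_add, Real.log_pow]
    push_cast
    linarith
  have hM2 : 1 ≤ M ^ 2 := one_le_pow₀ hM1
  have hmem := memLp_oddTest hR
  set f : LineL2 := hmem.toLp _ with hfdef
  have hf : ∀ᵐ s, f s = oddTest R s := hmem.coeFn_toLp
  have hnorm : ‖f‖ ^ 2 = 2 * L := by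
    have h := integral_invShell one_pos hR.le
    rw [div_one, hRdef, Real.log_exp] at h
    rw [← hRdef] at h
    have e := inner_self_eq_norm_sq_to_K (𝕜 := ℂ) f
    rw [L2.inner_def] at e
    have e2 : ∫ s, inner ℂ (f s) (f s) = ((∫ s, invShell 1 R s : ℝ) : ℂ) := by
      rw [← integral_complex_ofReal]
      refine integral_congr_ae ?_
      filter_upwards [hf, ae_ne_zero] with s hs h0
      rw [hs, ← oddTest_sq R h0, RCLike.inner_apply, Complex.conj_ofReal]
      push_cast
      ring
    rw [e2, h] at e
    exact (Complex.ofReal_injective (by rw [e]; push_cast; rfl)).symm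
  have hL0 : 0 < L := by linarith
  refine ⟨f, fun h => ?_, ?_, ?_⟩
  · rw [h, norm_zero] at hnorm
    linarith
  · apply Lp.ext
    filter_upwards [coeFn_lineConj f, hf] with s h1 h2
    rw [h1, h2, Complex.conj_ofReal]
  have hinner : ∀ᵐ t, (inner ℂ (f t) (flatDoubleLayer hθ f t)).re =
      -(invShell 1 R t * (rayPrim 1 θ √(R / |t|) - rayPrim 1 θ √(1 / |t|))) := by
    filter_upwards [hf, coeFn_flatDoubleLayer hθ f, ae_ne_zero] with t h1 h2 h0
    have e : ∫ s, (sideKer (-1) θ t s : ℂ) * f s =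
        ((∫ s, sideKer (-1) θ t s * oddTest R s : ℝ) : ℂ) := by
      rw [← integral_complex_ofReal]
      refine integral_congr_ae ?_
      filter_upwards [hf] with s hs
      rw [hs]
      push_cast
      rfl
    rw [h2, e, h1, integral_sideKer_oddTest hθ hR h0, RCLike.inner_apply, Complex.conj_ofReal,
      ← Complex.ofReal_mul, Complex.ofReal_re, ← oddTest_sq R h0]
    have hs : oddTest R t * (SignType.sign t * (√|t|)⁻¹) = oddTest R t ^ 2 := by
      rw [sq, oddTest]
      by_cases h : |t| ∈ Set.Icc 1 R
      · rw [Set.indicator_of_mem h]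
      · rw [Set.indicator_of_notMem h]
        simp
    rw [← hs]
    ring
  have hint := (L2.integrable_inner (𝕜 := ℂ) f (flatDoubleLayer hθ f)).re
  have hmono : ∫ t, (Real.cos (θ / 2) - η) * invShell (M ^ 2) (R / M ^ 2) t ≤
      ∫ t, -(inner ℂ (f t) (flatDoubleLayer hθ f t)).re := by
    refine integral_mono_ae ((integrable_invShell (by positivity) hMR).const_mul _) hint.neg ?_
    filter_upwards [hinner, ae_ne_zero] with t h1 h0
    have hta := abs_pos.2 h0
    rw [h1, neg_neg, mul_comm]
    by_cases h : |t| ∈ Set.Icc (M ^ 2) (R / M ^ 2)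
    · have hd : R / M ^ 2 ≤ R := div_le_self (by linarith) hM2
      rw [invShell, Set.indicator_of_mem h, invShell,
        Set.indicator_of_mem (show |t| ∈ Set.Icc 1 R from ⟨hM2.trans h.1, h.2.trans hd⟩)]
      refine mul_le_mul_of_nonneg_left (hM.trans (sub_le_sub ?_ ?_)) (by positivity)
      · refine monotone_rayPrim_one hθ (Real.le_sqrt_of_sq_le ?_)
        rw [le_div_iff₀ hta, mul_comm]
        exact (le_div_iff₀ (by positivity)).1 h.2
      · refine monotone_rayPrim_one hθ ((Real.sqrt_le_left (by positivity)).2 ?_)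
        rw [inv_pow, ← one_div]
        exact one_div_le_one_div_of_le (by positivity) h.1
    · rw [invShell, Set.indicator_of_notMem h, zero_mul]
      refine mul_nonneg (Set.indicator_nonneg (fun x hx => ?_) _) (sub_nonneg.2 ?_)
      · exact inv_nonneg.2 (zero_le_one.trans hx.1)
      · refine monotone_rayPrim_one hθ (Real.sqrt_le_sqrt ?_)
        exact div_le_div_of_nonneg_right hR.le hta.le
  have hre : (inner ℂ f (flatDoubleLayer hθ f)).re =
      ∫ t, (inner ℂ (f t) (flatDoubleLayer hθ f t)).re := by
    rw [L2.inner_def]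
    exact (integral_re (L2.integrable_inner (𝕜 := ℂ) f (flatDoubleLayer hθ f))).symm
  rw [integral_neg, ← hre, integral_const_mul, integral_invShell (by positivity) hMR.le,
    div_div, Real.log_div (by positivity) (by positivity), hRdef, Real.log_exp, ← pow_add,
    Real.log_pow] at hmono
  push_cast at hmono
  rw [hnorm]
  have hc := Real.cos_le_one (θ / 2)
  have hc0 := cos_half_pos hθ
  nlinarith [mul_le_mul_of_nonneg_right hc hlM, mul_nonneg hη.le hlM]

/-- The lower bound for the inverse of the double layer equation: `I + K` is almost as
small as `1 - cos (θ/2)` on some real function. -/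
theorem exists_norm_add_flatDoubleLayer_le (hθ : θ ∈ Set.Ioo 0 Real.pi) (hθ1 : θ ≤ 1) :
    ∃ f : LineL2, f ≠ 0 ∧ lineConj f = f ∧ ‖f + flatDoubleLayer hθ f‖ ≤ θ ^ 2 * ‖f‖ := by
  have h0 := hθ.1
  have h4 : θ ^ 4 ≤ 1 := pow_le_one₀ h0.le hθ1
  obtain ⟨f, hf, hc, hi⟩ := exists_inner_flatDoubleLayer_le hθ (η := θ ^ 4 / 16) (by positivity)
    (by linarith)
  refine ⟨f, hf, hc, ?_⟩
  have hK := norm_flatDoubleLayer_le hθ f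
  have hK2 := pow_le_pow_left₀ (norm_nonneg _) hK 2
  have hcos := Real.one_sub_sq_div_two_le_cos (x := θ / 2)
  have hcos1 := Real.cos_le_one (θ / 2)
  refine le_of_sq_le_sq ?_ (by positivity)
  have hn := norm_add_sq (𝕜 := ℂ) f (flatDoubleLayer hθ f)
  rw [hn]
  have hf2 : 0 ≤ ‖f‖ ^ 2 := sq_nonneg _
  have h1 : (1 - Real.cos (θ / 2)) ^ 2 ≤ (θ ^ 2 / 8) ^ 2 :=
    pow_le_pow_left₀ (by linarith) (by linarith) 2
  have h2 := mul_le_mul_of_nonneg_right h1 hf2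
  have hi' : RCLike.re (inner ℂ f (flatDoubleLayer hθ f)) ≤ _ := hi
  have h5 : 0 ≤ θ ^ 4 * ‖f‖ ^ 2 := by positivity
  nlinarith

/-- `I + K` does not shrink nonnegative functions, as `K` has a nonnegative kernel. -/
theorem exists_le_norm_add_flatDoubleLayer (hθ : θ ∈ Set.Ioo 0 Real.pi) :
    ∃ f : LineL2, f ≠ 0 ∧ lineConj f = f ∧ ‖f‖ ≤ ‖f + flatDoubleLayer hθ f‖ := by
  have hI : volume (Set.Icc (0 : ℝ) 1) ≠ ⊤ := by simp
  let f : LineL2 := indicatorConstLp 2 measurableSet_Icc hI 1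
  have hf : ∀ᵐ s, f s = ((Set.Icc (0 : ℝ) 1).indicator (fun _ => (1 : ℝ)) s : ℝ) := by
    filter_upwards [indicatorConstLp_coeFn (p := 2) (hs := measurableSet_Icc) (hμs := hI)
      (c := (1 : ℂ))] with s hs
    rw [hs]
    by_cases h : s ∈ Set.Icc (0 : ℝ) 1 <;> simp [h]
  refine ⟨f, fun h => ?_, ?_, ?_⟩
  · have := norm_indicatorConstLp (p := 2) (hs := measurableSet_Icc) (hμs := hI) (c := (1 : ℂ))
      two_ne_zero (by simp)
    rw [show indicatorConstLp 2 measurableSet_Icc hI (1 : ℂ) = 0 from h] at this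
    simp at this
  · apply Lp.ext
    filter_upwards [coeFn_lineConj f, hf] with s h1 h2
    rw [h1, h2, Complex.conj_ofReal]
  · refine Lp.norm_le_norm_of_ae_le ?_
    filter_upwards [hf, coeFn_flatDoubleLayer hθ f, Lp.coeFn_add f (flatDoubleLayer hθ f)]
      with t h1 h2 h3
    have e : ∫ s, (sideKer (-1) θ t s : ℂ) * f s =
        ((∫ s, sideKer (-1) θ t s * (Set.Icc (0 : ℝ) 1).indicator (fun _ => (1 : ℝ)) s : ℝ) : ℂ) := by
      rw [← integral_complex_ofReal]
      refine integral_congr_ae ?_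
      filter_upwards [hf] with s hs
      rw [hs]
      push_cast
      rfl
    have hk := (isSchurKernel_sideKer hθ (σ := -1) (by norm_num)).nonneg
    have h0 : 0 ≤ (Set.Icc (0 : ℝ) 1).indicator (fun _ => (1 : ℝ)) t :=
      Set.indicator_nonneg (fun _ _ => zero_le_one) _
    have h4 : 0 ≤ ∫ s, sideKer (-1) θ t s * (Set.Icc (0 : ℝ) 1).indicator (fun _ => (1 : ℝ)) s :=
      integral_nonneg fun s =>
        mul_nonneg (hk t s) (Set.indicator_nonneg (fun _ _ => zero_le_one) _)
    rw [h3, Pi.add_apply, h2, e, h1, ← Complex.ofReal_add, Complex.norm_real, Complex.norm_real,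
      Real.norm_of_nonneg h0, Real.norm_of_nonneg (add_nonneg h0 h4)]
    exact le_add_of_nonneg_right h4

end TestFunctions

/-! ### Pairs of reflections -/

section Inverse

variable {X Y : Type*} [NormedAddCommGroup X] [NormedSpace ℝ X] [NormedAddCommGroup Y]
  [NormedSpace ℝ Y] {T : X →L[ℝ] Y}

theorem norm_inverse_le (hT : T.IsInvertible) {M : ℝ} (hM : 0 ≤ M) (h : ∀ x, ‖x‖ ≤ M * ‖T x‖) :
    ‖T.inverse‖ ≤ M :=
  ContinuousLinearMap.opNorm_le_bound _ hM fun y => by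
    simpa only [hT.self_apply_inverse] using h (T.inverse y)

theorem le_mul_norm_inverse (hT : T.IsInvertible) {ε : ℝ} {x : X} (hx : x ≠ 0)
    (h : ‖T x‖ ≤ ε * ‖x‖) : 1 ≤ ε * ‖T.inverse‖ := by
  have h1 := T.inverse.le_opNorm (T x)
  rw [hT.inverse_apply_self] at h1
  have h2 := mul_le_mul_of_nonneg_left h (norm_nonneg T.inverse)
  have h3 := norm_pos_iff.2 hx
  refine le_of_mul_le_mul_right ?_ h3
  linarith

theorem one_le_opNorm {x : X} (hx : x ≠ 0) (h : ‖x‖ ≤ ‖T x‖) : 1 ≤ ‖T‖ :=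
  le_of_mul_le_mul_right ((one_mul ‖x‖).trans_le (h.trans (T.le_opNorm x))) (norm_pos_iff.2 hx)

theorem isInvertible_id_add [CompleteSpace X] {K : X →L[ℝ] X} (hK : ‖K‖ < 1) :
    (ContinuousLinearMap.id ℝ X + K).IsInvertible := by
  obtain ⟨u, hu⟩ := isUnit_one_sub_of_norm_lt_one (x := -K) (by rwa [norm_neg])
  rw [sub_neg_eq_add] at hu
  refine ContinuousLinearMap.IsInvertible.of_inverse (g := (u⁻¹ : (X →L[ℝ] X)ˣ).val) ?_ ?_
  · have := u.mul_inv
    rwa [hu] at this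
  · have := u.inv_mul
    rwa [hu] at this

end Inverse

section Reflections

variable {H : Type*} [NormedAddCommGroup H] [NormedSpace ℝ H] {E N : H →L[ℝ] H}

theorem plusProj_apply (R : H →L[ℝ] H) (f : H) : plusProj R f = (1 / 2 : ℝ) • (f + R f) := rfl

theorem plusProj_of_eq {R : H →L[ℝ] H} {f : H} (h : R f = f) : plusProj R f = f := by
  rw [plusProj_apply, h, ← two_smul ℝ, smul_smul]
  norm_num

theorem mem_plusSpace {R : H →L[ℝ] H} (hR : ∀ f, R (R f) = f) {f : H} :
    f ∈ plusSpace R ↔ R f = f := by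
  constructor
  · rintro ⟨g, rfl⟩
    change R (plusProj R g) = plusProj R g
    rw [plusProj_apply, map_smul, map_add, hR, add_comm]
  · exact fun h => ⟨f, plusProj_of_eq h⟩

theorem completeSpace_plusSpace [CompleteSpace H] {R : H →L[ℝ] H} (hR : ∀ f, R (R f) = f) :
    CompleteSpace (plusSpace R) := by
  have : (plusSpace R : Set H) = {f | R f = f} := Set.ext fun f => mem_plusSpace hR
  have hc : IsClosed (plusSpace R : Set H) := by
    rw [this]
    exact isClosed_eq R.continuous continuous_id
  exact hc.completeSpace_coe

theorem coe_plusRestrict (R S : H →L[ℝ] H) (f : plusSpace R) :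
    (plusRestrict R S f : H) = plusProj S f := rfl

/-- Two reflections `E` and `N` such that the angles between the relevant spectral subspaces are at
least of size `δ`, the compression of `E` to the range of `N⁺` is a strict contraction, and `I` plus
this compression shrinks some vector by the factor `ε` and does not shrink some other vector. -/
structure IsReflectionPair (E N : H →L[ℝ] H) (C δ ε : ℝ) : Prop where
  left_involutive : ∀ f, E (E f) = f
  right_involutive : ∀ f, N (N f) = f
  norm_left : ‖E‖ ≤ C
  norm_right : ‖N‖ ≤ 1
  delta_pos : 0 < δ
  delta_le : δ ≤ 1
  eps_pos : 0 < ε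
  contraction : ∃ c < 1, ∀ f, N f = f → ‖plusProj N (E f)‖ ≤ c * ‖f‖
  le_of_plus : ∀ F, E F = F → δ * ‖F‖ ≤ ‖F + N F‖
  le_of_minus : ∀ F, E F = -F → δ * ‖F‖ ≤ ‖F - N F‖
  exists_small : ∃ f, f ≠ 0 ∧ N f = f ∧ ‖f + plusProj N (E f)‖ ≤ ε * ‖f‖
  exists_large : ∃ f, f ≠ 0 ∧ N f = f ∧ ‖f‖ ≤ ‖f + plusProj N (E f)‖

namespace IsReflectionPair

variable {C δ ε : ℝ}

theorem norm_compression_lt (h : IsReflectionPair E N C δ ε) : ‖compression N E‖ < 1 := by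
  obtain ⟨c, hc1, hc⟩ := h.contraction
  refine lt_of_le_of_lt (ContinuousLinearMap.opNorm_le_bound _ (le_max_right c 0) fun f => ?_)
    (max_lt hc1 one_pos)
  exact (hc f ((mem_plusSpace h.right_involutive).1 f.2)).trans
    (mul_le_mul_of_nonneg_right (le_max_left _ _) (norm_nonneg _))

/-- The double layer equation is twice the Dirichlet map after the classical ansatz. -/
theorem layer_apply (h : IsReflectionPair E N C δ ε) (f : plusSpace N) :
    (ContinuousLinearMap.id ℝ (plusSpace N) + compression N E) f =
      (2 : ℝ) • plusRestrict E N (plusRestrict N E f) := by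
  have hf := (mem_plusSpace h.right_involutive).1 f.2
  apply Subtype.ext
  change (f : H) + plusProj N (E f) = (2 : ℝ) • plusProj N (plusProj E f)
  rw [plusProj_apply E, map_smul, map_add, plusProj_of_eq hf, smul_smul]
  norm_num

theorem layer_isInvertible [CompleteSpace H] (h : IsReflectionPair E N C δ ε) :
    (ContinuousLinearMap.id ℝ (plusSpace N) + compression N E).IsInvertible := by
  have := completeSpace_plusSpace h.right_involutive
  exact isInvertible_id_add h.norm_compression_lt

theorem norm_le_dirichlet (h : IsReflectionPair E N C δ ε) (F : plusSpace E) :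
    ‖F‖ ≤ 2 / δ * ‖plusRestrict E N F‖ := by
  have h1 := h.le_of_plus F ((mem_plusSpace h.left_involutive).1 F.2)
  have h2 : ‖plusRestrict E N F‖ = 1 / 2 * ‖(F : H) + N F‖ := by
    rw [Submodule.coe_norm, coe_plusRestrict, plusProj_apply, norm_smul]
    norm_num
  have h3 := h.delta_pos
  rw [h2, div_mul_eq_mul_div, le_div_iff₀ h3, Submodule.coe_norm]
  linarith

/-- The minus part `F⁻` of a real `f` has the same imaginary part, up to sign, as
the plus part, so that it is controlled by the plus part. -/
theorem norm_le_ansatz (h : IsReflectionPair E N C δ ε) (f : plusSpace N) :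
    ‖f‖ ≤ 3 / δ * ‖plusRestrict N E f‖ := by
  have hf := (mem_plusSpace h.right_involutive).1 f.2
  set F : H := plusProj E f with hF
  set G : H := (1 / 2 : ℝ) • ((f : H) - E f) with hG
  have hsum : F + G = f := by
    rw [hF, hG, plusProj_apply, ← smul_add, add_add_sub_cancel, ← two_smul ℝ, smul_smul]
    norm_num
  have hEG : E G = -G := by
    rw [hG, map_smul, map_sub, h.left_involutive, ← smul_neg, neg_sub]
  have h1 := h.le_of_minus G hEG
  have h2 : G - N G = -(F - N F) := by
    have : N F + N G = F + G := by rw [← map_add, hsum, hf]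
    rw [← sub_eq_zero]
    linear_combination (norm := module) -this
  have hN : ‖N F‖ ≤ ‖F‖ := by
    simpa using N.le_of_opNorm_le h.norm_right F
  have h3 : ‖G - N G‖ ≤ 2 * ‖F‖ := by
    rw [h2, norm_neg]
    linarith [norm_sub_le F (N F)]
  have h4 : ‖(f : H)‖ ≤ ‖F‖ + ‖G‖ := by
    rw [← hsum]
    exact norm_add_le _ _
  have h5 := h.delta_pos
  have h6 := mul_le_mul_of_nonneg_right h.delta_le (norm_nonneg F)
  have h7 := mul_le_mul_of_nonneg_left h4 h5.le
  rw [Submodule.coe_norm, Submodule.coe_norm, coe_plusRestrict, ← hF, div_mul_eq_mul_div,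
    le_div_iff₀ h5]
  linarith

theorem dirichlet_injective (h : IsReflectionPair E N C δ ε) :
    Function.Injective (plusRestrict E N) := by
  rw [injective_iff_map_eq_zero]
  intro F hF
  have := h.norm_le_dirichlet F
  rw [hF, norm_zero, mul_zero] at this
  exact norm_le_zero_iff.1 this

/-- Surjectivity comes from the double layer equation, injectivity from the angle estimate. -/
theorem dirichlet_isInvertible [CompleteSpace H] (h : IsReflectionPair E N C δ ε) :
    (plusRestrict E N).IsInvertible := by
  have hL := h.layer_isInvertible
  set L := ContinuousLinearMap.id ℝ (plusSpace N) + compression N E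
  have hr (g : plusSpace N) : plusRestrict E N ((2 : ℝ) • plusRestrict N E (L.inverse g)) = g := by
    rw [map_smul, ← h.layer_apply, hL.self_apply_inverse]
  exact ContinuousLinearMap.IsInvertible.of_inverse
    (g := (2 : ℝ) • (plusRestrict N E).comp L.inverse) (ContinuousLinearMap.ext hr)
    (ContinuousLinearMap.ext fun F => h.dirichlet_injective (hr _))

theorem ansatz_isInvertible [CompleteSpace H] (h : IsReflectionPair E N C δ ε) :
    (plusRestrict N E).IsInvertible := by
  have hL := h.layer_isInvertible
  set L := ContinuousLinearMap.id ℝ (plusSpace N) + compression N E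
  refine ContinuousLinearMap.IsInvertible.of_inverse
    (g := (2 : ℝ) • L.inverse.comp (plusRestrict E N)) (ContinuousLinearMap.ext fun F => ?_)
    (ContinuousLinearMap.ext fun f => ?_)
  · apply h.dirichlet_injective
    change plusRestrict E N (plusRestrict N E ((2 : ℝ) • L.inverse (plusRestrict E N F))) = _
    rw [map_smul, map_smul, ← h.layer_apply, hL.self_apply_inverse]
    rfl
  · change (2 : ℝ) • L.inverse (plusRestrict E N (plusRestrict N E f)) = f
    rw [← map_smul, ← h.layer_apply, hL.inverse_apply_self]

theorem norm_dirichlet_inverse_le [CompleteSpace H] (h : IsReflectionPair E N C δ ε) :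
    ‖(plusRestrict E N).inverse‖ ≤ 2 / δ :=
  norm_inverse_le h.dirichlet_isInvertible (div_pos two_pos h.delta_pos).le h.norm_le_dirichlet

theorem norm_ansatz_inverse_le [CompleteSpace H] (h : IsReflectionPair E N C δ ε) :
    ‖(plusRestrict N E).inverse‖ ≤ 3 / δ :=
  norm_inverse_le h.ansatz_isInvertible (div_pos three_pos h.delta_pos).le h.norm_le_ansatz

theorem norm_layer_inverse_le_mul [CompleteSpace H] (h : IsReflectionPair E N C δ ε) :
    2 * ‖(ContinuousLinearMap.id ℝ (plusSpace N) + compression N E).inverse‖ ≤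
      ‖(plusRestrict N E).inverse‖ * ‖(plusRestrict E N).inverse‖ := by
  have hD := h.dirichlet_isInvertible
  have hA := h.ansatz_isInvertible
  have : ‖(ContinuousLinearMap.id ℝ (plusSpace N) + compression N E).inverse‖ ≤
      ‖(plusRestrict N E).inverse‖ * ‖(plusRestrict E N).inverse‖ / 2 := by
    refine norm_inverse_le h.layer_isInvertible (by positivity) fun f => ?_
    rw [h.layer_apply, norm_smul, Real.norm_two]
    have h1 := (plusRestrict N E).inverse.le_opNorm (plusRestrict N E f)
    have h2 := (plusRestrict E N).inverse.le_opNorm (plusRestrict E N (plusRestrict N E f))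
    rw [hA.inverse_apply_self] at h1
    rw [hD.inverse_apply_self] at h2
    have h3 := mul_le_mul_of_nonneg_left h2 (norm_nonneg (plusRestrict N E).inverse)
    linarith
  linarith

theorem norm_layer_inverse_le [CompleteSpace H] (h : IsReflectionPair E N C δ ε) :
    ‖(ContinuousLinearMap.id ℝ (plusSpace N) + compression N E).inverse‖ ≤ 3 / δ ^ 2 := by
  have h1 := h.norm_layer_inverse_le_mul
  have h2 := mul_le_mul h.norm_ansatz_inverse_le h.norm_dirichlet_inverse_le
    (ContinuousLinearMap.opNorm_nonneg _) (div_pos three_pos h.delta_pos).le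
  have h3 : 3 / δ * (2 / δ) = 2 * (3 / δ ^ 2) := by
    have := h.delta_pos.ne'
    field_simp
  linarith

theorem le_norm_layer_inverse [CompleteSpace H] (h : IsReflectionPair E N C δ ε) :
    1 / ε ≤ ‖(ContinuousLinearMap.id ℝ (plusSpace N) + compression N E).inverse‖ := by
  obtain ⟨f, hf, hNf, hle⟩ := h.exists_small
  rw [div_le_iff₀' h.eps_pos]
  exact le_mul_norm_inverse h.layer_isInvertible
    (x := ⟨f, (mem_plusSpace h.right_involutive).2 hNf⟩) (fun h0 => hf (congrArg Subtype.val h0)) hle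

/-- As the inverse of the double layer equation factors through the other two inverses, a lower
bound for it and an upper bound for one of them give a lower bound for the other. -/
theorem le_norm_dirichlet_inverse [CompleteSpace H] (h : IsReflectionPair E N C δ ε) :
    2 * δ / (3 * ε) ≤ ‖(plusRestrict E N).inverse‖ := by
  have h1 := h.norm_layer_inverse_le_mul
  have h2 := mul_le_mul_of_nonneg_right h.norm_ansatz_inverse_le
    (norm_nonneg (plusRestrict E N).inverse)
  have h3 := h.le_norm_layer_inverse
  have h4 := h.delta_pos
  have h5 := h.eps_pos
  have h6 : 2 * (1 / ε) ≤ 3 / δ * ‖(plusRestrict E N).inverse‖ := by linarith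
  have h7 := mul_le_mul_of_nonneg_left h6 (div_pos h4 three_pos).le
  calc 2 * δ / (3 * ε) = δ / 3 * (2 * (1 / ε)) := by field_simp
    _ ≤ _ := h7
    _ = _ := by field_simp

theorem le_norm_ansatz_inverse [CompleteSpace H] (h : IsReflectionPair E N C δ ε) :
    δ / ε ≤ ‖(plusRestrict N E).inverse‖ := by
  have h1 := h.norm_layer_inverse_le_mul
  have h2 := mul_le_mul_of_nonneg_left h.norm_dirichlet_inverse_le
    (norm_nonneg (plusRestrict N E).inverse)
  have h3 := h.le_norm_layer_inverse
  have h4 := h.delta_pos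
  have h5 := h.eps_pos
  have h6 : 2 * (1 / ε) ≤ ‖(plusRestrict N E).inverse‖ * (2 / δ) := by linarith
  have h7 := mul_le_mul_of_nonneg_left h6 (half_pos h4).le
  calc δ / ε = δ / 2 * (2 * (1 / ε)) := by field_simp
    _ ≤ _ := h7
    _ = _ := by field_simp

theorem norm_layer_le (h : IsReflectionPair E N C δ ε) :
    ‖ContinuousLinearMap.id ℝ (plusSpace N) + compression N E‖ ≤ 2 := by
  have h1 := norm_add_le (ContinuousLinearMap.id ℝ (plusSpace N)) (compression N E)
  have h2 := ContinuousLinearMap.norm_id_le (𝕜 := ℝ) (E := plusSpace N)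
  linarith [h.norm_compression_lt]

theorem one_le_norm_layer (h : IsReflectionPair E N C δ ε) :
    1 ≤ ‖ContinuousLinearMap.id ℝ (plusSpace N) + compression N E‖ := by
  obtain ⟨f, hf, hNf, hle⟩ := h.exists_large
  exact one_le_opNorm (x := ⟨f, (mem_plusSpace h.right_involutive).2 hNf⟩)
    (fun h0 => hf (congrArg Subtype.val h0))
    hle

theorem norm_plusRestrict_le {R S : H →L[ℝ] H} {C : ℝ} (hS : ‖S‖ ≤ C) :
    ‖plusRestrict R S‖ ≤ (1 + C) / 2 := by
  have hC : 0 ≤ C := (norm_nonneg _).trans hS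
  refine ContinuousLinearMap.opNorm_le_bound _ (by linarith) fun f => ?_
  rw [Submodule.coe_norm, Submodule.coe_norm, coe_plusRestrict, plusProj_apply, norm_smul]
  have h1 := norm_add_le (f : H) (S f)
  have h2 := S.le_of_opNorm_le hS (f : H)
  rw [Real.norm_of_nonneg (by norm_num)]
  linarith

theorem norm_layer_le_mul (h : IsReflectionPair E N C δ ε) :
    ‖ContinuousLinearMap.id ℝ (plusSpace N) + compression N E‖ ≤
      2 * (‖plusRestrict E N‖ * ‖plusRestrict N E‖) := by
  refine ContinuousLinearMap.opNorm_le_bound _ (by positivity) fun f => ?_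
  rw [h.layer_apply, norm_smul, Real.norm_two, mul_assoc, mul_assoc]
  refine mul_le_mul_of_nonneg_left ?_ two_pos.le
  exact (ContinuousLinearMap.le_opNorm _ _).trans
    (mul_le_mul_of_nonneg_left (ContinuousLinearMap.le_opNorm _ _) (norm_nonneg _))

theorem norm_dirichlet_le (h : IsReflectionPair E N C δ ε) : ‖plusRestrict E N‖ ≤ 1 := by
  have := norm_plusRestrict_le (R := E) h.norm_right
  linarith

theorem le_norm_dirichlet (h : IsReflectionPair E N C δ ε) : 1 / (1 + C) ≤ ‖plusRestrict E N‖ := by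
  have h1 := h.one_le_norm_layer.trans h.norm_layer_le_mul
  have h2 := mul_le_mul_of_nonneg_left (norm_plusRestrict_le (R := N) h.norm_left)
    (norm_nonneg (plusRestrict E N))
  have h3 := (norm_nonneg _).trans h.norm_left
  rw [div_le_iff₀ (by linarith)]
  linarith

theorem le_norm_ansatz (h : IsReflectionPair E N C δ ε) : 1 / 2 ≤ ‖plusRestrict N E‖ := by
  have h1 := h.one_le_norm_layer.trans h.norm_layer_le_mul
  have h2 := mul_le_mul_of_nonneg_right h.norm_dirichlet_le (norm_nonneg (plusRestrict N E))
  linarith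

end IsReflectionPair

end Reflections

/-! ### The boundary of the cone -/

section Boundary

variable {θ : ℝ}

theorem mul_exp_neg_im (θ : ℝ) (z : ℂ) : (z * Complex.exp (-(θ * Complex.I))).im =
    ‖z‖ * Real.sin (z.arg - θ) := by
  have h : z * Complex.exp (-(θ * Complex.I)) =
      ‖z‖ * Complex.exp (((z.arg - θ : ℝ) : ℂ) * Complex.I) := by
    conv_lhs => rw [← Complex.norm_mul_exp_arg_mul_I z, mul_assoc, ← Complex.exp_add]
    congr 2
    push_cast
    ring
  rw [h, Complex.im_ofReal_mul, Complex.exp_ofReal_mul_I_im]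

/-- The cone is the intersection of two half planes. -/
theorem cone_eq (hθ : θ ∈ Set.Ioo 0 Real.pi) :
    cone θ = {z : ℂ | 0 < z.im ∧ (z * Complex.exp (-(θ * Complex.I))).im < 0} := by
  ext z
  simp only [cone, Set.mem_ofPred_eq, mul_exp_neg_im]
  have hpi := Complex.arg_le_pi z
  have him : z.im = ‖z‖ * Real.sin z.arg := (Complex.norm_mul_sin_arg z).symm
  constructor
  · rintro ⟨h1, h2⟩
    have hz : 0 < ‖z‖ := norm_pos_iff.2 fun h => by simp [h] at h1
    refine ⟨?_, mul_neg_of_pos_of_neg hz (Real.sin_neg_of_neg_of_neg_pi_lt (by linarith)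
      (by linarith [hθ.2]))⟩
    rw [him]
    exact mul_pos hz (Real.sin_pos_of_pos_of_lt_pi h1 (by linarith [hθ.2]))
  · rintro ⟨h1, h2⟩
    have h0 : 0 < z.arg := by
      refine lt_of_le_of_ne (Complex.arg_nonneg_iff.2 h1.le) fun h => ?_
      rw [him, ← h, Real.sin_zero, mul_zero] at h1
      exact h1.false
    refine ⟨h0, ?_⟩
    by_contra hc
    have h3 := Real.sin_nonneg_of_nonneg_of_le_pi (x := z.arg - θ) (by linarith [not_lt.1 hc])
      (by linarith [hθ.1])
    exact absurd h2 (not_lt.2 (mul_nonneg (norm_nonneg z) h3))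

/-- Arc length parametrisation of the boundary of the cone, with the cone on its left: the
positive half-line is the edge on the real axis and the vertex is at `0`. -/
noncomputable def edge (θ t : ℝ) : ℂ :=
  if 0 < t then (t : ℂ) else -(t * Complex.exp (θ * Complex.I))

/-- The arc length parameter of a boundary point. -/
noncomputable def edgeInv (z : ℂ) : ℝ := if z.arg = 0 then ‖z‖ else -‖z‖

theorem edge_of_pos (θ : ℝ) {t : ℝ} (ht : 0 < t) : edge θ t = t := if_pos ht

theorem edge_of_nonpos (θ : ℝ) {t : ℝ} (ht : t ≤ 0) :
    edge θ t = -(t * Complex.exp (θ * Complex.I)) := if_neg ht.not_gt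

theorem arg_edge_of_pos (θ : ℝ) {t : ℝ} (ht : 0 < t) : (edge θ t).arg = 0 := by
  rw [edge_of_pos θ ht, Complex.arg_ofReal_of_nonneg ht.le]

theorem arg_edge_of_neg (hθ : θ ∈ Set.Ioo 0 Real.pi) {t : ℝ} (ht : t < 0) :
    (edge θ t).arg = θ := by
  have e : edge θ t = ((-t : ℝ) : ℂ) * Complex.exp (θ * Complex.I) := by
    rw [edge_of_nonpos θ ht.le]
    push_cast
    ring
  rw [e, Complex.arg_real_mul _ (by linarith), Complex.arg_exp_mul_I, toIocMod_eq_self]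
  exact ⟨by linarith [hθ.1, Real.pi_pos], by linarith [hθ.2, Real.pi_pos]⟩

theorem tangent_edge_of_pos (θ : ℝ) {t : ℝ} (ht : 0 < t) : tangent θ (edge θ t) = 1 :=
  if_pos (arg_edge_of_pos θ ht)

theorem tangent_edge_of_neg (hθ : θ ∈ Set.Ioo 0 Real.pi) {t : ℝ} (ht : t < 0) :
    tangent θ (edge θ t) = -Complex.exp (θ * Complex.I) :=
  if_neg (by rw [arg_edge_of_neg hθ ht]; exact hθ.1.ne')

theorem edgeInv_edge (hθ : θ ∈ Set.Ioo 0 Real.pi) (t : ℝ) : edgeInv (edge θ t) = t := by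
  rcases lt_trichotomy t 0 with h | rfl | h
  · rw [edgeInv, if_neg (by rw [arg_edge_of_neg hθ h]; exact hθ.1.ne'), edge_of_nonpos θ h.le,
      norm_neg, norm_mul, Complex.norm_exp_ofReal_mul_I, mul_one, Complex.norm_real,
      Real.norm_of_nonpos h.le, neg_neg]
  · simp [edge, edgeInv]
  · rw [edgeInv, if_pos (arg_edge_of_pos θ h), edge_of_pos θ h, Complex.norm_real,
      Real.norm_of_nonneg h.le]

theorem measurable_edge (θ : ℝ) : Measurable (edge θ) :=
  Measurable.ite measurableSet_Ioi (by fun_prop) (by fun_prop)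

theorem measurable_edgeInv : Measurable edgeInv :=
  Measurable.ite (measurableSet_eq_fun Complex.measurable_arg measurable_const) (by fun_prop)
    (by fun_prop)

theorem measurableEmbedding_edge (hθ : θ ∈ Set.Ioo 0 Real.pi) : MeasurableEmbedding (edge θ) :=
  (measurable_edge θ).measurableEmbedding (Function.LeftInverse.injective (edgeInv_edge hθ))

theorem edge_im_of_nonpos (θ : ℝ) {t : ℝ} (ht : t ≤ 0) :
    (edge θ t).im = -(t * Real.sin θ) := by
  rw [edge_of_nonpos θ ht, Complex.neg_im, Complex.im_ofReal_mul, Complex.exp_ofReal_mul_I_im]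

theorem frontier_cone (hθ : θ ∈ Set.Ioo 0 Real.pi) : frontier (cone θ) = Set.range (edge θ) := by
  have hsin := sin_pos_of_mem hθ
  have hexp := exp_neg_mul_exp θ
  have c1 : Continuous fun z : ℂ => z.im := Complex.continuous_im
  have c2 : Continuous fun z : ℂ => (z * Complex.exp (-(θ * Complex.I))).im := by fun_prop
  have hmul (r : ℝ) (w : ℂ) : ((r : ℂ) * w).im = r * w.im := Complex.im_ofReal_mul r w
  have himneg : (Complex.exp (-(θ * Complex.I))).im = -Real.sin θ := by
    rw [← neg_mul, ← Complex.ofReal_neg, Complex.exp_ofReal_mul_I_im, Real.sin_neg]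
  have hopen : IsOpen (cone θ) := by
    rw [cone_eq hθ]
    exact (isOpen_lt continuous_const c1).inter (isOpen_lt c2 continuous_const)
  have hcl : closure (cone θ) =
      {z : ℂ | 0 ≤ z.im ∧ (z * Complex.exp (-(θ * Complex.I))).im ≤ 0} := by
    apply subset_antisymm
    · refine closure_minimal (fun z hz => ?_)
        ((isClosed_le continuous_const c1).inter (isClosed_le c2 continuous_const))
      rw [cone_eq hθ] at hz
      exact ⟨hz.1.le, hz.2.le⟩
    · -- A point of the closed cone is approached along the direction of the bisector.
      rintro z ⟨h1, h2⟩
      have hlim : Tendsto (fun r : ℝ => z + r * Complex.exp (((θ / 2 : ℝ) : ℂ) * Complex.I)) (𝓝[>] 0)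
          (𝓝 z) := by
        have : Continuous fun r : ℝ => z + r * Complex.exp (((θ / 2 : ℝ) : ℂ) * Complex.I) := by
          fun_prop
        have h0 := this.tendsto 0
        simp only [Complex.ofReal_zero, zero_mul, add_zero] at h0
        exact h0.mono_left nhdsWithin_le_nhds
      refine mem_closure_of_tendsto hlim ?_
      filter_upwards [self_mem_nhdsWithin] with r (hr : 0 < r)
      have hs := sin_half_pos hθ
      have hp := mul_pos hr hs
      have e : Complex.exp (((θ / 2 : ℝ) : ℂ) * Complex.I) * Complex.exp (-(θ * Complex.I)) =
          Complex.exp (((-(θ / 2) : ℝ) : ℂ) * Complex.I) := by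
        rw [← Complex.exp_add]
        congr 1
        push_cast
        ring
      rw [cone_eq hθ]
      constructor
      · rw [Complex.add_im, hmul, Complex.exp_ofReal_mul_I_im]
        linarith
      · rw [add_mul, mul_assoc, e, Complex.add_im, hmul, Complex.exp_ofReal_mul_I_im, Real.sin_neg]
        linarith
  rw [hopen.frontier_eq, hcl, cone_eq hθ]
  ext z
  constructor
  · rintro ⟨⟨h1, h2⟩, h3⟩
    rcases h1.eq_or_lt with h0 | h0
    · have hz : ((z.re : ℝ) : ℂ) = z := Complex.ext rfl h0
      rw [← hz, hmul, himneg] at h2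
      have hre : 0 ≤ z.re := by nlinarith
      rcases hre.eq_or_lt with h4 | h4
      · refine ⟨0, ?_⟩
        rw [← hz, ← h4]
        simp [edge]
      · exact ⟨z.re, by rw [edge_of_pos θ h4, hz]⟩
    · have h4 : (z * Complex.exp (-(θ * Complex.I))).im = 0 :=
        le_antisymm h2 (not_lt.1 fun hc => h3 ⟨h0, hc⟩)
      set r := (z * Complex.exp (-(θ * Complex.I))).re with hr
      have h5 : (r : ℂ) = z * Complex.exp (-(θ * Complex.I)) := Complex.ext rfl h4.symm
      have hz : z = r * Complex.exp (θ * Complex.I) := by rw [h5, mul_assoc, hexp, mul_one]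
      have hr0 : 0 ≤ r := by
        rw [hz, hmul, Complex.exp_ofReal_mul_I_im] at h1
        nlinarith
      refine ⟨-r, ?_⟩
      rw [edge_of_nonpos θ (by linarith), hz]
      push_cast
      ring
  · rintro ⟨t, rfl⟩
    rcases le_or_gt t 0 with ht | ht
    · have e : edge θ t * Complex.exp (-(θ * Complex.I)) = ((-t : ℝ) : ℂ) := by
        rw [edge_of_nonpos θ ht, neg_mul, mul_assoc, mul_comm (Complex.exp _), hexp, mul_one]
        push_cast
        rfl
      have h0 : (edge θ t * Complex.exp (-(θ * Complex.I))).im = 0 := by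
        rw [e, Complex.ofReal_im]
      refine ⟨⟨?_, h0.le⟩, fun hc => h0.not_lt hc.2⟩
      rw [edge_im_of_nonpos θ ht]
      nlinarith
    · have h0 : (edge θ t).im = 0 := by rw [edge_of_pos θ ht, Complex.ofReal_im]
      refine ⟨⟨h0.ge, ?_⟩, fun hc => h0.not_gt hc.1⟩
      rw [edge_of_pos θ ht, hmul, himneg]
      nlinarith

theorem hausdorffMeasure_restrict_image {ι : ℝ → ℂ} (hι : Isometry ι) (A : Set ℝ)
    (hA : MeasurableSet A) :
    (Measure.hausdorffMeasure 1).restrict (ι '' A) = (volume.restrict A).map ι := by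
  have he : MeasurableEmbedding ι := hι.isClosedEmbedding.measurableEmbedding
  have h := hι.map_hausdorffMeasure (d := 1) (Or.inl zero_le_one)
  rw [hausdorffMeasure_real] at h
  have h2 := he.restrict_map (volume : Measure ℝ) (ι '' A)
  rw [Set.preimage_image_eq _ he.injective, h, Measure.restrict_restrict
    (he.measurableSet_image.2 hA), Set.inter_eq_left.2 (Set.image_subset_range _ _)] at h2
  exact h2

theorem arcLength_eq_map (hθ : θ ∈ Set.Ioo 0 Real.pi) : arcLength θ = volume.map (edge θ) := by
  have i1 : Isometry fun t : ℝ => (t : ℂ) := Complex.isometry_ofReal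
  have i2 : Isometry fun t : ℝ => -((t : ℂ) * Complex.exp (θ * Complex.I)) := by
    refine Isometry.of_dist_eq fun s t => ?_
    rw [dist_neg_neg, dist_eq_norm, ← sub_mul, norm_mul, Complex.norm_exp_ofReal_mul_I, mul_one,
      ← dist_eq_norm, Complex.isometry_ofReal.dist_eq]
  have e1 : edge θ '' Set.Ioi 0 = (fun t : ℝ => (t : ℂ)) '' Set.Ioi 0 :=
    Set.image_congr fun t ht => edge_of_pos θ ht
  have e2 : edge θ '' Set.Iic 0 =
      (fun t : ℝ => -((t : ℂ) * Complex.exp (θ * Complex.I))) '' Set.Iic 0 :=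
    Set.image_congr fun t ht => edge_of_nonpos θ ht
  have he := measurableEmbedding_edge hθ
  have hr : Set.range (edge θ) = edge θ '' Set.Iic 0 ∪ edge θ '' Set.Ioi 0 := by
    rw [← Set.image_union, Set.Iic_union_Ioi, Set.image_univ]
  have hd : Disjoint (edge θ '' Set.Iic 0) (edge θ '' Set.Ioi 0) :=
    (Set.disjoint_image_iff he.injective).2 (Set.Iic_disjoint_Ioi le_rfl)
  have hv : (volume : Measure ℝ) = volume.restrict (Set.Iic 0) + volume.restrict (Set.Ioi 0) := by
    rw [← Measure.restrict_union (Set.Iic_disjoint_Ioi le_rfl) measurableSet_Ioi,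
      Set.Iic_union_Ioi, Measure.restrict_univ]
  rw [arcLength, frontier_cone hθ, hr, Measure.restrict_union hd
    (he.measurableSet_image.2 measurableSet_Ioi), e1, e2,
    hausdorffMeasure_restrict_image i1 _ measurableSet_Ioi,
    hausdorffMeasure_restrict_image i2 _ measurableSet_Iic, hv, Measure.map_add _ _ he.measurable]
  rw [← hv]
  congr 1 <;> refine Measure.map_congr ?_
  · filter_upwards [ae_restrict_mem measurableSet_Iic] with t ht
    rw [edge_of_nonpos θ ht]
  · filter_upwards [ae_restrict_mem measurableSet_Ioi] with t ht
    rw [edge_of_pos θ ht]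

theorem measurePreserving_edge (hθ : θ ∈ Set.Ioo 0 Real.pi) :
    MeasurePreserving (edge θ) volume (arcLength θ) :=
  ⟨measurable_edge θ, (arcLength_eq_map hθ).symm⟩

theorem measurePreserving_edgeInv (hθ : θ ∈ Set.Ioo 0 Real.pi) :
    MeasurePreserving edgeInv (arcLength θ) volume := by
  refine ⟨measurable_edgeInv, ?_⟩
  rw [arcLength_eq_map hθ, Measure.map_map measurable_edgeInv (measurable_edge θ)]
  have : edgeInv ∘ edge θ = id := funext (edgeInv_edge hθ)
  rw [this, Measure.map_id]

theorem ae_arcLength_iff (hθ : θ ∈ Set.Ioo 0 Real.pi) {p : ℂ → Prop} :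
    (∀ᵐ z ∂(arcLength θ), p z) ↔ ∀ᵐ t, p (edge θ t) := by
  rw [arcLength_eq_map hθ, (measurableEmbedding_edge hθ).ae_map_iff]

end Boundary

/-! ### From the line to the boundary of the cone -/

theorem integrable_indicator_mul_inv (f : LineL2) {ε : ℝ} (hε : 0 < ε) (t : ℝ) :
    Integrable ({s : ℝ | ε < |s - t|}.indicator fun s => f s * ((s : ℂ) - t)⁻¹) := by
  have hS : MeasurableSet {s : ℝ | ε < |s - t|} := measurableSet_lt measurable_const (by fun_prop)
  have hi := LineL2.integrable_mul_res f (z := t + ε * Complex.I) (by simp [hε.ne'])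
  refine (hi.norm.const_mul 2).mono' (((LineL2.memLp f).aestronglyMeasurable.mul
    (Measurable.aestronglyMeasurable (by fun_prop))).indicator hS) (Eventually.of_forall fun s => ?_)
  by_cases h : ε < |s - t|
  · have hs : 0 < |s - t| := hε.trans h
    have h0 : 0 < ‖(s : ℂ) - (t + ε * Complex.I)‖ :=
      norm_pos_iff.2 (ofReal_sub_ne_zero (by simp [hε.ne']) s)
    have h1 : ‖(s : ℂ) - t‖ = |s - t| := by
      rw [← Complex.ofReal_sub, Complex.norm_real, Real.norm_eq_abs]
    have h2 : ‖(s : ℂ) - (t + ε * Complex.I)‖ ≤ 2 * |s - t| := by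
      have := norm_sub_le ((s : ℂ) - t) (ε * Complex.I)
      rw [norm_mul, Complex.norm_I, mul_one, Complex.norm_real, Real.norm_of_nonneg hε.le, h1] at this
      rw [← sub_sub]
      linarith
    rw [Set.indicator_of_mem (by exact h), norm_mul, norm_mul, mul_left_comm, res, norm_inv, norm_inv,
      h1]
    refine mul_le_mul_of_nonneg_left ?_ (norm_nonneg _)
    rw [← div_eq_mul_inv, inv_le_comm₀ hs (by positivity), inv_div]
    linarith
  · rw [Set.indicator_of_notMem (by exact h), norm_zero]
    positivity

section Transfer

variable {θ : ℝ}

theorem norm_tangent (θ : ℝ) (w : ℂ) : ‖tangent θ w‖ = 1 := by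
  unfold tangent
  split_ifs
  · exact norm_one
  · rw [norm_neg, Complex.norm_exp_ofReal_mul_I]

/-- After division by the tangent, the Cauchy kernel with pole at the boundary point `t` becomes the
kernel `(s - t)⁻¹` on the own edge and the kernel with pole `oppPole θ t` on the opposite edge. -/
theorem edge_sub_edge_of_pos (hθ : θ ∈ Set.Ioo 0 Real.pi) {t : ℝ} (ht : 0 < t) {s : ℝ} :
    (0 < s → edge θ s - edge θ t = tangent θ (edge θ s) * (s - t)) ∧
      (s < 0 → edge θ s - edge θ t = tangent θ (edge θ s) * (s - oppPole θ t)) := by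
  have hexp := exp_neg_mul_exp θ
  refine ⟨fun hs => ?_, fun hs => ?_⟩
  · rw [tangent_edge_of_pos θ hs, edge_of_pos θ hs, edge_of_pos θ ht, one_mul]
  · rw [tangent_edge_of_neg hθ hs, edge_of_nonpos θ hs.le, edge_of_pos θ ht, oppPole_of_pos θ ht]
    linear_combination (t : ℂ) * hexp

theorem edge_sub_edge_of_neg (hθ : θ ∈ Set.Ioo 0 Real.pi) {t : ℝ} (ht : t < 0) {s : ℝ} :
    (s < 0 → edge θ s - edge θ t = tangent θ (edge θ s) * (s - t)) ∧
      (0 < s → edge θ s - edge θ t = tangent θ (edge θ s) * (s - oppPole θ t)) := by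
  refine ⟨fun hs => ?_, fun hs => ?_⟩
  · rw [tangent_edge_of_neg hθ hs, edge_of_nonpos θ hs.le, edge_of_nonpos θ ht.le]
    ring
  · rw [tangent_edge_of_pos θ hs, edge_of_pos θ hs, edge_of_nonpos θ ht.le, oppPole_of_neg θ ht]
    ring

theorem truncCauchy_edge (hθ : θ ∈ Set.Ioo 0 Real.pi) (ε : ℝ) (f : ℂ → ℂ) (t : ℝ) :
    truncCauchy θ ε f (edge θ t) = (Real.pi * Complex.I)⁻¹ *
      ∫ s, {s : ℝ | ε < ‖edge θ s - edge θ t‖}.indicator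
        (fun s => f (edge θ s) / (edge θ s - edge θ t) * tangent θ (edge θ s)) s := by
  have hm := measurable_edge θ
  rw [truncCauchy, arcLength_eq_map hθ, one_div,
    ← integral_indicator (measurableSet_lt measurable_const (by fun_prop)),
    (measurableEmbedding_edge hθ).integral_map]
  rfl

/-- Principal value Cauchy integrals on the cone: the own edge `A` contributes a
Hilbert transform, and on the opposite edge `B` the truncation is eventually void. -/
theorem tendsto_truncCauchy (hθ : θ ∈ Set.Ioo 0 Real.pi) {f : ℂ → ℂ} {F : LineL2}
    (hF : ∀ᵐ s, f (edge θ s) = F s) {A B : Set ℝ} (hA : MeasurableSet A) (hB : MeasurableSet B)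
    (hAB : Disjoint A B) (hcov : ∀ᵐ s : ℝ, s ∈ A ∨ s ∈ B) {t : ℝ} (ht : t ≠ 0)
    (hown : ∀ s ∈ A, edge θ s - edge θ t = tangent θ (edge θ s) * (s - t))
    (hopp : ∀ s ∈ B, edge θ s - edge θ t = tangent θ (edge θ s) * (s - oppPole θ t))
    (hlim : Tendsto (fun ε : ℝ => ∫ s in {s : ℝ | ε < |s - t|}, cutoff A hA F s * ((s : ℂ) - t)⁻¹)
      (𝓝[>] 0) (𝓝 (Real.pi * Complex.I * lineHilbert (cutoff A hA F) t))) :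
    Tendsto (fun ε : ℝ => truncCauchy θ ε f (edge θ t)) (𝓝[>] 0)
      (𝓝 (lineHilbert (cutoff A hA F) t +
        (Real.pi * Complex.I)⁻¹ * ∫ s, cutoff B hB F s * res (oppPole θ t) s)) := by
  have hpi : (Real.pi : ℂ) * Complex.I ≠ 0 :=
    mul_ne_zero (by exact_mod_cast Real.pi_ne_zero) Complex.I_ne_zero
  have him := oppPole_im_pos hθ ht
  have h1 := (hlim.add_const (∫ s, cutoff B hB F s * res (oppPole θ t) s)).const_mul
    (Real.pi * Complex.I)⁻¹
  rw [mul_add, inv_mul_cancel_left₀ hpi] at h1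
  refine h1.congr' ?_
  filter_upwards [Ioo_mem_nhdsGT him] with ε hε
  have hS : MeasurableSet {s : ℝ | ε < |s - t|} := measurableSet_lt measurable_const (by fun_prop)
  rw [truncCauchy_edge hθ, ← integral_indicator hS,
    ← integral_add (integrable_indicator_mul_inv _ hε.1 t) (LineL2.integrable_mul_res _ him.ne')]
  congr 1
  refine integral_congr_ae ?_
  filter_upwards [hF, coeFn_cutoff A hA F, coeFn_cutoff B hB F, hcov] with s h1 h2 h3 h4
  have htan : tangent θ (edge θ s) ≠ 0 := norm_ne_zero_iff.1 (by rw [norm_tangent]; norm_num)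
  rcases h4 with h4 | h4
  · have h5 : s ∉ B := hAB.notMem_of_mem_left h4
    have hn : ‖edge θ s - edge θ t‖ = |s - t| := by
      rw [hown s h4, norm_mul, norm_tangent, one_mul, ← Complex.ofReal_sub, Complex.norm_real,
        Real.norm_eq_abs]
    rw [h3, Set.indicator_of_notMem h5, zero_mul, add_zero]
    by_cases h : ε < |s - t|
    · rw [Set.indicator_of_mem (by exact h), Set.indicator_of_mem (by rw [← hn] at h; exact h), h1,
        h2, Set.indicator_of_mem h4, hown s h4]
      rw [div_mul_eq_mul_div, mul_comm (F s) (tangent θ _),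
        mul_div_mul_left _ _ htan, div_eq_mul_inv]
    · rw [Set.indicator_of_notMem (by exact h), Set.indicator_of_notMem (by rw [← hn] at h; exact h)]
  · have h5 : s ∉ A := hAB.notMem_of_mem_right h4
    have hn : ε < ‖edge θ s - edge θ t‖ := by
      rw [hopp s h4, norm_mul, norm_tangent, one_mul]
      have := Complex.abs_im_le_norm ((s : ℂ) - oppPole θ t)
      rw [Complex.sub_im, Complex.ofReal_im, zero_sub, abs_neg, abs_of_pos him] at this
      exact hε.2.trans_le this
    have h6 : {s : ℝ | ε < |s - t|}.indicator (fun s => cutoff A hA F s * ((s : ℂ) - t)⁻¹) s = 0 := by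
      refine Set.indicator_apply_eq_zero.2 fun _ => ?_
      rw [h2, Set.indicator_of_notMem h5, zero_mul]
    rw [h6, zero_add, h3, Set.indicator_of_mem h4, Set.indicator_of_mem (by exact hn), h1, hopp s h4,
      res, div_mul_eq_mul_div, mul_comm (F s) (tangent θ _),
      mul_div_mul_left _ _ htan, div_eq_mul_inv]

/-- Composition with the arc length parametrisation. -/
noncomputable def toLine (hθ : θ ∈ Set.Ioo 0 Real.pi) : BdryL2 θ →ₗᵢ[ℝ] LineL2 :=
  Lp.compMeasurePreservingₗᵢ ℝ (edge θ) (measurePreserving_edge hθ)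

/-- Composition with the arc length parameter. -/
noncomputable def ofLine (hθ : θ ∈ Set.Ioo 0 Real.pi) : LineL2 →ₗᵢ[ℝ] BdryL2 θ :=
  Lp.compMeasurePreservingₗᵢ ℝ edgeInv (measurePreserving_edgeInv hθ)

theorem coeFn_toLine (hθ : θ ∈ Set.Ioo 0 Real.pi) (f : BdryL2 θ) :
    ∀ᵐ t, toLine hθ f t = f (edge θ t) :=
  Lp.coeFn_compMeasurePreserving f (measurePreserving_edge hθ)

theorem coeFn_ofLine (hθ : θ ∈ Set.Ioo 0 Real.pi) (g : LineL2) :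
    ∀ᵐ t, ofLine hθ g (edge θ t) = g t := by
  have h := Lp.coeFn_compMeasurePreserving g (measurePreserving_edgeInv hθ)
  have h2 := (ae_arcLength_iff hθ).1 h
  filter_upwards [h2] with t ht
  have : ofLine hθ g (edge θ t) = g (edgeInv (edge θ t)) := ht
  rw [this, edgeInv_edge hθ]

theorem toLine_ofLine (hθ : θ ∈ Set.Ioo 0 Real.pi) (g : LineL2) : toLine hθ (ofLine hθ g) = g := by
  apply Lp.ext
  filter_upwards [coeFn_toLine hθ (ofLine hθ g), coeFn_ofLine hθ g] with t h1 h2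
  rw [h1, h2]

/-- The Cauchy operator of the cone, transplanted from the line. -/
noncomputable def coneCauchy (hθ : θ ∈ Set.Ioo 0 Real.pi) : BdryL2 θ →L[ℝ] BdryL2 θ :=
  (ofLine hθ).toContinuousLinearMap.comp
    (((flatCauchy hθ).restrictScalars ℝ).comp (toLine hθ).toContinuousLinearMap)

theorem isPVCauchy_coneCauchy (hθ : θ ∈ Set.Ioo 0 Real.pi) (f : BdryL2 θ) :
    IsPVCauchy θ f (coneCauchy hθ f) := by
  rw [IsPVCauchy, ae_arcLength_iff hθ]
  set F := toLine hθ f with hF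
  have hcoe : ∀ᵐ s, f (edge θ s) = F s := (coeFn_toLine hθ f).mono fun s hs => hs.symm
  have hcov : ∀ᵐ s : ℝ, s ∈ Set.Ioi (0 : ℝ) ∨ s ∈ Set.Iio (0 : ℝ) := by
    filter_upwards [ae_ne_zero] with s hs
    exact hs.lt_or_gt.symm
  filter_upwards [coeFn_ofLine hθ (flatCauchy hθ F), coeFn_flatCauchy_of_pos hθ F,
    coeFn_flatCauchy_of_neg hθ F, ae_tendsto_truncated_integral (cutPos F),
    ae_tendsto_truncated_integral (cutNeg F), ae_ne_zero] with t h1 hp hn tp tn ht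
  have e : coneCauchy hθ f (edge θ t) = flatCauchy hθ F t := h1
  rw [e]
  rcases ht.lt_or_gt with h | h
  · rw [hn h]
    exact tendsto_truncCauchy hθ hcoe measurableSet_Iio measurableSet_Ioi disjoint_Ioi_Iio.symm
      (hcov.mono fun s => Or.symm) ht (fun s hs => (edge_sub_edge_of_neg hθ h).1 hs)
      (fun s hs => (edge_sub_edge_of_neg hθ h).2 hs) tn
  · rw [hp h]
    exact tendsto_truncCauchy hθ hcoe measurableSet_Ioi measurableSet_Iio disjoint_Ioi_Iio
      hcov ht (fun s hs => (edge_sub_edge_of_pos hθ h).1 hs)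
      (fun s hs => (edge_sub_edge_of_pos hθ h).2 hs) tp

theorem IsPVCauchy.unique {f g g' : BdryL2 θ} (h : IsPVCauchy θ f g) (h' : IsPVCauchy θ f g') :
    g = g' := by
  apply Lp.ext
  filter_upwards [h, h'] with z h1 h2
  exact tendsto_nhds_unique h1 h2

theorem isPVCauchy_cauchyOp (hθ : θ ∈ Set.Ioo 0 Real.pi) (f : BdryL2 θ) :
    IsPVCauchy θ f (cauchyOp θ f) :=
  Classical.epsilon_spec (p := fun T : BdryL2 θ →L[ℝ] BdryL2 θ => ∀ f, IsPVCauchy θ f (T f))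
    ⟨coneCauchy hθ, isPVCauchy_coneCauchy hθ⟩ f

theorem toLine_cauchyOp (hθ : θ ∈ Set.Ioo 0 Real.pi) (f : BdryL2 θ) :
    toLine hθ (cauchyOp θ f) = flatCauchy hθ (toLine hθ f) := by
  rw [(isPVCauchy_cauchyOp hθ f).unique (isPVCauchy_coneCauchy hθ f)]
  exact toLine_ofLine hθ _

theorem toLine_conjOp (hθ : θ ∈ Set.Ioo 0 Real.pi) (f : BdryL2 θ) :
    toLine hθ (conjOp θ f) = lineConj (toLine hθ f) := by
  have h := (ae_arcLength_iff hθ).1 (ContinuousLinearMap.coeFn_compLpL (p := 2) (μ := arcLength θ)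
    (Complex.conjCLE : ℂ →L[ℝ] ℂ) f)
  apply Lp.ext
  filter_upwards [h, coeFn_toLine hθ (conjOp θ f), coeFn_toLine hθ f,
    coeFn_lineConj (toLine hθ f)] with t h1 h2 h3 h4
  rw [h2, h4, h3]
  exact h1

/-- For a real function, `Re (E f)` is the double layer potential of the kernel on the line. -/
theorem toLine_plusProj_cauchyOp (hθ : θ ∈ Set.Ioo 0 Real.pi) {f : BdryL2 θ}
    (hf : lineConj (toLine hθ f) = toLine hθ f) :
    toLine hθ (plusProj (conjOp θ) (cauchyOp θ f)) = flatDoubleLayer hθ (toLine hθ f) := by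
  have h := flatCauchy_add_conj hθ (toLine hθ f)
  rw [hf] at h
  rw [plusProj_apply, map_smul, map_add, toLine_conjOp, toLine_cauchyOp, h,
    two_smul ℂ, ← two_smul ℝ, smul_smul]
  norm_num

/-- The properties of the Cauchy operator and of conjugation that determine the conditioning, with
explicit constants. -/
theorem isReflectionPair_cone (h0 : 0 < θ) (h1 : θ ≤ 1) :
    IsReflectionPair (cauchyOp θ) (conjOp θ) 14 (θ / 10) (θ ^ 2) := by
  have hpi := Real.pi_gt_three
  have hθ : θ ∈ Set.Ioo 0 Real.pi := ⟨h0, by linarith⟩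
  have hinj := (toLine hθ).injective
  have hnorm (f : BdryL2 θ) : ‖toLine hθ f‖ = ‖f‖ := (toLine hθ).norm_map f
  have hcos : Real.cos (θ / 2) < 1 := by
    rw [← Real.cos_zero]
    exact Real.cos_lt_cos_of_nonneg_of_le_pi le_rfl (by linarith) (by linarith)
  -- Jordan's inequality gives `sin (θ/2) ≥ θ/π`, and `3 π < 10`.
  have hsin : 3 * (θ / 10) ≤ Real.sin (θ / 2) := by
    have h2 := Real.mul_le_sin (x := θ / 2) (by linarith) (by linarith)
    have h3 : 2 / Real.pi * (θ / 2) = θ / Real.pi := by field_simp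
    have h4 : θ / (10 / 3) ≤ θ / Real.pi :=
      div_le_div_of_nonneg_left h0.le Real.pi_pos (by linarith [Real.pi_lt_d2])
    linarith
  -- The Rellich estimate on either eigenspace of the Cauchy operator.
  have hrellich {F : BdryL2 θ} {c : ℂ} (hc : c ≠ 0)
      (hF : flatCauchy hθ (toLine hθ F) = c • toLine hθ F) :
      θ / 10 * ‖F‖ ≤ ‖F + conjOp θ F‖ ∧ θ / 10 * ‖F‖ ≤ ‖F - conjOp θ F‖ := by
    have h2 := sin_mul_norm_le_of_flatPairing_eq_zero hθ (flatPairing_self_eq_zero hθ hc hF)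
    rw [← toLine_conjOp, ← map_add, ← map_sub, hnorm, hnorm, hnorm] at h2
    have h3 := mul_le_mul_of_nonneg_right hsin (norm_nonneg F)
    constructor <;> linarith [h2.1, h2.2]
  -- Transfer of a real test function from the line to the boundary of the cone.
  have hback {f : LineL2} (hf : lineConj f = f) : f ≠ 0 → ofLine hθ f ≠ 0 ∧
      conjOp θ (ofLine hθ f) = ofLine hθ f ∧
      ‖ofLine hθ f + plusProj (conjOp θ) (cauchyOp θ (ofLine hθ f))‖ =
        ‖f + flatDoubleLayer hθ f‖ ∧ ‖ofLine hθ f‖ = ‖f‖ := by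
    have e := toLine_ofLine hθ f
    intro hne
    refine ⟨fun h => hne ?_, hinj ?_, ?_, (ofLine hθ).norm_map f⟩
    · rw [← e, h, map_zero]
    · rw [toLine_conjOp, e, hf]
    · rw [← hnorm, map_add, toLine_plusProj_cauchyOp hθ (by rw [e, hf]), e]
  refine ⟨fun f => hinj ?_, fun f => hinj ?_, ?_, ?_, by linarith, by linarith, by positivity,
    ⟨Real.cos (θ / 2), hcos, fun f hf => ?_⟩, fun F hF => ?_, fun F hF => ?_, ?_, ?_⟩
  · rw [toLine_cauchyOp, toLine_cauchyOp, flatCauchy_flatCauchy]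
  · rw [toLine_conjOp, toLine_conjOp, lineConj_lineConj]
  · refine ContinuousLinearMap.opNorm_le_bound _ (by norm_num) fun f => ?_
    rw [← hnorm, ← hnorm f, toLine_cauchyOp]
    exact norm_flatCauchy_le hθ _
  · refine ContinuousLinearMap.opNorm_le_bound _ zero_le_one fun f => ?_
    rw [← hnorm, ← hnorm f, toLine_conjOp, norm_lineConj, one_mul]
  · rw [← hnorm, ← hnorm f, toLine_plusProj_cauchyOp hθ (by rw [← toLine_conjOp, hf])]
    exact norm_flatDoubleLayer_le hθ _
  · refine (hrellich (c := 1) one_ne_zero ?_).1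
    rw [← toLine_cauchyOp, hF, one_smul]
  · refine (hrellich (c := -1) (by norm_num) ?_).2
    rw [← toLine_cauchyOp, hF, map_neg, neg_one_smul]
  · obtain ⟨f, hf, hc, hle⟩ := exists_norm_add_flatDoubleLayer_le hθ h1
    obtain ⟨e1, e2, e3, e4⟩ := hback hc hf
    exact ⟨ofLine hθ f, e1, e2, by rwa [e3, e4]⟩
  · obtain ⟨f, hf, hc, hle⟩ := exists_le_norm_add_flatDoubleLayer hθ
    obtain ⟨e1, e2, e3, e4⟩ := hback hc hf
    exact ⟨ofLine hθ f, e1, e2, by rwa [e3, e4]⟩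

end Transfer

/-! ### Asymptotics -/

section Asymptotics

theorem isTheta_of_bounds {a b : ℝ → ℝ} {c C : ℝ} (hc : 0 < c)
    (h : ∀ᶠ θ in 𝓝[>] (0 : ℝ), 0 ≤ b θ ∧ c * b θ ≤ a θ ∧ a θ ≤ C * b θ) : a =Θ[𝓝[>] 0] b := by
  constructor
  · refine IsBigO.of_bound C ?_
    filter_upwards [h] with θ h
    rw [Real.norm_of_nonneg ((mul_nonneg hc.le h.1).trans h.2.1), Real.norm_of_nonneg h.1]
    exact h.2.2
  · refine IsBigO.of_bound c⁻¹ ?_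
    filter_upwards [h] with θ h
    rw [Real.norm_of_nonneg ((mul_nonneg hc.le h.1).trans h.2.1), Real.norm_of_nonneg h.1,
      inv_mul_eq_div, le_div_iff₀' hc]
    exact h.2.1

/-- Operators of norm comparable to `1` have a condition number comparable to the norm of
the inverse. -/
theorem isTheta_condNumber {X Y : ℝ → Type*} [∀ θ, NormedAddCommGroup (X θ)]
    [∀ θ, NormedSpace ℝ (X θ)] [∀ θ, NormedAddCommGroup (Y θ)] [∀ θ, NormedSpace ℝ (Y θ)]
    {T : ∀ θ, X θ →L[ℝ] Y θ} {b : ℝ → ℝ} {c C : ℝ} (hc : 0 < c)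
    (h : ∀ᶠ θ in 𝓝[>] (0 : ℝ), c ≤ ‖T θ‖ ∧ ‖T θ‖ ≤ C)
    (hb : (fun θ => ‖(T θ).inverse‖) =Θ[𝓝[>] 0] b) :
    (fun θ => condNumber (T θ)) =Θ[𝓝[>] 0] b := by
  have h1 : (fun θ => ‖T θ‖) =Θ[𝓝[>] 0] fun _ => (1 : ℝ) :=
    isTheta_of_bounds hc (h.mono fun θ h =>
      ⟨zero_le_one, (mul_one c).trans_le h.1, h.2.trans_eq (mul_one C).symm⟩)
  have h2 := h1.mul hb
  simp only [one_mul] at h2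
  exact h2

theorem eventually_isReflectionPair : ∀ᶠ θ in 𝓝[>] (0 : ℝ),
    0 < θ ∧ IsReflectionPair (cauchyOp θ) (conjOp θ) 14 (θ / 10) (θ ^ 2) := by
  filter_upwards [Ioc_mem_nhdsGT one_pos] with θ h
  exact ⟨h.1, isReflectionPair_cone h.1 h.2⟩

theorem isTheta_layerEq_inverse :
    (fun θ : ℝ => ‖(layerEq θ).inverse‖) =Θ[𝓝[>] 0] fun θ => 1 / θ ^ 2 := by
  refine isTheta_of_bounds (c := 1) (C := 300) one_pos ?_
  filter_upwards [eventually_isReflectionPair] with θ ⟨h0, h⟩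
  refine ⟨by positivity, (one_mul _).trans_le h.le_norm_layer_inverse,
    h.norm_layer_inverse_le.trans_eq ?_⟩
  field_simp
  norm_num

theorem isTheta_dirichletMap_inverse :
    (fun θ : ℝ => ‖(dirichletMap θ).inverse‖) =Θ[𝓝[>] 0] fun θ => 1 / θ := by
  refine isTheta_of_bounds (c := 1 / 15) (C := 20) (by norm_num) ?_
  filter_upwards [eventually_isReflectionPair] with θ ⟨h0, h⟩
  refine ⟨by positivity, le_trans (le_of_eq ?_) h.le_norm_dirichlet_inverse,
    h.norm_dirichlet_inverse_le.trans_eq ?_⟩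
  · field_simp
    norm_num
  · field_simp
    norm_num

theorem isTheta_ansatzMap_inverse :
    (fun θ : ℝ => ‖(ansatzMap θ).inverse‖) =Θ[𝓝[>] 0] fun θ => 1 / θ := by
  refine isTheta_of_bounds (c := 1 / 10) (C := 30) (by norm_num) ?_
  filter_upwards [eventually_isReflectionPair] with θ ⟨h0, h⟩
  refine ⟨by positivity, le_trans (le_of_eq ?_) h.le_norm_ansatz_inverse,
    h.norm_ansatz_inverse_le.trans_eq ?_⟩
  · field_simp
  · field_simp
    norm_num

end Asymptotics

end ConeCauchy

theorem mainTheorem4 :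
    (∀ᶠ θ in 𝓝[>] (0 : ℝ),
      (∀ f : ConeCauchy.BdryL2 θ, ConeCauchy.IsPVCauchy θ f (ConeCauchy.cauchyOp θ f)) ∧
      (∀ f : ConeCauchy.BdryL2 θ, ConeCauchy.cauchyOp θ (ConeCauchy.cauchyOp θ f) = f) ∧
      (ConeCauchy.layerEq θ).IsInvertible ∧
      (ConeCauchy.dirichletMap θ).IsInvertible ∧
      (ConeCauchy.ansatzMap θ).IsInvertible) ∧
    ((fun θ : ℝ => ‖(ConeCauchy.layerEq θ).inverse‖) =Θ[𝓝[>] 0] fun θ => 1 / θ ^ 2) ∧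
    ((fun θ : ℝ => ‖(ConeCauchy.dirichletMap θ).inverse‖) =Θ[𝓝[>] 0] fun θ => 1 / θ) ∧
    ((fun θ : ℝ => ‖(ConeCauchy.ansatzMap θ).inverse‖) =Θ[𝓝[>] 0] fun θ => 1 / θ) ∧
    (∃ C : ℝ, ∀ᶠ θ in 𝓝[>] (0 : ℝ),
      ‖ConeCauchy.cauchyOp θ‖ ≤ C ∧ ‖ConeCauchy.conjOp θ‖ ≤ C ∧ ‖ConeCauchy.doubleLayer θ‖ ≤ C) ∧
    ((fun θ : ℝ => ConeCauchy.condNumber (ConeCauchy.layerEq θ)) =Θ[𝓝[>] 0] fun θ => 1 / θ ^ 2) ∧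
    ((fun θ : ℝ => ConeCauchy.condNumber (ConeCauchy.dirichletMap θ)) =Θ[𝓝[>] 0]
      fun θ => 1 / θ) ∧
    ((fun θ : ℝ => ConeCauchy.condNumber (ConeCauchy.ansatzMap θ)) =Θ[𝓝[>] 0]
      fun θ => 1 / θ) := by
  refine ⟨?_, ConeCauchy.isTheta_layerEq_inverse, ConeCauchy.isTheta_dirichletMap_inverse,
    ConeCauchy.isTheta_ansatzMap_inverse, ⟨14, ?_⟩, ?_, ?_, ?_⟩
  · filter_upwards [ConeCauchy.eventually_isReflectionPair, Ioo_mem_nhdsGT Real.pi_pos]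
      with θ ⟨_, h⟩ hθ
    exact ⟨ConeCauchy.isPVCauchy_cauchyOp hθ, h.left_involutive, h.layer_isInvertible,
      h.dirichlet_isInvertible, h.ansatz_isInvertible⟩
  · filter_upwards [ConeCauchy.eventually_isReflectionPair] with θ ⟨_, h⟩
    exact ⟨h.norm_left, h.norm_right.trans (by norm_num),
      h.norm_compression_lt.le.trans (by norm_num)⟩
  · exact ConeCauchy.isTheta_condNumber (c := 1) (C := 2) one_pos
      (ConeCauchy.eventually_isReflectionPair.mono fun θ h =>
        ⟨h.2.one_le_norm_layer, h.2.norm_layer_le⟩) ConeCauchy.isTheta_layerEq_inverse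
  · exact ConeCauchy.isTheta_condNumber (c := 1 / (1 + 14)) (C := 1) (by norm_num)
      (ConeCauchy.eventually_isReflectionPair.mono fun θ h =>
        ⟨h.2.le_norm_dirichlet, h.2.norm_dirichlet_le⟩) ConeCauchy.isTheta_dirichletMap_inverse
  · exact ConeCauchy.isTheta_condNumber (c := 1 / 2) (C := (1 + 14) / 2) (by norm_num)
      (ConeCauchy.eventually_isReflectionPair.mono fun θ h =>
        ⟨h.2.le_norm_ansatz, ConeCauchy.IsReflectionPair.norm_plusRestrict_le h.2.norm_left⟩)
      ConeCauchy.isTheta_ansatzMap_inverse
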